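/- Let $n\ge i\ge 2$ and let $a_1,\dots,a_n,b_1,\dots,b_{n-1}\in\mathbb C$. Let $\mathfrak g$ be of type $B_n$, $C_n$ or $D_n$, with Chevalley generators $e_j,f_j$, simple coroots $h_j$, simple roots $\alpha_j$ and fundamental weights $\Lambda_j^{(n)}$ ($1\le j\le n$); the node $n$ is the short root in type $B_n$, the long root in type $C_n$, and is joined to $n-2$ in type $D_n$. Put $x_j(c)=\exp(c\,e_j)$. A weight $\mu$ is *lower* than $\lambda$ if $\lambda-\mu$ is a nonzero sum of simple roots. The fundamental representations are realized as follows; Lie algebra elements act on tensor products as derivations. *Spin modules.* Let $V_{sp}^{(n)}$ have the basis of all sign sequences $\epsilon=(\epsilon_1,\dots,\epsilon_n)$, $\epsilon_j\in\{+,-\}$. For $j<n$ (types $B_n$, $D_n$), $e_j$ changes $(\epsilon_j,\epsilon_{j+1})=(-,+)$ into $(+,-)$, and $h_j\epsilon=\frac{\epsilon_j-\epsilon_{j+1}}2\epsilon$. In type $B_n$, $e_n$ changes $\epsilon_n=-$ into $+$, and $h_n\epsilon=\epsilon_n\epsilon$. In type $D_n$, $e_n$ changes $(\epsilon_{n-1},\epsilon_n)=(-,-)$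 into $(+,+)$, and $h_n\epsilon=\frac{\epsilon_{n-1}+\epsilon_n}2\epsilon$. The $f_j$ are the reverse changes; in all other cases the result is $0$. Let $\mathrm{sg}(\epsilon)=(-1)^{\sum_{j:\epsilon_j=-}(n-j+1)}$, and let $(+,\cdot)$ denote the map $\epsilon\mapsto(+,\epsilon)$ from rank $n-1$ to rank $n$, and also $\epsilon\otimes\epsilon'\mapsto(+,\epsilon)\otimes(+,\epsilon')$. *Lowest weight vectors.* Write (L$_i$) for: $\epsilon_j=\epsilon'_j=-$ for $j\le i$ and $\epsilon_j\epsilon'_j=-$ for $j>i$. - Type $B_n$: $v_{\Lambda_i^{(n)}}=\sum_{(\mathrm L_i)}(-1)^{n(n+1)/2}\mathrm{sg}(\epsilon')\,\epsilon\otimes\epsilon'$ for $1\le i<n$, and $v_{\Lambda_n^{(n)}}=(-,\dots,-)$. - Type $D_n$: $v_{\Lambda_i^{(n)}}=\sum_{(\mathrm L_i),\ \prod_j\epsilon_j=+}(-1)^{n(n+1)/2+i}\,\mathrm{sg}(\epsilon')\,\epsilon\otimes\epsilon'$ for $1\le i\le n-2$; $v_{\Lambda_n^{(n)}}$ is $(-,\dots,-,-)$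 for $n$ even and $(-,\dots,-,+)$ for $n$ odd, and $v_{\Lambda_{n-1}^{(n)}}$ is $(-,\dots,-,+)$ for $n$ even and $(-,\dots,-,-)$ for $n$ odd. - Type $C_n$: the vector representation has the basis $v_1,\dots,v_n,v_{\bar1},\dots,v_{\bar n}$, with $e_jv_{j+1}=v_j$, $e_jv_{\bar j}=v_{\overline{j+1}}$, $f_jv_j=v_{j+1}$, $f_jv_{\overline{j+1}}=v_{\bar j}$ ($j<n$), $e_nv_{\bar n}=v_n$, $f_nv_n=v_{\bar n}$, all other actions of $e_j,f_j$ being zero; $v_j$ and $v_{\bar j}$ have the weights $\pm(\Lambda_j-\Lambda_{j-1})$, $\Lambda_0=0$. In its $i$-th tensor power, $v_{\Lambda_i^{(n)}}=\sum_{\sigma\in\mathfrak S_i}\mathrm{sgn}(\sigma)\,v_{\overline{\sigma(i)}}\otimes\cdots\otimes v_{\overline{\sigma(1)}}$. Let $v'$ be obtained from $v_{\Lambda_{i-1}^{(n-1)}}$ by replacing every $v_{\bar j}$ by $v_{\overline{j+1}}$, and let $z[v;j]$ denote $z$ with $v$ inserted as the $j$-th tensor factor. Then $v_{\Lambda_i^{(n)}}$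 is a lowest weight vector. Its weight is $-\Lambda_i^{(n)}$, except that for $D_n$ with $n$ odd the weights of $v_{\Lambda_{n-1}^{(n)}}$ and $v_{\Lambda_n^{(n)}}$ are $-\Lambda_n^{(n)}$ and $-\Lambda_{n-1}^{(n)}$. Let $L(\Lambda_i^{(n)})$ be the submodule that it generates. In types $B_n$ and $C_n$ put $X=x_1(b_1)\cdots x_{n-1}(b_{n-1})\,x_n(a_n)\cdots x_1(a_1)$, and in type $D_n$ put $X=x_1(b_1)\cdots x_{n-2}(b_{n-2})\,x_n(b_{n-1})\,x_{n-1}(a_{n-1})\cdots x_1(a_1)$. Then $Xv_{\Lambda_i^{(n)}}$ equals, up to an added $w$: - Type $B_n$: - $(b_1\cdots b_{i-1})^2(b_i\cdots b_{n-1})\,a_n^2\,(a_{n-1}\cdots a_i)\,(+,v_{\Lambda_{i-1}^{(n-1)}})$ if $i<n$; - $b_1\cdots b_{n-1}a_n\,(+,v_{\Lambda_{n-1}^{(n-1)}})$ if $i=n$. - Type $C_n$: $(b_1\cdots b_{i-1})^2(b_i\cdots b_{n-1})(a_na_{n-1}\cdots a_i)\sum_{j=1}^i(-1)^{j-1}v'[v_1;j]$.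 - Type $D_n$: - $(b_1\cdots b_{i-1})^2(b_i\cdots b_{n-1})(a_{n-1}\cdots a_i)\,(+,v_{\Lambda_{i-1}^{(n-1)}})$ if $i\le n-2$; - $b_1\cdots b_{n-2}a_{n-1}\,(+,v_{\Lambda_{n-2}^{(n-1)}})$ if $i=n-1$, $n$ even; - $b_1\cdots b_{n-2}b_{n-1}\,(+,v_{\Lambda_{n-2}^{(n-1)}})$ if $i=n-1$, $n$ odd; - $b_1\cdots b_{n-2}a_{n-1}\,(+,v_{\Lambda_{n-1}^{(n-1)}})$ if $i=n$, $n$ odd; - $b_1\cdots b_{n-2}b_{n-1}\,(+,v_{\Lambda_{n-1}^{(n-1)}})$ if $i=n$, $n$ even. Here the displayed leading vector (without its coefficient) is a weight vector, and $w$ is a linear combination of weight vectors of $L(\Lambda_i^{(n)})$ whose weights are lower than that of the leading vector. -/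

import Mathlib

open scoped TensorProduct

noncomputable section

namespace FundamentalRep

/-! ### Modules presented by the action of Chevalley generators

Nodes of the Dynkin diagram of rank `n` are numbered `1, …, n`; the operators attached to other
numbers play no role. -/

/-- The action of the Chevalley generators `e_j`, `f_j`, `h_j` on a complex vector space. -/
structure ChevalleyAction (V : Type) [AddCommGroup V] [Module ℂ V] where
  /-- the action of `e_j` -/
  e : ℕ → Module.End ℂ V
  /-- the action of `f_j` -/
  f : ℕ → Module.End ℂ V
  /-- the action of the coroot `h_j` -/
  h : ℕ → Module.End ℂ V

/-- An element `T` of a Lie algebra acts on `V ⊗ V` by `T ⊗ 1 + 1 ⊗ T`. -/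
def tensorSquareEnd {V : Type} [AddCommGroup V] [Module ℂ V] (T : Module.End ℂ V) :
    Module.End ℂ (V ⊗[ℂ] V) :=
  TensorProduct.map T LinearMap.id + TensorProduct.map LinearMap.id T

/-- An element `T` of a Lie algebra acts on the tensor power of `V` by
`∑ₛ 1 ⊗ ⋯ ⊗ T ⊗ ⋯ ⊗ 1`, with `T` in the factor `s`. -/
def tensorPowerEnd {V : Type} [AddCommGroup V] [Module ℂ V] (r : ℕ) (T : Module.End ℂ V) :
    Module.End ℂ (⨂[ℂ] _ : Fin r, V) :=
  ∑ s : Fin r, PiTensorProduct.map (Function.update (fun _ => LinearMap.id) s T)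

namespace ChevalleyAction

variable {V : Type} [AddCommGroup V] [Module ℂ V]

/-- The tensor square of a module. -/
def tensorSquare (R : ChevalleyAction V) : ChevalleyAction (V ⊗[ℂ] V) where
  e j := tensorSquareEnd (R.e j)
  f j := tensorSquareEnd (R.f j)
  h j := tensorSquareEnd (R.h j)

/-- The `r`-th tensor power of a module. -/
def tensorPower (R : ChevalleyAction V) (r : ℕ) : ChevalleyAction (⨂[ℂ] _ : Fin r, V) where
  e j := tensorPowerEnd r (R.e j)
  f j := tensorPowerEnd r (R.f j)
  h j := tensorPowerEnd r (R.h j)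

/-- The action of the group element `x_j(c) = exp (c e_j)` (here `e_j` acts nilpotently). -/
def x [Module ℚ V] [SMulCommClass ℂ ℚ V] (R : ChevalleyAction V) (j : ℕ) (c : ℂ) :
    Module.End ℂ V :=
  IsNilpotent.exp (c • R.e j)

/-- The submodule generated by `v`: the smallest subspace that contains `v` and is stable under
`e_j`, `f_j`, `h_j` for all nodes `j = 1, …, n`. -/
def generated (R : ChevalleyAction V) (n : ℕ) (v : V) : Submodule ℂ V :=
  sInf {L | v ∈ L ∧ ∀ j ∈ Finset.Icc 1 n, ∀ y ∈ L, R.e j y ∈ L ∧ R.f j y ∈ L ∧ R.h j y ∈ L}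

/-- `y` is a (nonzero) weight vector of the weight `μ`, where `μ t` is the value of the weight on
the coroot of the node `t + 1`. -/
def IsWeightVector (R : ChevalleyAction V) {n : ℕ} (μ : Fin n → ℤ) (y : V) : Prop :=
  y ≠ 0 ∧ ∀ t : Fin n, R.h (t + 1) y = (μ t : ℂ) • y

/-- `v` is a lowest weight vector of the weight `μ`. -/
def IsLowestWeightVector (R : ChevalleyAction V) {n : ℕ} (μ : Fin n → ℤ) (v : V) : Prop :=
  R.IsWeightVector μ v ∧ ∀ j ∈ Finset.Icc 1 n, R.f j v = 0

end ChevalleyAction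

/-- For a Cartan matrix `A` with entries `A s t = α_t (h_s)`: the weight `μ` is lower than `lam`,
that is, `lam - μ` is a nonzero sum of simple roots. -/
def IsLower {n : ℕ} (A : Matrix (Fin n) (Fin n) ℤ) (μ lam : Fin n → ℤ) : Prop :=
  ∃ k : Fin n → ℕ, k ≠ 0 ∧ ∀ s, lam s - μ s = ∑ t, A s t * (k t : ℤ)

/-- Let `v` be a lowest weight vector and `L` the module that it generates. This says that
`g v = c · lead + w`, where `lead` is a weight vector and `w` is a linear combination of weight
vectors of `L` with lower weights than the one of `lead`. -/
def HasLeadingTerm {V : Type} [AddCommGroup V] [Module ℂ V] {n : ℕ}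
    (A : Matrix (Fin n) (Fin n) ℤ) (R : ChevalleyAction V) (v : V) (g : Module.End ℂ V)
    (c : ℂ) (lead : V) : Prop :=
  ∃ lam : Fin n → ℤ, R.IsWeightVector lam lead ∧
    ∃ w ∈ Submodule.span ℂ
        {y : V | y ∈ R.generated n v ∧ ∃ μ : Fin n → ℤ, R.IsWeightVector μ y ∧ IsLower A μ lam},
      g v = c • lead + w

/-- The weight `-Λ_i`. -/
def negFundamental (n i : ℕ) : Fin n → ℤ :=
  fun t => if (t : ℕ) + 1 = i then -1 else 0

/-! ### Cartan matrices

The entry `(s, t)` is the value of the simple root of the node `t + 1` on the simple coroot of the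
node `s + 1`. (Mathlib's `CartanMatrix.B` and `CartanMatrix.C` use the transposed convention.) -/

/-- The Cartan matrix of type `B_n`: the entry at the nodes `(n, n-1)` is `-2`. -/
def cartanB (n : ℕ) : Matrix (Fin n) (Fin n) ℤ := Matrix.of fun s t =>
  if s = t then 2
  else if (s : ℕ) = t + 1 ∧ (s : ℕ) + 1 = n then -2
  else if (s : ℕ) = t + 1 ∨ (t : ℕ) = s + 1 then -1
  else 0

/-- The Cartan matrix of type `C_n`: the entry at the nodes `(n-1, n)` is `-2`. -/
def cartanC (n : ℕ) : Matrix (Fin n) (Fin n) ℤ := Matrix.of fun s t =>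
  if s = t then 2
  else if (t : ℕ) = s + 1 ∧ (t : ℕ) + 1 = n then -2
  else if (s : ℕ) = t + 1 ∨ (t : ℕ) = s + 1 then -1
  else 0

/-- The Cartan matrix of type `D_n`: the nodes `1, …, n-1` form a chain, and the node `n` is joined
to the node `n-2`. -/
def cartanD (n : ℕ) : Matrix (Fin n) (Fin n) ℤ := Matrix.of fun s t =>
  if s = t then 2
  else if ((s : ℕ) = t + 1 ∧ (s : ℕ) + 1 < n) ∨ ((t : ℕ) = s + 1 ∧ (t : ℕ) + 1 < n) then -1
  else if ((s : ℕ) = t + 2 ∧ (s : ℕ) + 1 = n) ∨ ((t : ℕ) = s + 2 ∧ (t : ℕ) + 1 = n) then -1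
  else 0

/-! ### The vector representation of type `C_n` -/

/-- The space with the basis `v_1, …, v_n` (left summand) and `v_{\bar 1}, …, v_{\bar n}` (right
summand). The element with the number `t : Fin n` has the label `t + 1`. -/
abbrev VecC (n : ℕ) : Type := (Fin n ⊕ Fin n) →₀ ℂ

/-- The basis vector `v_j` for `1 ≤ j ≤ n`. -/
def vec (n j : ℕ) : VecC n :=
  if hj : 1 ≤ j ∧ j ≤ n then Finsupp.single (Sum.inl ⟨j - 1, by omega⟩) 1 else 0

/-- The basis vector `v_{\bar j}` for `1 ≤ j ≤ n`. -/
def vecBar (n j : ℕ) : VecC n :=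
  if hj : 1 ≤ j ∧ j ≤ n then Finsupp.single (Sum.inr ⟨j - 1, by omega⟩) 1 else 0

/-- The linear map with the given values on a basis. -/
abbrev onBasis {X V : Type} [AddCommGroup V] [Module ℂ V] (φ : X → V) : (X →₀ ℂ) →ₗ[ℂ] V :=
  Finsupp.linearCombination ℂ φ

/-- The vector representation of type `C_n`:
`e_i v_{i+1} = v_i`, `e_i v_{\bar i} = v_{\overline{i+1}}`, `f_i v_i = v_{i+1}`,
`f_i v_{\overline{i+1}} = v_{\bar i}` for `i < n`, `e_n v_{\bar n} = v_n`, `f_n v_n = v_{\bar n}`,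
all other actions of `e_i`, `f_i` are zero; the weight of `v_j` is `Λ_j - Λ_{j-1}`, that of
`v_{\bar j}` is `Λ_{j-1} - Λ_j`. -/
def vectorC (n : ℕ) : ChevalleyAction (VecC n) where
  e i := onBasis fun
    | Sum.inl t => if i < n ∧ (t : ℕ) + 1 = i + 1 then vec n i else 0
    | Sum.inr t =>
        if (t : ℕ) + 1 = i then (if i = n then vec n n else vecBar n (i + 1)) else 0
  f i := onBasis fun
    | Sum.inl t =>
        if (t : ℕ) + 1 = i then (if i = n then vecBar n n else vec n (i + 1)) else 0
    | Sum.inr t => if i < n ∧ (t : ℕ) + 1 = i + 1 then vecBar n i else 0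
  h i := onBasis fun
    | Sum.inl t =>
        ((if (t : ℕ) + 1 = i then 1 else 0) - (if (t : ℕ) = i then 1 else 0) : ℂ) •
          vec n (t + 1)
    | Sum.inr t =>
        ((if (t : ℕ) = i then 1 else 0) - (if (t : ℕ) + 1 = i then 1 else 0) : ℂ) •
          vecBar n (t + 1)

/-- The lowest weight vector of `L(Λ_i)` in type `C_n`,
`∑_σ sgn(σ) v_{\overline{σ(i)}} ⊗ ⋯ ⊗ v_{\overline{σ(1)}}`. -/
def lowC (n i : ℕ) : ⨂[ℂ] _ : Fin i, VecC n :=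
  ∑ σ : Equiv.Perm (Fin i), ((Equiv.Perm.sign σ : ℤ) : ℂ) •
    PiTensorProduct.tprod ℂ fun s : Fin i => vecBar n ((σ (Fin.rev s) : ℕ) + 1)

/-- `v_j ↦ v_{j+1}`, `v_{\bar j} ↦ v_{\overline{j+1}}`, from rank `n` to rank `n + 1`. -/
def shiftC (n : ℕ) : VecC n →ₗ[ℂ] VecC (n + 1) :=
  onBasis fun
    | Sum.inl t => vec (n + 1) (t + 2)
    | Sum.inr t => vecBar (n + 1) (t + 2)

/-- `z ↦ z[v; s + 1]`: the vector `v` is inserted as the factor with the number `s + 1`. -/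
def insertFactor {V : Type} [AddCommGroup V] [Module ℂ V] {r : ℕ} (s : Fin (r + 1)) (v : V) :
    (⨂[ℂ] _ : Fin r, V) →ₗ[ℂ] ⨂[ℂ] _ : Fin (r + 1), V :=
  PiTensorProduct.lift ((PiTensorProduct.tprod ℂ (s := fun _ : Fin (r + 1) => V)).curryMid s v)

/-- The vector `∑_{j=1}^{k+1} (-1)^{j-1} v'[v_1; j]` in rank `m + 1`, where `v'` is the lowest weight
vector of `L(Λ_k)` in rank `m` with all labels shifted by one. -/
def leadC (m k : ℕ) : ⨂[ℂ] _ : Fin (k + 1), VecC (m + 1) :=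
  ∑ s : Fin (k + 1), ((-1 : ℂ) ^ (s : ℕ)) •
    insertFactor s (vec (m + 1) 1) (PiTensorProduct.map (fun _ => shiftC m) (lowC m k))

/-! ### Spin representations -/

/-- Sequences `(ε_1, …, ε_n)` of signs. -/
abbrev Signs (n : ℕ) : Type := Fin n → ℤˣ

/-- The space with the basis of all sequences of `n` signs. -/
abbrev Spin (n : ℕ) : Type := Signs n →₀ ℂ

/-- The basis vector given by a sequence of signs. -/
abbrev spinVec {n : ℕ} (ε : Signs n) : Spin n := Finsupp.single ε 1

/-- The entry `ε_j` as an integer, for `1 ≤ j ≤ n`. -/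
def entry {n : ℕ} (ε : Signs n) (j : ℕ) : ℤ :=
  if hj : 1 ≤ j ∧ j ≤ n then ((ε ⟨j - 1, by omega⟩ : ℤˣ) : ℤ) else 0

/-- Replace the entry `ε_j` by `s`. -/
def setEntry {n : ℕ} (ε : Signs n) (j : ℕ) (s : ℤˣ) : Signs n :=
  fun t => if (t : ℕ) + 1 = j then s else ε t

/-- Spin representation of type `B_n`. -/
def spinB (n : ℕ) : ChevalleyAction (Spin n) where
  e i := onBasis fun ε =>
    if i < n ∧ entry ε i = -1 ∧ entry ε (i + 1) = 1 then
      spinVec (setEntry (setEntry ε i 1) (i + 1) (-1))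
    else if i = n ∧ entry ε n = -1 then spinVec (setEntry ε n 1)
    else 0
  f i := onBasis fun ε =>
    if i < n ∧ entry ε i = 1 ∧ entry ε (i + 1) = -1 then
      spinVec (setEntry (setEntry ε i (-1)) (i + 1) 1)
    else if i = n ∧ entry ε n = 1 then spinVec (setEntry ε n (-1))
    else 0
  h i := onBasis fun ε =>
    if i < n then (((entry ε i - entry ε (i + 1) : ℤ) : ℂ) / 2) • spinVec ε
    else if i = n then ((entry ε n : ℤ) : ℂ) • spinVec ε
    else 0

/-- The sum of the two spin representations of type `D_n`; the sequences with `∏ ε_j = 1` span the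
submodule `V^{(+,n)}`, those with `∏ ε_j = -1` the submodule `V^{(-,n)}`. -/
def spinD (n : ℕ) : ChevalleyAction (Spin n) where
  e i := onBasis fun ε =>
    if i < n ∧ entry ε i = -1 ∧ entry ε (i + 1) = 1 then
      spinVec (setEntry (setEntry ε i 1) (i + 1) (-1))
    else if i = n ∧ entry ε (n - 1) = -1 ∧ entry ε n = -1 then
      spinVec (setEntry (setEntry ε (n - 1) 1) n 1)
    else 0
  f i := onBasis fun ε =>
    if i < n ∧ entry ε i = 1 ∧ entry ε (i + 1) = -1 then
      spinVec (setEntry (setEntry ε i (-1)) (i + 1) 1)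
    else if i = n ∧ entry ε (n - 1) = 1 ∧ entry ε n = 1 then
      spinVec (setEntry (setEntry ε (n - 1) (-1)) n (-1))
    else 0
  h i := onBasis fun ε =>
    if i < n then (((entry ε i - entry ε (i + 1) : ℤ) : ℂ) / 2) • spinVec ε
    else if i = n then (((entry ε (n - 1) + entry ε n : ℤ) : ℂ) / 2) • spinVec ε
    else 0

/-- `sg(ε) = (-1)^{∑ (n - j + 1)}`, the sum over the positions `j` with `ε_j = -`. -/
def sg {n : ℕ} (ε : Signs n) : ℂ :=
  (-1) ^ (∑ j ∈ (Finset.Icc 1 n).filter (fun j => entry ε j = -1), (n - j + 1))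

/-- The condition `ε_j = ε'_j = -` for `j ≤ i` and `ε_j ε'_j = -` for `j > i`. -/
def CondL {n : ℕ} (i : ℕ) (ε ε' : Signs n) : Prop :=
  ∀ j ∈ Finset.Icc 1 n,
    if j ≤ i then entry ε j = -1 ∧ entry ε' j = -1 else entry ε j * entry ε' j = -1

open Classical in
/-- The lowest weight vector of `L(Λ_i)`, `i < n`, in type `B_n`. -/
def lowB (n i : ℕ) : Spin n ⊗[ℂ] Spin n :=
  ∑ p : Signs n × Signs n,
    if CondL i p.1 p.2 then
      ((-1 : ℂ) ^ (n * (n + 1) / 2) * sg p.2) • (spinVec p.1 ⊗ₜ[ℂ] spinVec p.2)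
    else 0

open Classical in
/-- The lowest weight vector of `L(Λ_i)`, `i ≤ n - 2`, in type `D_n`. Here `ε` runs through the basis
of `V^{(+,n)}`; then `ε'` is in the basis of `V^{(+,n)}` if `n - i` is even and in that of
`V^{(-,n)}` if `n - i` is odd. The sign is the one for which the product
`exp (f_{i_1}) ⋯ exp (f_{i_N})` along a reduced longest word has the coefficient `+1` between the
highest weight vector `∑ sg(ε) ε ⊗ ε'` of `L(Λ_i)` and this vector. -/
def lowD (n i : ℕ) : Spin n ⊗[ℂ] Spin n :=
  ∑ p : Signs n × Signs n,
    if CondL i p.1 p.2 ∧ ∏ t, p.1 t = 1 then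
      ((-1 : ℂ) ^ (n * (n + 1) / 2 + i) * sg p.2) • (spinVec p.1 ⊗ₜ[ℂ] spinVec p.2)
    else 0

/-- `(-, …, -, -)`. -/
def allMinus (n : ℕ) : Spin n := spinVec fun _ => -1

/-- `(-, …, -, +)`. -/
def lastPlus (n : ℕ) : Spin n := spinVec fun t => if (t : ℕ) + 1 = n then 1 else -1

/-- The lowest weight vector of `L(Λ_n)` in type `B_n`. -/
def lowSpinB (n : ℕ) : Spin n := allMinus n

/-- The lowest weight vector of `L(Λ_n)` in type `D_n`. -/
def lowSpinD (n : ℕ) : Spin n := if Even n then allMinus n else lastPlus n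

/-- The lowest weight vector of `L(Λ_{n-1})` in type `D_n`. -/
def lowSpinD' (n : ℕ) : Spin n := if Even n then lastPlus n else allMinus n

/-- `v ↦ (+, v)` on spaces of sequences. -/
def plus (n : ℕ) : Spin n →ₗ[ℂ] Spin (n + 1) :=
  onBasis fun ε => spinVec (Fin.cons 1 ε)

/-- `v ↦ (+, v)` on tensor squares, `ε ⊗ ε' ↦ (+, ε) ⊗ (+, ε')`. -/
def plusTensor (n : ℕ) : Spin n ⊗[ℂ] Spin n →ₗ[ℂ] Spin (n + 1) ⊗[ℂ] Spin (n + 1) :=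
  TensorProduct.map (plus n) (plus n)

/-! ### The words -/

/-- `x_1(c_1) x_2(c_2) ⋯ x_r(c_r)`. -/
def ascending {V : Type} [AddCommGroup V] [Module ℂ V] [Module ℚ V] [SMulCommClass ℂ ℚ V]
    (R : ChevalleyAction V) (r : ℕ) (c : ℕ → ℂ) : Module.End ℂ V :=
  ((List.range r).map fun s => R.x (s + 1) (c (s + 1))).prod

/-- `x_r(c_r) ⋯ x_2(c_2) x_1(c_1)`. -/
def descending {V : Type} [AddCommGroup V] [Module ℂ V] [Module ℚ V] [SMulCommClass ℂ ℚ V]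
    (R : ChevalleyAction V) (r : ℕ) (c : ℕ → ℂ) : Module.End ℂ V :=
  ((List.range r).reverse.map fun s => R.x (s + 1) (c (s + 1))).prod

/-- `x_1(b_1) ⋯ x_{n-1}(b_{n-1}) x_n(a_n) ⋯ x_1(a_1)`. -/
def wordBC {V : Type} [AddCommGroup V] [Module ℂ V] [Module ℚ V] [SMulCommClass ℂ ℚ V]
    (R : ChevalleyAction V) (n : ℕ) (a b : ℕ → ℂ) : Module.End ℂ V :=
  ascending R (n - 1) b * descending R n a

/-- `x_1(b_1) ⋯ x_{n-2}(b_{n-2}) x_n(b_{n-1}) x_{n-1}(a_{n-1}) ⋯ x_1(a_1)`. -/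
def wordD {V : Type} [AddCommGroup V] [Module ℂ V] [Module ℚ V] [SMulCommClass ℂ ℚ V]
    (R : ChevalleyAction V) (n : ℕ) (a b : ℕ → ℂ) : Module.End ℂ V :=
  ascending R (n - 2) b * R.x n (b (n - 1)) * descending R (n - 1) a

end FundamentalRep

end

noncomputable section

namespace FundamentalRep

/-! Degrees take the place of weights. Relative to a lowest weight `μ`, a vector of weight `μ + ∑
κ_t α_t` has degree `κ ∈ ℕⁿ`, and `LT` says that `l` is the component of `y` in the top degree `κ`,
all other components having strictly smaller degree. This relation is compatible with sums, with
tensor products (`LT.tmul`), with multilinear maps (`LT.multilinear`) and with `x_j(c)` when `e_j² =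
0`: then `x_j(c) = 1 + c e_j`, and the new top component is `c e_j l` (`LT.x_apply`). At the end,
`hasLeadingTerm_of_LT` returns to weights: the generated module is stable under the coroots, hence
contains all weight components of `X v`, and a functional that is positive on the simple roots shows
that no weight is lower than itself.

Spin modules. The word is a core `Y` wrapped in layers `x_p(b_p) ⋯ x_p(a_p)`. Let `ε_p = -`. If
`ε_{p+1} = +`, then `x_p(a_p)` moves the minus sign to `p + 1`, where the inner layers raise it, and
`x_p(b_p)` is idle. If `ε_{p+1} = -`, then `x_p(a_p)` is idle, the inner layers turn `ε_{p+1}` into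
`+`, and `x_p(b_p)` raises the minus sign at `p`. So every `t` contributes `a_t` or `b_t` according
to the sign `ε_{t+1}` (`SpinData.sandwich_spec`). In the tensor square a pair of equal minus signs
contributes `b_t²` and a pair of opposite signs `a_t b_t`; the coefficient is therefore the same for
all pairs in the lowest weight vector, and the remaining sum is `(+, v)`. The operators `f_j`
annihilate that vector because exchanging the entries at the affected positions reverses the sign
`sg`.

Type C. The lowest weight vector is the antisymmetrization of `v_{\bar i}, …, v_{\bar 1}`. The group
elements act on every factor. The first `i - 1` steps only add vectors that already occur in the
sequence, and the other steps of the descending part move only the first factor, up to `v_n`. The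
ascending part takes `v_n` to `v_1` and every other `v_{\bar j}` to `b_j v_{\overline{j+1}}`, up to
lower terms. -/

theorem exp_of_sq {B : Type*} [Ring B] [Module ℚ B] {T : B} (h : T ^ 2 = 0) :
    IsNilpotent.exp T = 1 + T := by
  rw [IsNilpotent.exp_eq_sum h]
  simp [Finset.sum_range_succ]

/-! ### Weight spaces and leading terms -/

section Framework

variable {V : Type} [AddCommGroup V] [Module ℂ V] {n : ℕ}

/-- The vectors of the weight `μ`, together with zero. -/
def weightSpace (R : ChevalleyAction V) (μ : Fin n → ℤ) : Submodule ℂ V where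
  carrier := {y | ∀ t : Fin n, R.h (t + 1) y = (μ t : ℂ) • y}
  add_mem' := fun {a b} ha hb t => by rw [map_add, ha t, hb t, smul_add]
  zero_mem' := fun t => by simp
  smul_mem' := fun c y hy t => by rw [map_smul, hy t, smul_comm]

theorem mem_weightSpace {R : ChevalleyAction V} {μ : Fin n → ℤ} {y : V} :
    y ∈ weightSpace R μ ↔ ∀ t : Fin n, R.h (t + 1) y = (μ t : ℂ) • y := Iff.rfl

/-- The weight `μ + ∑ κ_t α_t`. -/
def shiftWt (A : Matrix (Fin n) (Fin n) ℤ) (μ : Fin n → ℤ) (κ : Fin n → ℕ) : Fin n → ℤ :=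
  fun s => μ s + ∑ t, A s t * (κ t : ℤ)

/-- The sum of the weight spaces of `μ + ∑ κ'_t α_t` with `κ' < κ`. -/
def Low (A : Matrix (Fin n) (Fin n) ℤ) (R : ChevalleyAction V) (μ : Fin n → ℤ) (κ : Fin n → ℕ) :
    Submodule ℂ V :=
  ⨆ κ' : {κ' : Fin n → ℕ // κ' < κ}, weightSpace R (shiftWt A μ κ')

/-- The sum of the weight spaces of `μ + ∑ κ'_t α_t` with `κ' ≤ κ`. -/
def Le (A : Matrix (Fin n) (Fin n) ℤ) (R : ChevalleyAction V) (μ : Fin n → ℤ) (κ : Fin n → ℕ) :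
    Submodule ℂ V :=
  ⨆ κ' : {κ' : Fin n → ℕ // κ' ≤ κ}, weightSpace R (shiftWt A μ κ')

/-- `l` is the component of `y` of the top weight `μ + ∑ κ_t α_t`. -/
def LT (A : Matrix (Fin n) (Fin n) ℤ) (R : ChevalleyAction V) (μ : Fin n → ℤ) (κ : Fin n → ℕ)
    (y l : V) : Prop :=
  l ∈ weightSpace R (shiftWt A μ κ) ∧ y - l ∈ Low A R μ κ

/-- `e_t` raises weights by `α_t`. -/
def IsGraded (A : Matrix (Fin n) (Fin n) ℤ) (R : ChevalleyAction V) : Prop :=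
  ∀ (s t : Fin n) (y : V), R.h (s + 1) (R.e (t + 1) y) =
    R.e (t + 1) (R.h (s + 1) y) + (A s t : ℂ) • R.e (t + 1) y

/-- The indicator of the node `j`. -/
def node (n j : ℕ) : Fin n → ℕ := fun t => if (t : ℕ) + 1 = j then 1 else 0

variable {A : Matrix (Fin n) (Fin n) ℤ} {R : ChevalleyAction V} {μ : Fin n → ℤ} {κ κ' : Fin n → ℕ}
  {y y' l l' : V}

theorem shiftWt_zero : shiftWt A μ 0 = μ := by
  ext s; simp [shiftWt]

theorem shiftWt_add (κ κ' : Fin n → ℕ) :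
    shiftWt A μ (κ + κ') = shiftWt A (shiftWt A μ κ) κ' := by
  ext s; simp [shiftWt, mul_add, Finset.sum_add_distrib, add_assoc]

theorem shiftWt_node (t : Fin n) : shiftWt A μ (node n (t + 1)) = fun s => μ s + A s t := by
  ext s
  simp only [shiftWt, node, add_left_inj, Fin.val_inj]
  simp

theorem e_mem_weightSpace (hR : IsGraded A R) {j : ℕ} (hj : j ∈ Finset.Icc 1 n)
    (hy : y ∈ weightSpace R μ) : R.e j y ∈ weightSpace R (shiftWt A μ (node n j)) := by
  obtain ⟨h1, h2⟩ := Finset.mem_Icc.1 hj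
  obtain ⟨t, rfl⟩ : ∃ t : Fin n, j = t + 1 := ⟨⟨j - 1, by omega⟩, by simp; omega⟩
  intro s
  rw [hR, hy s, shiftWt_node, map_smul, Int.cast_add, add_smul]

theorem weightSpace_le_Le (h : κ' ≤ κ) : weightSpace R (shiftWt A μ κ') ≤ Le A R μ κ :=
  le_iSup (fun κ' : {κ' : Fin n → ℕ // κ' ≤ κ} => weightSpace R (shiftWt A μ κ')) ⟨κ', h⟩

theorem weightSpace_le_Low (h : κ' < κ) : weightSpace R (shiftWt A μ κ') ≤ Low A R μ κ :=
  le_iSup (fun κ' : {κ' : Fin n → ℕ // κ' < κ} => weightSpace R (shiftWt A μ κ')) ⟨κ', h⟩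

theorem Low_le_Le : Low A R μ κ ≤ Le A R μ κ :=
  iSup_le fun κ' => weightSpace_le_Le κ'.2.le

theorem Le_mono (h : κ' ≤ κ) : Le A R μ κ' ≤ Le A R μ κ :=
  iSup_le fun κ' => weightSpace_le_Le (κ'.2.trans h)

theorem Le_le_Low (h : κ' < κ) : Le A R μ κ' ≤ Low A R μ κ :=
  iSup_le fun κ' => weightSpace_le_Low (κ'.2.trans_lt h)

theorem Low_shiftWt_le : Low A R (shiftWt A μ κ') κ ≤ Low A R μ (κ' + κ) :=
  iSup_le fun η => by
    rw [← shiftWt_add]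
    exact weightSpace_le_Low (add_lt_add_right η.2 κ')

theorem LT.mem_Le (h : LT A R μ κ y l) : y ∈ Le A R μ κ := by
  rw [← sub_add_cancel y l]
  exact add_mem (Low_le_Le h.2) (weightSpace_le_Le le_rfl h.1)

theorem LT.add (h : LT A R μ κ y l) (h' : LT A R μ κ y' l') : LT A R μ κ (y + y') (l + l') :=
  ⟨add_mem h.1 h'.1, by rw [add_sub_add_comm]; exact add_mem h.2 h'.2⟩

theorem LT.smul (c : ℂ) (h : LT A R μ κ y l) : LT A R μ κ (c • y) (c • l) :=
  ⟨Submodule.smul_mem _ _ h.1, by rw [← smul_sub]; exact Submodule.smul_mem _ _ h.2⟩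

theorem LT.zero : LT A R μ κ 0 0 := ⟨zero_mem _, by simp⟩

theorem LT.sum {ι : Type*} (S : Finset ι) {f g : ι → V} (h : ∀ i ∈ S, LT A R μ κ (f i) (g i)) :
    LT A R μ κ (∑ i ∈ S, f i) (∑ i ∈ S, g i) :=
  ⟨sum_mem fun i hi => (h i hi).1, by
    rw [← Finset.sum_sub_distrib]; exact sum_mem fun i hi => (h i hi).2⟩

theorem LT.of_mem_Low (h : y ∈ Low A R μ κ) : LT A R μ κ y 0 := ⟨zero_mem _, by simpa using h⟩

theorem LT.of_mem (h : y ∈ weightSpace R μ) : LT A R μ 0 y y :=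
  ⟨by rwa [shiftWt_zero], by simp⟩

/-- Changes the base weight. It is needed when an induction hypothesis has been applied to a vector
that is already raised. -/
theorem LT.shift (h : LT A R (shiftWt A μ κ') κ y l) : LT A R μ (κ' + κ) y l :=
  ⟨by rw [shiftWt_add]; exact h.1, Low_shiftWt_le h.2⟩

theorem node_pos {j : ℕ} (hj : j ∈ Finset.Icc 1 n) : 0 < node n j := by
  obtain ⟨h1, h2⟩ := Finset.mem_Icc.1 hj
  refine lt_of_le_of_ne (fun _ => Nat.zero_le _) fun h => ?_
  have := congrFun h ⟨j - 1, by omega⟩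
  simp [node, Nat.sub_add_cancel h1] at this

theorem e_mem_Low (hR : IsGraded A R) {j : ℕ} (hj : j ∈ Finset.Icc 1 n)
    (hy : y ∈ Low A R μ κ) : R.e j y ∈ Low A R μ (κ + node n j) := by
  have : Low A R μ κ ≤ (Low A R μ (κ + node n j)).comap (R.e j) :=
    iSup_le fun η z hz => weightSpace_le_Low (add_lt_add_left η.2 (node n j)) (by
      rw [shiftWt_add]; exact e_mem_weightSpace hR hj hz)
  exact this hy

theorem e_mem_Le (hR : IsGraded A R) {j : ℕ} (hj : j ∈ Finset.Icc 1 n)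
    (hy : y ∈ Le A R μ κ) : R.e j y ∈ Le A R μ (κ + node n j) := by
  have : Le A R μ κ ≤ (Le A R μ (κ + node n j)).comap (R.e j) :=
    iSup_le fun η z hz => weightSpace_le_Le (add_le_add_left η.2 (node n j)) (by
      rw [shiftWt_add]; exact e_mem_weightSpace hR hj hz)
  exact this hy

theorem generated_stable (j : ℕ) (hj : j ∈ Finset.Icc 1 n) (v : V)
    (hy : y ∈ R.generated n v) :
    R.e j y ∈ R.generated n v ∧ R.h j y ∈ R.generated n v := by
  simp only [ChevalleyAction.generated, Submodule.mem_sInf, Set.mem_ofPred_eq] at hy ⊢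
  exact ⟨fun L hL => (hL.2 j hj y (hy L hL)).1, fun L hL => (hL.2 j hj y (hy L hL)).2.2⟩

theorem mem_generated (v : V) : v ∈ R.generated n v := by
  simp only [ChevalleyAction.generated, Submodule.mem_sInf, Set.mem_ofPred_eq]
  exact fun L hL => hL.1

/-! ### Exponentials of the operators `e_j` -/

section Exp

variable [Module ℚ V] [SMulCommClass ℂ ℚ V]

theorem x_eq_of_sq {j : ℕ} (h : R.e j * R.e j = 0) (c : ℂ) : R.x j c = 1 + c • R.e j := by
  have h2 : (c • R.e j) ^ 2 = 0 := by rw [pow_two, smul_mul_smul_comm, h, smul_zero]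
  rw [ChevalleyAction.x, exp_of_sq h2]

theorem x_apply_of_sq {j : ℕ} (h : R.e j * R.e j = 0) (c : ℂ) (y : V) :
    R.x j c y = y + c • R.e j y := by
  rw [x_eq_of_sq h]; simp

theorem x_mem_Le (hR : IsGraded A R) {j : ℕ} (hj : j ∈ Finset.Icc 1 n)
    (h : R.e j * R.e j = 0) (c : ℂ) (hy : y ∈ Le A R μ κ) :
    R.x j c y ∈ Le A R μ (κ + node n j) := by
  rw [x_apply_of_sq h]
  exact add_mem (Le_mono (by simp) hy) (Submodule.smul_mem _ _ (e_mem_Le hR hj hy))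

/-- In `y + c e_j y` the summand `y` has degrees at most `κ`, strictly below `κ + node n j`, so only
`e_j` applied to the top component reaches the top. The new top component may be zero. -/
theorem LT.x_apply (hR : IsGraded A R) {j : ℕ} (hj : j ∈ Finset.Icc 1 n)
    (h : R.e j * R.e j = 0) (c : ℂ) (hy : LT A R μ κ y l) :
    LT A R μ (κ + node n j) (R.x j c y) (c • R.e j l) := by
  refine ⟨?_, ?_⟩
  · rw [shiftWt_add]
    exact Submodule.smul_mem _ _ (e_mem_weightSpace hR hj hy.1)
  · rw [x_apply_of_sq h, add_sub_assoc, ← smul_sub, ← map_sub]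
    exact add_mem (Le_le_Low (lt_add_of_pos_right κ (node_pos hj)) hy.mem_Le)
      (Submodule.smul_mem _ _ (e_mem_Low hR hj hy.2))

theorem x_mem_generated (j : ℕ) (hj : j ∈ Finset.Icc 1 n) (c : ℂ) (v : V)
    (hy : y ∈ R.generated n v) : R.x j c y ∈ R.generated n v := by
  -- The exponential is a sum with rational coefficients, while the submodule is only known to be
  -- closed under complex scalars.
  have hq : ∀ (q : ℚ) (z : V), q • z = (q : ℂ) • z := fun q z => by
    simp [Rat.cast_smul_eq_qsmul]
  have hp : ∀ r : ℕ, ((c • R.e j) ^ r) y ∈ R.generated n v := by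
    intro r
    induction r with
    | zero => simpa using hy
    | succ r ih =>
      rw [pow_succ', Module.End.mul_apply, LinearMap.smul_apply]
      exact Submodule.smul_mem _ _ (generated_stable j hj v ih).1
  rw [ChevalleyAction.x, IsNilpotent.exp, LinearMap.sum_apply]
  refine sum_mem fun r _ => ?_
  rw [LinearMap.smul_apply, hq]
  exact Submodule.smul_mem _ _ (hp r)

theorem list_x_prod_mem_generated (w : List (ℕ × ℂ)) (hw : ∀ p ∈ w, p.1 ∈ Finset.Icc 1 n) (v : V)
    (hy : y ∈ R.generated n v) :
    (w.map fun p => R.x p.1 p.2).prod y ∈ R.generated n v := by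
  induction w with
  | nil => simpa using hy
  | cons p w ih =>
    rw [List.map_cons, List.prod_cons, Module.End.mul_apply]
    exact x_mem_generated _ (hw p (by simp)) _ v (ih fun q hq => hw q (by simp [hq]))

theorem ascending_mem_generated {r : ℕ} (hr : r ≤ n) (c : ℕ → ℂ) (v : V)
    (hy : y ∈ R.generated n v) : ascending R r c y ∈ R.generated n v := by
  have := list_x_prod_mem_generated (R := R) (n := n)
    ((List.range r).map fun s => (s + 1, c (s + 1))) (by
      intro p hp
      simp only [List.mem_map, List.mem_range] at hp
      obtain ⟨s, hs, rfl⟩ := hp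
      simp; omega) v hy
  simpa [ascending, Function.comp_def] using this

theorem descending_mem_generated {r : ℕ} (hr : r ≤ n) (c : ℕ → ℂ) (v : V)
    (hy : y ∈ R.generated n v) : descending R r c y ∈ R.generated n v := by
  have := list_x_prod_mem_generated (R := R) (n := n)
    ((List.range r).reverse.map fun s => (s + 1, c (s + 1))) (by
      intro p hp
      simp only [List.mem_map, List.mem_reverse, List.mem_range] at hp
      obtain ⟨s, hs, rfl⟩ := hp
      simp; omega) v hy
  rw [List.map_map] at this
  exact this

end Exp

/-- A submodule stable under the coroots contains the weight components of its elements. -/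
theorem weight_component_mem (L : Submodule ℂ V)
    (hL : ∀ t : Fin n, ∀ y ∈ L, R.h (t + 1) y ∈ L) (S : Finset (Fin n → ℤ)) :
    ∀ f : (Fin n → ℤ) → V, (∀ μ ∈ S, f μ ∈ weightSpace R μ) → ∑ μ ∈ S, f μ ∈ L →
      ∀ μ ∈ S, f μ ∈ L := by
  induction S using Finset.induction_on with
  | empty => simp
  | insert ν S hν ih =>
    intro f hf hsum
    have key : ∀ μ ∈ S, f μ ∈ L := by
      intro μ hμ
      obtain ⟨t, ht⟩ : ∃ t, μ t ≠ ν t := by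
        by_contra! h
        exact hν (by rwa [← funext h])
      -- The operator `h_t - ν(t)` removes the component of weight `ν` and multiplies the others by
      -- `μ(t) - ν(t)`. The node `t` was chosen to make this factor nonzero for the given `μ`.
      have h1 := ih (fun μ => ((μ t : ℂ) - ν t) • f μ)
        (fun μ hμ => Submodule.smul_mem _ _ (hf μ (Finset.mem_insert_of_mem hμ))) (by
          have h2 := sub_mem (hL t _ hsum) (Submodule.smul_mem L (ν t : ℂ) hsum)
          rw [map_sum, Finset.smul_sum, ← Finset.sum_sub_distrib, Finset.sum_insert hν,
            hf ν (Finset.mem_insert_self _ _) t, sub_self, zero_add] at h2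
          convert h2 using 2 with μ hμ
          rw [hf μ (Finset.mem_insert_of_mem hμ) t, sub_smul]) μ hμ
      refine (Submodule.smul_mem_iff L ?_).1 h1
      rw [sub_ne_zero]
      exact_mod_cast ht
    intro μ hμ
    rcases Finset.mem_insert.1 hμ with rfl | hμ
    · rw [Finset.sum_insert hν] at hsum
      exact (Submodule.add_mem_iff_left L (sum_mem key)).1 hsum
    · exact key μ hμ

theorem isLower_shiftWt (h : κ' < κ) : IsLower A (shiftWt A μ κ') (shiftWt A μ κ) := by
  refine ⟨κ - κ', fun h0 => h.not_ge (tsub_eq_zero_iff_le.1 h0), fun s => ?_⟩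
  have : ∀ t, ((κ - κ') t : ℤ) = κ t - κ' t := fun t => by
    rw [Pi.sub_apply, Nat.cast_sub (h.le t)]
  simp only [this, shiftWt, mul_sub, Finset.sum_sub_distrib]
  ring

/-- The weight components of `g v` lie in the generated module, since that module is stable under
the coroots. The weight of `lead` is a separate hypothesis because `c` may vanish, in which case
`hLT` says nothing about it. -/
theorem hasLeadingTerm_of_LT (hirr : ∀ lam, ¬ IsLower A lam lam) {v lead : V} {c : ℂ}
    {g : Module.End ℂ V} (hg : g v ∈ R.generated n v) (hLT : LT A R μ κ (g v) (c • lead))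
    (hlead : lead ∈ weightSpace R (shiftWt A μ κ)) (h0 : lead ≠ 0) :
    HasLeadingTerm A R v g c lead := by
  classical
  set lam := shiftWt A μ κ with hlam
  refine ⟨lam, ⟨h0, hlead⟩, g v - c • lead, ?_, by simp⟩
  -- Degrees are forgotten here: indexed by weights, components with different indices can be
  -- separated by the coroots.
  have h1 : g v - c • lead ∈ ⨆ μ' : {μ' : Fin n → ℤ // IsLower A μ' lam}, weightSpace R μ'.1 := by
    refine (iSup_le fun η => ?_ : Low A R μ κ ≤ _) hLT.2
    exact le_iSup (fun μ' : {μ' : Fin n → ℤ // IsLower A μ' lam} => weightSpace R μ'.1)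
      ⟨_, isLower_shiftWt η.2⟩
  obtain ⟨f, hf, hsum⟩ := (Submodule.mem_iSup_iff_exists_finsupp _ _).1 h1
  rw [← hsum]
  -- All components of `g v`: those of lower weight come from `f`, the one of weight `lam` is the
  -- leading term.
  set F : (Fin n → ℤ) → V := fun ν => if h : IsLower A ν lam then f ⟨ν, h⟩ else
    if ν = lam then c • lead else 0 with hF
  set S : Finset (Fin n → ℤ) := f.support.map (Function.Embedding.subtype _)
  have hS : lam ∉ S := by simp [S, hirr]
  have hSsum : ∑ ν ∈ S, F ν = f.sum fun _ z => z := by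
    rw [Finset.sum_map, Finsupp.sum]
    exact Finset.sum_congr rfl fun ν _ => by simp [hF, ν.2]
  have hcomp := weight_component_mem (R.generated n v)
    (fun t y hy => (generated_stable (t + 1) (by simp) v hy).2) (insert lam S) F
    (fun ν _ => by
      by_cases h : IsLower A ν lam
      · simpa [hF, h] using hf ⟨ν, h⟩
      · by_cases h' : ν = lam
        · subst h'
          simpa [hF, h] using Submodule.smul_mem _ _ hlead
        · simp [hF, h, h'])
    (by
      rw [Finset.sum_insert hS, hSsum, hsum]
      simpa [hF, hirr] using hg)
  refine sum_mem fun ν hν => ?_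
  by_cases hz : f ν = 0
  · rw [hz]; exact zero_mem _
  · refine Submodule.subset_span ⟨?_, ν.1, ⟨hz, hf ν⟩, ν.2⟩
    have := hcomp ν.1 (Finset.mem_insert_of_mem (by simpa [S] using ⟨ν.2, hz⟩))
    simpa [hF, ν.2] using this

/-- If `A k = 0` with `k ≥ 0`, pairing with `c` gives a vanishing sum of nonnegative terms `(cA)_t
k_t`. Every `(cA)_t` is positive, so `k = 0`. -/
theorem irrefl_of_functional (c : Fin n → ℤ) (hc : ∀ t, 0 < ∑ s, c s * A s t)
    (lam : Fin n → ℤ) : ¬ IsLower A lam lam := by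
  rintro ⟨k, hk, h⟩
  have h1 : ∑ t, (∑ s, c s * A s t) * (k t : ℤ) = 0 := by
    simp_rw [Finset.sum_mul]
    rw [Finset.sum_comm]
    refine Finset.sum_eq_zero fun s _ => ?_
    simp_rw [mul_assoc]
    rw [← Finset.mul_sum, ← h s, sub_self, mul_zero]
  refine hk (funext fun t => ?_)
  have := (Finset.sum_eq_zero_iff_of_nonneg
    (fun t _ => mul_nonneg (hc t).le (Int.natCast_nonneg _))).1 h1 t (Finset.mem_univ _)
  simpa [(hc t).ne'] using this

end Framework

/-! ### The weight lattice orders are strict -/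

theorem sum_fin_ite_val {n : ℕ} (c : ℕ → ℤ) (j : ℕ) :
    ∑ s : Fin n, (if (s : ℕ) = j then c j else 0) = if j < n then c j else 0 := by
  rw [Fin.sum_univ_eq_sum_range (fun s => if s = j then c j else 0) n, Finset.sum_ite_eq']
  simp

theorem sum_fin_ite_add {n : ℕ} (c : ℕ → ℤ) (j d : ℕ) (hj : j < n) :
    ∑ s : Fin n, (if j = (s : ℕ) + d then c (j - d) else 0) = if d ≤ j then c (j - d) else 0 := by
  by_cases h : d ≤ j
  · have : ∀ s : Fin n, (if j = (s : ℕ) + d then c (j - d) else 0) =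
        if (s : ℕ) = j - d then c (j - d) else 0 := fun s => if_congr (by omega) rfl rfl
    simp_rw [this]
    rw [sum_fin_ite_val c (j - d), if_pos (by omega), if_pos h]
  · rw [if_neg h]
    exact Finset.sum_eq_zero fun s _ => if_neg (by omega)

theorem irrefl_cartanB (n : ℕ) (lam : Fin n → ℤ) : ¬ IsLower (cartanB n) lam lam := by
  -- Twice the coefficients of the sum of the positive coroots in the simple coroots, the factor two
  -- avoiding halves at the last node. Every simple root takes the value `4`.
  refine irrefl_of_functional
    (fun s => if (s : ℕ) + 1 = n then (n : ℤ) * (n + 1) else 2 * ((s : ℤ) + 1) * (2 * n - s)) ?_ lam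
  intro t
  set c : ℕ → ℤ := fun s =>
    if s + 1 = n then (n : ℤ) * (n + 1) else 2 * ((s : ℤ) + 1) * (2 * n - s) with hc
  have : ∀ s : Fin n, c s * cartanB n s t =
      (if (s : ℕ) = t then 2 * c t else 0) +
      (if (s : ℕ) = t + 1 then -(if (t : ℕ) + 2 = n then 2 else 1) * c (t + 1) else 0) +
      (if (t : ℕ) = s + 1 then - c (t - 1) else 0) := by
    intro s
    simp only [cartanB, Matrix.of_apply, Fin.ext_iff]
    have ht := t.2
    have hs := s.2
    rcases lt_trichotomy (s : ℕ) t with h | h | h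
    · by_cases h' : (t : ℕ) = s + 1
      · have : (t : ℕ) - 1 = s := by omega
        simp [h', show ¬ (s : ℕ) = s + 1 + 1 by omega]
      · simp [h.ne, h', show ¬ (s : ℕ) = t + 1 by omega]
    · rw [h]; simp; ring
    · by_cases h' : (s : ℕ) = t + 1
      · simp only [h']
        simp [show (t : ℕ) + 1 + 1 = t + 2 by omega]
        split_ifs <;> ring
      · simp [h.ne', h', show ¬ (t : ℕ) = s + 1 by omega]
  change 0 < ∑ s : Fin n, c s * cartanB n s t
  simp only [this, Finset.sum_add_distrib]
  rw [sum_fin_ite_val (fun j => 2 * c j), sum_fin_ite_val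
    (fun j => -(if (t : ℕ) + 2 = n then 2 else 1) * c j), sum_fin_ite_add (fun j => -c j) _ 1 t.2]
  obtain ⟨t, ht⟩ := t
  obtain ⟨r, rfl⟩ : ∃ r, n = t + 1 + r := ⟨n - (t + 1), by omega⟩
  rcases t with _ | t <;> rcases r with _ | _ | r <;> simp [hc] <;> grind

theorem irrefl_cartanC (n : ℕ) (lam : Fin n → ℤ) : ¬ IsLower (cartanC n) lam lam := by
  -- The coefficients of the sum of the positive coroots in the simple coroots. Every simple root
  -- takes the value `2`.
  refine irrefl_of_functional (fun s => ((s : ℤ) + 1) * (2 * n - 1 - s)) ?_ lam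
  intro t
  set c : ℕ → ℤ := fun s => ((s : ℤ) + 1) * (2 * n - 1 - s) with hc
  have : ∀ s : Fin n, c s * cartanC n s t =
      (if (s : ℕ) = t then 2 * c t else 0) +
      (if (s : ℕ) = t + 1 then - c (t + 1) else 0) +
      (if (t : ℕ) = s + 1 then -(if (t : ℕ) + 1 = n then 2 else 1) * c (t - 1) else 0) := by
    intro s
    simp only [cartanC, Matrix.of_apply, Fin.ext_iff]
    have ht := t.2
    have hs := s.2
    rcases lt_trichotomy (s : ℕ) t with h | h | h
    · by_cases h' : (t : ℕ) = s + 1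
      · simp [h', show ¬ (s : ℕ) = s + 1 + 1 by omega]
        split_ifs <;> ring
      · simp [h.ne, h', show ¬ (s : ℕ) = t + 1 by omega]
    · rw [h]; simp; ring
    · by_cases h' : (s : ℕ) = t + 1
      · simp only [h']
        simp [show ¬ (t : ℕ) = t + 1 + 1 by omega]
      · simp [h.ne', h', show ¬ (t : ℕ) = s + 1 by omega]
  change 0 < ∑ s : Fin n, c s * cartanC n s t
  simp only [this, Finset.sum_add_distrib]
  rw [sum_fin_ite_val (fun j => 2 * c j), sum_fin_ite_val
    (fun j => - c j), sum_fin_ite_add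
    (fun j => -(if (t : ℕ) + 1 = n then 2 else 1) * c j) _ 1 t.2]
  obtain ⟨t, ht⟩ := t
  obtain ⟨r, rfl⟩ : ∃ r, n = t + 1 + r := ⟨n - (t + 1), by omega⟩
  rcases t with _ | t <;> rcases r with _ | _ | r <;> simp [hc] <;> grind

theorem irrefl_cartanD (n : ℕ) (hn : 2 ≤ n) (lam : Fin n → ℤ) : ¬ IsLower (cartanD n) lam lam := by
  -- Again twice the coefficients of the sum of the positive coroots. The last two nodes form the
  -- fork and have equal coefficients.
  refine irrefl_of_functional (fun s =>
    if n ≤ (s : ℕ) + 2 then (n : ℤ) * (n - 1) else 2 * ((s : ℤ) + 1) * (2 * n - 2 - s)) ?_ lam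
  intro t
  set c : ℕ → ℤ := fun s =>
    if n ≤ s + 2 then (n : ℤ) * (n - 1) else 2 * ((s : ℤ) + 1) * (2 * n - 2 - s) with hc
  have : ∀ s : Fin n, c s * cartanD n s t =
      (if (s : ℕ) = t then 2 * c t else 0) +
      (if (s : ℕ) = t + 1 then -(if (t : ℕ) + 2 < n then 1 else 0) * c (t + 1) else 0) +
      (if (s : ℕ) = t + 2 then -(if (t : ℕ) + 3 = n then 1 else 0) * c (t + 2) else 0) +
      (if (t : ℕ) = s + 1 then -(if (t : ℕ) + 1 < n then 1 else 0) * c (t - 1) else 0) +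
      (if (t : ℕ) = s + 2 then -(if (t : ℕ) + 1 = n then 1 else 0) * c (t - 2) else 0) := by
    intro s
    simp only [cartanD, Matrix.of_apply, Fin.ext_iff]
    have ht := t.2
    have hs := s.2
    generalize (s : ℕ) = s at *
    generalize (t : ℕ) = t at *
    rcases lt_trichotomy s t with h | h | h
    · rcases (show t = s + 1 ∨ t = s + 2 ∨ s + 2 < t by omega) with rfl | rfl | h'
      · simp
        split_ifs <;> omega
      · simp
        split_ifs <;> omega
      · rw [if_neg (by omega), if_neg (by omega), if_neg (by omega), if_neg (by omega),
          if_neg (by omega), if_neg (by omega), if_neg (by omega), if_neg (by omega)]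
        simp
    · rw [h]; simp; ring
    · rcases (show s = t + 1 ∨ s = t + 2 ∨ t + 2 < s by omega) with rfl | rfl | h'
      · simp
        split_ifs <;> omega
      · simp
        split_ifs <;> omega
      · rw [if_neg (by omega), if_neg (by omega), if_neg (by omega), if_neg (by omega),
          if_neg (by omega), if_neg (by omega), if_neg (by omega), if_neg (by omega)]
        simp
  change 0 < ∑ s : Fin n, c s * cartanD n s t
  simp only [this, Finset.sum_add_distrib]
  rw [sum_fin_ite_val (fun j => 2 * c j),
    sum_fin_ite_val (fun j => -(if (t : ℕ) + 2 < n then 1 else 0) * c j),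
    sum_fin_ite_val (fun j => -(if (t : ℕ) + 3 = n then 1 else 0) * c j),
    sum_fin_ite_add (fun j => -(if (t : ℕ) + 1 < n then 1 else 0) * c j) _ 1 t.2,
    sum_fin_ite_add (fun j => -(if (t : ℕ) + 1 = n then 1 else 0) * c j) _ 2 t.2]
  obtain ⟨t, ht⟩ := t
  obtain ⟨r, rfl⟩ : ∃ r, n = t + 1 + r := ⟨n - (t + 1), by omega⟩
  rcases t with _ | _ | t <;> rcases r with _ | _ | _ | _ | r <;> simp [hc] at hn ⊢ <;> grind

/-! ### Actions given on a basis -/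

section Basis

variable {X : Type} {n : ℕ} {A : Matrix (Fin n) (Fin n) ℤ} {R : ChevalleyAction (X →₀ ℂ)}

theorem isGraded_of_basis (wt : X → Fin n → ℤ)
    (hwt : ∀ x, Finsupp.single x (1 : ℂ) ∈ weightSpace R (wt x))
    (he : ∀ x (t : Fin n), R.e (t + 1) (Finsupp.single x 1) = 0 ∨
      ∃ x', R.e (t + 1) (Finsupp.single x 1) = Finsupp.single x' 1 ∧
        ∀ s, wt x' s = wt x s + A s t) : IsGraded A R := by
  intro s t y
  have key : R.h (s + 1) ∘ₗ R.e (t + 1) =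
      R.e (t + 1) ∘ₗ R.h (s + 1) + (A s t : ℂ) • R.e (t + 1) := by
    refine Finsupp.lhom_ext' fun x => LinearMap.ext_ring ?_
    simp only [LinearMap.comp_apply, LinearMap.add_apply, LinearMap.smul_apply,
      Finsupp.lsingle_apply]
    rw [hwt x s, map_smul]
    rcases he x t with h | ⟨x', h, hx'⟩
    · simp [h]
    · rw [h, hwt x' s, hx', Int.cast_add, add_smul]
  exact LinearMap.congr_fun key y

theorem sq_eq_zero_of_basis (T : Module.End ℂ (X →₀ ℂ))
    (h : ∀ x, T (T (Finsupp.single x 1)) = 0) : T * T = 0 :=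
  Finsupp.lhom_ext' fun x => LinearMap.ext_ring (by simpa using h x)

theorem supported_le_comap {Y W : Type*} [AddCommGroup W] [Module ℂ W]
    (T : (Y →₀ ℂ) →ₗ[ℂ] W) (S : Set Y) (L : Submodule ℂ W)
    (h : ∀ x ∈ S, T (Finsupp.single x 1) ∈ L) {y : Y →₀ ℂ} (hy : y ∈ Finsupp.supported ℂ ℂ S) :
    T y ∈ L := by
  rw [Finsupp.supported_eq_span_single] at hy
  have : Submodule.span ℂ ((fun i => Finsupp.single i (1 : ℂ)) '' S) ≤ L.comap T := by
    rw [Submodule.span_le]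
    rintro _ ⟨x, hx, rfl⟩
    exact h x hx
  exact this hy

/-- Lets the weight of a raised basis vector be read off from the grading instead of being computed
again. -/
theorem weight_unique {V : Type} [AddCommGroup V] [Module ℂ V] {R : ChevalleyAction V}
    {μ ν : Fin n → ℤ} {y : V} (hy : y ≠ 0) (hμ : y ∈ weightSpace R μ)
    (hν : y ∈ weightSpace R ν) : μ = ν := by
  ext t
  have := (hμ t).symm.trans (hν t)
  exact_mod_cast smul_left_injective ℂ hy this

end Basis

/-! ### Sequences of signs -/

section Signs

variable {n : ℕ} {ε ε' : Signs n}

theorem entry_eq (ε : Signs n) (t : Fin n) : entry ε (t + 1) = ε t := by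
  simp [entry]

theorem entry_cases (ε : Signs n) {j : ℕ} (h1 : 1 ≤ j) (h2 : j ≤ n) :
    entry ε j = 1 ∨ entry ε j = -1 := by
  rw [entry, dif_pos ⟨h1, h2⟩]
  rcases Int.units_eq_one_or (ε ⟨j - 1, by omega⟩) with h | h <;> simp [h]

theorem entry_setEntry (ε : Signs n) (j : ℕ) (s : ℤˣ) {l : ℕ} (h1 : 1 ≤ l) (h2 : l ≤ n) :
    entry (setEntry ε j s) l = if l = j then (s : ℤ) else entry ε l := by
  simp only [entry, h1, h2, and_self, dif_pos, setEntry, Nat.sub_add_cancel h1]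
  split_ifs <;> rfl

theorem signs_ext (h : ∀ j, 1 ≤ j → j ≤ n → entry ε j = entry ε' j) : ε = ε' := by
  ext t
  have := h (t + 1) (by omega) (by omega)
  rwa [entry_eq, entry_eq] at this

/-- `(-, +)` at the positions `j`, `j + 1` becomes `(+, -)`. -/
def raise (ε : Signs n) (j : ℕ) : Signs n := setEntry (setEntry ε j 1) (j + 1) (-1)

theorem entry_raise (ε : Signs n) (j : ℕ) {l : ℕ} (h1 : 1 ≤ l) (h2 : l ≤ n) :
    entry (raise ε j) l = if l = j + 1 then -1 else if l = j then 1 else entry ε l := by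
  rw [raise, entry_setEntry _ _ _ h1 h2, entry_setEntry _ _ _ h1 h2]
  simp

end Signs

/-! ### Weights of the spin representations -/

section SpinWeights

variable {n : ℕ}

/-- The weight of `ε` in type `B_n`. -/
def wtB (ε : Signs n) : Fin n → ℤ := fun s =>
  if (s : ℕ) + 1 < n then (entry ε (s + 1) - entry ε (s + 2)) / 2 else entry ε n

/-- The weight of `ε` in type `D_n`. -/
def wtD (ε : Signs n) : Fin n → ℤ := fun s =>
  if (s : ℕ) + 1 < n then (entry ε (s + 1) - entry ε (s + 2)) / 2
  else (entry ε (n - 1) + entry ε n) / 2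

theorem spinB_e_of_lt {j : ℕ} (hj : j < n) (ε : Signs n) :
    (spinB n).e j (spinVec ε) =
      if entry ε j = -1 ∧ entry ε (j + 1) = 1 then spinVec (raise ε j) else 0 := by
  simp [spinB, hj, hj.ne, raise]

theorem spinB_e_last (ε : Signs n) :
    (spinB n).e n (spinVec ε) = if entry ε n = -1 then spinVec (setEntry ε n 1) else 0 := by
  simp [spinB]

theorem spinD_e_of_lt {j : ℕ} (hj : j < n) (ε : Signs n) :
    (spinD n).e j (spinVec ε) =
      if entry ε j = -1 ∧ entry ε (j + 1) = 1 then spinVec (raise ε j) else 0 := by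
  simp [spinD, hj, hj.ne, raise]

theorem spinD_e_last (ε : Signs n) :
    (spinD n).e n (spinVec ε) = if entry ε (n - 1) = -1 ∧ entry ε n = -1 then
      spinVec (setEntry (setEntry ε (n - 1) 1) n 1) else 0 := by
  simp [spinD]

theorem intCast_half {z : ℤ} (h : z % 2 = 0) : (((z / 2 : ℤ)) : ℂ) = (z : ℂ) / 2 := by
  obtain ⟨w, rfl⟩ := Int.dvd_of_emod_eq_zero h
  simp

theorem spinVec_mem_weightSpaceB (ε : Signs n) : spinVec ε ∈ weightSpace (spinB n) (wtB ε) := by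
  intro t
  by_cases h : (t : ℕ) + 1 < n
  · have h1 := entry_cases ε (j := t + 1) (by omega) (by omega)
    have h2 := entry_cases ε (j := t + 2) (by omega) (by omega)
    have h3 : (entry ε (t + 1) - entry ε (t + 2)) % 2 = 0 := by omega
    simp only [wtB, h, if_true, intCast_half h3]
    simp [spinB, h]
  · have h' : (t : ℕ) + 1 = n := by omega
    simp [spinB, h', wtB]

theorem spinVec_mem_weightSpaceD (hn : 2 ≤ n) (ε : Signs n) :
    spinVec ε ∈ weightSpace (spinD n) (wtD ε) := by
  intro t
  by_cases h : (t : ℕ) + 1 < n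
  · have h1 := entry_cases ε (j := t + 1) (by omega) (by omega)
    have h2 := entry_cases ε (j := t + 2) (by omega) (by omega)
    have h3 : (entry ε (t + 1) - entry ε (t + 2)) % 2 = 0 := by omega
    simp only [wtD, h, if_true, intCast_half h3]
    simp [spinD, h]
  · have h' : (t : ℕ) + 1 = n := by omega
    have h1 := entry_cases ε (j := n - 1) (by omega) (by omega)
    have h2 := entry_cases ε (j := n) (by omega) (by omega)
    have h3 : (entry ε (n - 1) + entry ε n) % 2 = 0 := by omega
    simp only [wtD, h, if_false, intCast_half h3]
    simp [spinD, h']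

theorem isGraded_spinB (n : ℕ) : IsGraded (cartanB n) (spinB n) := by
  refine isGraded_of_basis wtB spinVec_mem_weightSpaceB fun ε t => ?_
  by_cases h : (t : ℕ) + 1 < n
  · rw [spinB_e_of_lt h]
    split_ifs with hε
    · refine Or.inr ⟨_, rfl, fun s => ?_⟩
      simp only [wtB, cartanB, Matrix.of_apply, Fin.ext_iff]
      rw [entry_raise ε _ (l := n) (by omega) le_rfl]
      by_cases hs : (s : ℕ) + 1 < n
      · rw [entry_raise ε _ (l := s + 1) (by omega) (by omega),
          entry_raise ε _ (l := s + 2) (by omega) (by omega)]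
        have h1 := entry_cases ε (j := s + 1) (by omega) (by omega)
        have h2 := entry_cases ε (j := s + 2) (by omega) (by omega)
        -- These implications record the known entries at the changed positions; with them each
        -- entry of the Cartan matrix is a matter of linear arithmetic.
        have e1 : (s : ℕ) = t → entry ε (s + 1) = -1 := fun h => by rw [h]; exact hε.1
        have e2 : (s : ℕ) = t → entry ε (s + 2) = 1 := fun h => by rw [h]; exact hε.2
        have e3 : (s : ℕ) = t + 1 → entry ε (s + 1) = 1 := fun h => by rw [h]; exact hε.2
        have e4 : (t : ℕ) = s + 1 → entry ε (s + 2) = -1 := fun h => by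
          rw [show (s : ℕ) + 2 = t + 1 by omega]; exact hε.1
        rw [if_pos hs, if_pos hs]
        clear hε
        split_ifs <;> omega
      · have e3 : (n : ℕ) = t + 2 → entry ε n = 1 := fun h =>
          (congrArg (entry ε) h).trans hε.2
        rw [if_neg hs, if_neg hs]
        clear hε
        split_ifs <;> omega
    · exact Or.inl rfl
  · have h' : (t : ℕ) + 1 = n := by omega
    rw [h', spinB_e_last]
    split_ifs with hε
    · refine Or.inr ⟨_, rfl, fun s => ?_⟩
      simp only [wtB, cartanB, Matrix.of_apply, Fin.ext_iff]
      rw [entry_setEntry ε _ _ (l := n) (by omega) le_rfl]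
      by_cases hs : (s : ℕ) + 1 < n
      · rw [entry_setEntry ε _ _ (l := s + 1) (by omega) (by omega),
          entry_setEntry ε _ _ (l := s + 2) (by omega) (by omega)]
        have h1 := entry_cases ε (j := s + 1) (by omega) (by omega)
        have h2 := entry_cases ε (j := s + 2) (by omega) (by omega)
        have e2 : (s : ℕ) + 2 = n → entry ε (s + 2) = -1 := fun h => by rw [h]; exact hε
        rw [if_pos hs, if_pos hs]
        simp only [Units.val_one]
        split_ifs <;> omega
      · rw [if_neg hs, if_neg hs]
        simp only [Units.val_one]
        split_ifs <;> omega
    · exact Or.inl rfl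

theorem isGraded_spinD (hn : 2 ≤ n) : IsGraded (cartanD n) (spinD n) := by
  refine isGraded_of_basis wtD (spinVec_mem_weightSpaceD hn) fun ε t => ?_
  by_cases h : (t : ℕ) + 1 < n
  · rw [spinD_e_of_lt h]
    split_ifs with hε
    · refine Or.inr ⟨_, rfl, fun s => ?_⟩
      simp only [wtD, cartanD, Matrix.of_apply, Fin.ext_iff]
      rw [entry_raise ε _ (l := n) (by omega) le_rfl,
        entry_raise ε _ (l := n - 1) (by omega) (by omega)]
      by_cases hs : (s : ℕ) + 1 < n
      · rw [entry_raise ε _ (l := s + 1) (by omega) (by omega),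
          entry_raise ε _ (l := s + 2) (by omega) (by omega)]
        have h1 := entry_cases ε (j := s + 1) (by omega) (by omega)
        have h2 := entry_cases ε (j := s + 2) (by omega) (by omega)
        have e1 : (s : ℕ) = t → entry ε (s + 1) = -1 := fun h => by rw [h]; exact hε.1
        have e2 : (s : ℕ) = t → entry ε (s + 2) = 1 := fun h => by rw [h]; exact hε.2
        have e3 : (s : ℕ) = t + 1 → entry ε (s + 1) = 1 := fun h => by rw [h]; exact hε.2
        have e4 : (t : ℕ) = s + 1 → entry ε (s + 2) = -1 := fun h => by
          rw [show (s : ℕ) + 2 = t + 1 by omega]; exact hε.1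
        rw [if_pos hs, if_pos hs]
        clear hε
        split_ifs <;> omega
      · have h1 := entry_cases ε (j := n) (by omega) (by omega)
        have h2 := entry_cases ε (j := n - 1) (by omega) (by omega)
        have e3 : (n : ℕ) = t + 2 → entry ε n = 1 := fun h =>
          (congrArg (entry ε) h).trans hε.2
        have e4 : (n : ℕ) = t + 2 → entry ε (n - 1) = -1 := fun h => by
          rw [show n - 1 = t + 1 by omega]; exact hε.1
        have e5 : (n : ℕ) = t + 3 → entry ε (n - 1) = 1 := fun h => by
          rw [show n - 1 = t + 1 + 1 by omega]; exact hε.2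
        rw [if_neg hs, if_neg hs]
        clear hε
        split_ifs <;> omega
    · exact Or.inl rfl
  · have h' : (t : ℕ) + 1 = n := by omega
    rw [h', spinD_e_last]
    split_ifs with hε
    · refine Or.inr ⟨_, rfl, fun s => ?_⟩
      have key : ∀ l, 1 ≤ l → l ≤ n → entry (setEntry (setEntry ε (n - 1) 1) n 1) l =
          if l = n then 1 else if l = n - 1 then 1 else entry ε l := fun l h1 h2 => by
        rw [entry_setEntry _ _ _ h1 h2, entry_setEntry _ _ _ h1 h2]; simp
      simp only [wtD, cartanD, Matrix.of_apply, Fin.ext_iff]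
      rw [key n (by omega) le_rfl, key (n - 1) (by omega) (by omega)]
      by_cases hs : (s : ℕ) + 1 < n
      · rw [key (s + 1) (by omega) (by omega), key (s + 2) (by omega) (by omega)]
        have h1 := entry_cases ε (j := s + 1) (by omega) (by omega)
        have h2 := entry_cases ε (j := s + 2) (by omega) (by omega)
        have e1 : (s : ℕ) + 2 = n → entry ε (s + 2) = -1 := fun h => by rw [h]; exact hε.2
        have e2 : (s : ℕ) + 1 = n - 1 → entry ε (s + 1) = -1 := fun h => by rw [h]; exact hε.1
        have e3 : (s : ℕ) + 2 = n - 1 → entry ε (s + 2) = -1 := fun h => by rw [h]; exact hε.1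
        rw [if_pos hs, if_pos hs]
        clear hε
        split_ifs <;> omega
      · rw [if_neg hs, if_neg hs, hε.1, hε.2]
        split_ifs <;> omega
    · exact Or.inl rfl

/-- After one application the entry at `j` is `+`, and `e_j` needs a minus sign there. -/
theorem spinB_e_sq {j : ℕ} (hj : j ∈ Finset.Icc 1 n) : (spinB n).e j * (spinB n).e j = 0 := by
  obtain ⟨h1, h2⟩ := Finset.mem_Icc.1 hj
  refine sq_eq_zero_of_basis _ fun ε => ?_
  rcases h2.lt_or_eq with h | rfl
  · rw [spinB_e_of_lt h]
    split_ifs with hε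
    · rw [spinB_e_of_lt h, entry_raise ε _ h1 h.le]
      simp
    · simp
  · rw [spinB_e_last]
    split_ifs with hε
    · rw [spinB_e_last, entry_setEntry ε _ _ h1 le_rfl]
      simp
    · simp

theorem spinD_e_sq {j : ℕ} (hj : j ∈ Finset.Icc 1 n) : (spinD n).e j * (spinD n).e j = 0 := by
  obtain ⟨h1, h2⟩ := Finset.mem_Icc.1 hj
  refine sq_eq_zero_of_basis _ fun ε => ?_
  rcases h2.lt_or_eq with h | rfl
  · rw [spinD_e_of_lt h]
    split_ifs with hε
    · rw [spinD_e_of_lt h, entry_raise ε _ h1 h.le]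
      simp
    · simp
  · rw [spinD_e_last]
    split_ifs with hε
    · rw [spinD_e_last, entry_setEntry _ _ _ h1 le_rfl]
      simp
    · simp

end SpinWeights

/-! ### Words of the form `x_p(b_p) ⋯ x_{q-1}(b_{q-1}) Y x_{q-1}(a_{q-1}) ⋯ x_p(a_p)` -/

section Sandwich

variable {V : Type} [AddCommGroup V] [Module ℂ V] [Module ℚ V] [SMulCommClass ℂ ℚ V]

/-- The operator `x_p(b_p) ⋯ x_{q-1}(b_{q-1}) Y x_{q-1}(a_{q-1}) ⋯ x_p(a_p)` with `p = q - d`. -/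
def sandwich (R : ChevalleyAction V) (a b : ℕ → ℂ) (Y : Module.End ℂ V) (q : ℕ) :
    ℕ → Module.End ℂ V
  | 0 => Y
  | d + 1 => R.x (q - (d + 1)) (b (q - (d + 1))) * sandwich R a b Y q d *
      R.x (q - (d + 1)) (a (q - (d + 1)))

theorem ascending_succ (R : ChevalleyAction V) (r : ℕ) (c : ℕ → ℂ) :
    ascending R (r + 1) c = ascending R r c * R.x (r + 1) (c (r + 1)) := by
  simp [ascending, List.range_succ]

theorem descending_succ (R : ChevalleyAction V) (r : ℕ) (c : ℕ → ℂ) :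
    descending R (r + 1) c = R.x (r + 1) (c (r + 1)) * descending R r c := by
  simp [descending, List.range_succ]

/-- The last factor of the ascending word and the first factor of the descending word stand next to
the sandwich and have the same number, so they form its next layer. -/
theorem ascending_mul_descending (R : ChevalleyAction V) (a b : ℕ → ℂ) (Y : Module.End ℂ V)
    (r d : ℕ) (hd : d ≤ r) :
    ascending R r b * Y * descending R r a =
      ascending R (r - d) b * sandwich R a b Y (r + 1) d * descending R (r - d) a := by
  induction d with
  | zero => rfl
  | succ d ih =>
    rw [ih (by omega)]
    obtain ⟨s, hs⟩ : ∃ s, r - d = s + 1 := ⟨r - d - 1, by omega⟩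
    have h1 : r - (d + 1) = s := by omega
    have h2 : r + 1 - (d + 1) = s + 1 := by omega
    rw [sandwich, hs, h1, h2, ascending_succ, descending_succ]
    simp only [mul_assoc]

theorem wordBC_eq_sandwich (R : ChevalleyAction V) (a b : ℕ → ℂ) (m : ℕ) :
    wordBC R (m + 1) a b = sandwich R a b (R.x (m + 1) (a (m + 1))) (m + 1) m := by
  have := ascending_mul_descending R a b (R.x (m + 1) (a (m + 1))) m m le_rfl
  rw [wordBC, descending_succ, ← mul_assoc, Nat.add_sub_cancel, this]
  simp [ascending, descending]

/-- In type `D` the two nodes of the fork form the core, and the layers are numbered `m, …, 1`. -/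
theorem wordD_eq_sandwich (R : ChevalleyAction V) (a b : ℕ → ℂ) (m : ℕ) :
    wordD R (m + 2) a b =
      sandwich R a b (R.x (m + 2) (b (m + 1)) * R.x (m + 1) (a (m + 1))) (m + 1) m := by
  have := ascending_mul_descending R a b (R.x (m + 2) (b (m + 1)) * R.x (m + 1) (a (m + 1)))
    m m le_rfl
  rw [wordD, show m + 2 - 1 = m + 1 from rfl, descending_succ, show m + 2 - 2 = m from rfl,
    ← mul_assoc, mul_assoc (ascending R m b), this]
  simp [ascending, descending]

end Sandwich

/-! ### The leading term on a basis vector of a spin representation -/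

section SpinLeading

variable {n : ℕ}

/-- All positions behind `q` carry the sign `s`. -/
def TailEq (q : ℕ) (s : ℤˣ) (ε : Signs n) : Prop := ∀ t : Fin n, q < (t : ℕ) + 1 → ε t = s

/-- The entry `ε_p` is replaced by `+`, and the entries behind `q` change their signs. -/
def leadSign (p q : ℕ) (ε : Signs n) : Signs n :=
  fun t => if (t : ℕ) + 1 = p then 1 else if q < (t : ℕ) + 1 then -ε t else ε t

theorem entry_leadSign (p q : ℕ) (ε : Signs n) {l : ℕ} (h1 : 1 ≤ l) (h2 : l ≤ n) :
    entry (leadSign p q ε) l = if l = p then 1 else if q < l then -entry ε l else entry ε l := by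
  simp only [entry, h1, h2, and_self, dif_pos, leadSign, Nat.sub_add_cancel h1]
  split_ifs <;> simp

/-- The multiplicities of the simple roots in the difference of the weights of the leading vector
and of `ε`. -/
def leadMult (n : ℕ) (τ : Fin n → ℕ) (p q : ℕ) : Fin n → ℕ := τ + ∑ t ∈ Finset.Ico p q, node n t

/-- The coefficient of the leading vector. -/
def leadCoeff (a b : ℕ → ℂ) (c : ℂ) (p q : ℕ) (ε : Signs n) : ℂ :=
  (∏ t ∈ Finset.Ico p q, if entry ε (t + 1) = 1 then a t else b t) * c

theorem leadMult_eq_add {τ : Fin n → ℕ} {p q : ℕ} (h : p < q) :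
    leadMult n τ p q = leadMult n τ (p + 1) q + node n p := by
  rw [leadMult, Finset.sum_eq_sum_Ico_succ_bot h, leadMult]
  abel

variable {A : Matrix (Fin n) (Fin n) ℤ} {R : ChevalleyAction (Spin n)} {wt : Signs n → Fin n → ℤ}
  {q : ℕ}

/-- The properties of the two types of spin representations that enter the computation of the
leading term; `Y` is the inner part of the word. -/
structure SpinData (A : Matrix (Fin n) (Fin n) ℤ) (R : ChevalleyAction (Spin n))
    (wt : Signs n → Fin n → ℤ) (q : ℕ) (s : ℤˣ) (Y : Module.End ℂ (Spin n))
    (τ : Fin n → ℕ) (c : ℂ) : Prop where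
  graded : IsGraded A R
  mem_weightSpace : ∀ ε, spinVec ε ∈ weightSpace R (wt ε)
  le : q ≤ n
  e_of_lt : ∀ p < q, ∀ ε, R.e p (spinVec ε) =
    if entry ε p = -1 ∧ entry ε (p + 1) = 1 then spinVec (raise ε p) else 0
  e_sq : ∀ j ∈ Finset.Icc 1 n, R.e j * R.e j = 0
  mult_pos : 0 < τ
  inner_minus : ∀ ε, TailEq q s ε → entry ε q = -1 →
    LT A R (wt ε) τ (Y (spinVec ε)) (c • spinVec (leadSign q q ε))
  inner_plus : ∀ ε, TailEq q s ε → entry ε q = 1 → Y (spinVec ε) ∈ Le A R (wt ε) 0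
  inner_supported : ∀ p < q, 1 ≤ p → ∀ y ∈ Finsupp.supported ℂ ℂ {ε : Signs n | entry ε p = 1},
    Y y ∈ Finsupp.supported ℂ ℂ {ε : Signs n | entry ε p = 1}

namespace SpinData

variable {s : ℤˣ} {Y : Module.End ℂ (Spin n)} {τ : Fin n → ℕ} {c : ℂ} {a b : ℕ → ℂ}

theorem x_apply (H : SpinData A R wt q s Y τ c) {p : ℕ} (h1 : 1 ≤ p) (hp : p < q) (z : ℂ)
    (y : Spin n) : R.x p z y = y + z • R.e p y :=
  x_apply_of_sq (H.e_sq p (Finset.mem_Icc.2 ⟨h1, hp.le.trans H.le⟩)) z y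

/-- The operator `e_p` acts only on sequences with a minus sign at `p`. -/
theorem x_of_supported (H : SpinData A R wt q s Y τ c) {p : ℕ} (h1 : 1 ≤ p) (hp : p < q) (z : ℂ)
    {y : Spin n} (hy : y ∈ Finsupp.supported ℂ ℂ {ε : Signs n | entry ε p = 1}) :
    R.x p z y = y := by
  have : R.e p y ∈ (⊥ : Submodule ℂ (Spin n)) := by
    refine supported_le_comap (R.e p) _ ⊥ (fun ε hε => ?_) hy
    have hε : entry ε p = 1 := hε
    rw [H.e_of_lt p hp, hε]
    simp
  rw [H.x_apply h1 hp, (Submodule.mem_bot ℂ).1 this, smul_zero, add_zero]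

theorem x_supported (H : SpinData A R wt q s Y τ c) {p j : ℕ} (h1 : 1 ≤ p) (hpj : p < j)
    (hj : j < q) (z : ℂ) {y : Spin n}
    (hy : y ∈ Finsupp.supported ℂ ℂ {ε : Signs n | entry ε p = 1}) :
    R.x j z y ∈ Finsupp.supported ℂ ℂ {ε : Signs n | entry ε p = 1} := by
  rw [H.x_apply (by omega) hj]
  refine add_mem hy (Submodule.smul_mem _ _ (supported_le_comap (R.e j) _ _ (fun ε hε => ?_) hy))
  rw [H.e_of_lt j hj]
  split_ifs
  · refine Finsupp.single_mem_supported ℂ _ ?_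
    have hn := H.le
    change entry (raise ε j) p = 1
    rw [entry_raise ε _ h1 (by omega), if_neg (by omega), if_neg (by omega)]
    exact hε
  · exact zero_mem _

/-- Every layer involved has a number above `p`, hence leaves the entry at `p` unchanged; for the
core this is `inner_supported`. -/
theorem sandwich_supported (H : SpinData A R wt q s Y τ c) {p d : ℕ} (h1 : 1 ≤ p)
    (hd : p + d < q) {y : Spin n}
    (hy : y ∈ Finsupp.supported ℂ ℂ {ε : Signs n | entry ε p = 1}) :
    sandwich R a b Y q d y ∈ Finsupp.supported ℂ ℂ {ε : Signs n | entry ε p = 1} := by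
  induction d generalizing y with
  | zero => exact H.inner_supported p hd h1 y hy
  | succ d ih =>
    exact H.x_supported h1 (by omega) (by omega) _
      (ih (by omega) (H.x_supported h1 (by omega) (by omega) _ hy))

theorem wt_raise (H : SpinData A R wt q s Y τ c) {p : ℕ} (h1 : 1 ≤ p) (hp : p < q)
    {ε : Signs n} (h : entry ε p = -1 ∧ entry ε (p + 1) = 1) :
    wt (raise ε p) = shiftWt A (wt ε) (node n p) := by
  refine weight_unique (y := spinVec (raise ε p)) (by simp) (H.mem_weightSpace _) ?_
  have := e_mem_weightSpace H.graded (Finset.mem_Icc.2 ⟨h1, hp.le.trans H.le⟩)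
    (H.mem_weightSpace ε)
  rwa [H.e_of_lt p hp, if_pos h] at this

/-- The heart of the spin case, by induction on the number of layers. With `ε_p = -` exactly one of
the outer factors `x_p(a_p)`, `x_p(b_p)` contributes to the top degree, which one depending on
`ε_{p+1}`. With `ε_p = +` layer `p` is idle, which gives the weaker bound without `α_p`. This bound
is what shows that the competing term in the first case is lower. -/
theorem sandwich_spec (H : SpinData A R wt q s Y τ c) (a b : ℕ → ℂ) (d : ℕ) :
    ∀ p, 1 ≤ p → p + d = q → ∀ ε, TailEq q s ε →
      (entry ε p = -1 → LT A R (wt ε) (leadMult n τ p q) (sandwich R a b Y q d (spinVec ε))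
        (leadCoeff a b c p q ε • spinVec (leadSign p q ε))) ∧
      (entry ε p = 1 → sandwich R a b Y q d (spinVec ε) ∈
        Le A R (wt ε) (if p < q then leadMult n τ (p + 1) q else 0)) := by
  induction d with
  | zero =>
    rintro p h1 rfl ε hε
    constructor
    · intro h
      simpa [leadMult, leadCoeff, sandwich] using H.inner_minus ε hε h
    · intro h
      simpa [sandwich] using H.inner_plus ε hε h
  | succ d ih =>
    intro p h1 hpd ε hε
    have hp : p < q := by omega
    have hn := H.le
    have hmem : p ∈ Finset.Icc 1 n := Finset.mem_Icc.2 ⟨h1, by omega⟩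
    have hsq := H.e_sq p hmem
    have hsand : ∀ y, sandwich R a b Y q (d + 1) y =
        R.x p (b p) (sandwich R a b Y q d (R.x p (a p) y)) := fun y => by
      rw [sandwich, show q - (d + 1) = p by omega]; rfl
    obtain ⟨ih1, ih2⟩ := ih (p + 1) (by omega) (by omega) ε hε
    rw [if_pos hp]
    constructor
    · intro hm
      rw [hsand]
      rcases entry_cases ε (j := p + 1) (by omega) (by omega) with h | h
      -- Case `(-, +)`: `x_p(a_p)` yields `ε` and `a_p` times the raised sequence, which has a minus
      -- sign at `p + 1` as the inner layers require.
      · have hε1 : TailEq q s (raise ε p) := fun t ht => by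
          rw [← hε t ht]
          simp only [raise, setEntry]
          rw [if_neg (by omega), if_neg (by omega)]
        have hen : ∀ l, 1 ≤ l → l ≤ n → entry (raise ε p) l = _ := fun l => entry_raise ε p
        have h3 := ((ih (p + 1) (by omega) (by omega) _ hε1).1
          (by rw [hen _ (by omega) (by omega), if_pos rfl]))
        rw [H.wt_raise h1 hp ⟨hm, h⟩] at h3
        have h4 := (h3.shift.smul (a p))
        have hco : a p • leadCoeff a b c (p + 1) q (raise ε p) •
              spinVec (leadSign (p + 1) q (raise ε p)) =
            leadCoeff a b c p q ε • spinVec (leadSign p q ε) := by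
          have e1 : leadSign (p + 1) q (raise ε p) = leadSign p q ε := by
            refine signs_ext fun l hl1 hl2 => ?_
            rw [entry_leadSign _ _ _ hl1 hl2, entry_leadSign _ _ _ hl1 hl2, hen l hl1 hl2]
            by_cases e1 : l = p
            · subst e1; simp [hp.not_gt]
            · by_cases e2 : l = p + 1
              · subst e2; simp [h, show ¬ q < p + 1 by omega]
              · simp [e1, e2]
          have e2 : a p * leadCoeff a b c (p + 1) q (raise ε p) = leadCoeff a b c p q ε := by
            rw [leadCoeff, leadCoeff, Finset.prod_eq_prod_Ico_succ_bot hp, if_pos h, mul_assoc]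
            congr 2
            refine Finset.prod_congr rfl fun t ht => ?_
            rw [Finset.mem_Ico] at ht
            have e3 : entry (raise ε p) (t + 1) = entry ε (t + 1) := by
              rw [hen _ (by omega) (by omega), if_neg (by omega), if_neg (by omega)]
            rw [e3]
          rw [e1, smul_smul, e2]
        rw [hco, add_comm (node n p), ← leadMult_eq_add hp] at h4
        -- In the raised part the entry at `p` is now `+` and stays so, hence `x_p(b_p)` is idle.
        have h5 : R.x p (b p) (sandwich R a b Y q d (spinVec (raise ε p))) =
            sandwich R a b Y q d (spinVec (raise ε p)) := by
          refine H.x_of_supported h1 hp _ (H.sandwich_supported h1 (by omega) ?_)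
          refine Finsupp.single_mem_supported ℂ _ ?_
          change entry (raise ε p) p = 1
          rw [hen _ h1 (by omega)]; simp
        -- The unraised part has `+` at `p + 1`. Even after `x_p(b_p)` its degree lacks `α_{p+1}`,
        -- or `τ` if `p + 1 = q`, and so stays below the top.
        have h6 := x_mem_Le H.graded hmem hsq (b p) (ih2 h)
        have h7 : (if p + 1 < q then leadMult n τ (p + 1 + 1) q else 0) + node n p <
            leadMult n τ p q := by
          rw [leadMult_eq_add hp]
          refine add_lt_add_left ?_ _
          split_ifs with hq
          · rw [leadMult_eq_add hq]
            exact lt_add_of_pos_right _ (node_pos (Finset.mem_Icc.2 ⟨by omega, by omega⟩))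
          · rw [leadMult, Finset.Ico_eq_empty (by omega)]
            simpa using H.mult_pos
        have h8 := (LT.of_mem_Low (Le_le_Low h7 h6)).add h4
        rw [zero_add] at h8
        rw [H.x_apply h1 hp (a p), H.e_of_lt p hp, if_pos ⟨hm, h⟩, map_add, map_add, map_smul,
          map_smul, h5]
        exact h8
      -- Case `(-, -)`: `x_p(a_p)` is idle, and after the inner layers the entries are `(-, +)`,
      -- ready for `x_p(b_p)`.
      · have h2 : R.x p (a p) (spinVec ε) = spinVec ε := by
          rw [H.x_apply h1 hp, H.e_of_lt p hp, h]; simp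
        have h3 := (ih1 h).x_apply H.graded hmem hsq (b p)
        rw [h2, leadMult_eq_add hp]
        convert h3 using 1
        have hen : ∀ l, 1 ≤ l → l ≤ n → entry (leadSign (p + 1) q ε) l = _ :=
          fun l => entry_leadSign (p + 1) q ε
        rw [map_smul, H.e_of_lt p hp, if_pos ⟨by
            rw [hen _ h1 (by omega), if_neg (by omega), if_neg (by omega)]; exact hm, by
            rw [hen _ (by omega) (by omega), if_pos rfl]⟩, smul_smul]
        congr 2
        · rw [leadCoeff, leadCoeff, Finset.prod_eq_prod_Ico_succ_bot hp, h]
          simp [mul_assoc]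
        · refine signs_ext fun l hl1 hl2 => ?_
          rw [entry_raise _ _ hl1 hl2, entry_leadSign _ _ _ hl1 hl2, hen l hl1 hl2]
          by_cases e1 : l = p
          · subst e1; simp
          · by_cases e2 : l = p + 1
            · subst e2; simp [h, show ¬ q < p + 1 by omega]
            · simp [e1, e2]
    · intro hpl
      have hN : spinVec ε ∈ Finsupp.supported ℂ ℂ {ε : Signs n | entry ε p = 1} :=
        Finsupp.single_mem_supported ℂ _ hpl
      rw [hsand, H.x_of_supported h1 hp _ hN,
        H.x_of_supported h1 hp _ (H.sandwich_supported h1 (by omega) hN)]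
      rcases entry_cases ε (j := p + 1) (by omega) (by omega) with h | h
      · refine Le_mono ?_ (ih2 h)
        split_ifs with hq
        · rw [leadMult_eq_add hq]; exact le_add_of_nonneg_right fun _ => Nat.zero_le _
        · exact fun _ => Nat.zero_le _
      · exact (ih1 h).mem_Le

end SpinData

end SpinLeading

/-! ### The cores of the words in types B and D -/

section SpinInstances

theorem mem_Le_zero {V : Type} [AddCommGroup V] [Module ℂ V] {n : ℕ}
    {A : Matrix (Fin n) (Fin n) ℤ} {R : ChevalleyAction V} {μ : Fin n → ℤ} {y : V}
    (h : y ∈ weightSpace R μ) : y ∈ Le A R μ 0 :=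
  weightSpace_le_Le (A := A) le_rfl (by rwa [shiftWt_zero])

/-- Here `q` is the rank, so no position lies behind `q` and the tail condition is vacuous. -/
theorem spinDataB (m : ℕ) (s : ℤˣ) (c : ℂ) :
    SpinData (cartanB (m + 1)) (spinB (m + 1)) wtB (m + 1) s ((spinB (m + 1)).x (m + 1) c)
      (node (m + 1) (m + 1)) c := by
  have hmem : m + 1 ∈ Finset.Icc 1 (m + 1) := by simp
  have hx := x_apply_of_sq (spinB_e_sq hmem) c
  refine ⟨isGraded_spinB _, spinVec_mem_weightSpaceB, le_rfl, fun p hp ε => spinB_e_of_lt hp ε,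
    fun j hj => spinB_e_sq hj, node_pos hmem, fun ε _ h => ?_, fun ε _ h => ?_,
    fun p hp h1 y hy => ?_⟩
  · have h1 := (LT.of_mem (A := cartanB (m + 1)) (spinVec_mem_weightSpaceB ε)).x_apply
      (isGraded_spinB _) hmem (spinB_e_sq hmem) c
    rw [zero_add, spinB_e_last, if_pos h] at h1
    convert h1 using 3
    refine signs_ext fun l hl1 hl2 => ?_
    rw [entry_leadSign _ _ _ hl1 hl2, entry_setEntry _ _ _ hl1 hl2, if_neg hl2.not_gt]
    rfl
  · rw [hx, spinB_e_last, h]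
    simpa using mem_Le_zero (A := cartanB (m + 1)) (spinVec_mem_weightSpaceB ε)
  · rw [hx]
    refine add_mem hy (Submodule.smul_mem _ _ (supported_le_comap _ _ _ (fun ε hε => ?_) hy))
    rw [spinB_e_last]
    split_ifs
    · refine Finsupp.single_mem_supported ℂ _ ?_
      change entry _ p = 1
      rw [entry_setEntry _ _ _ h1 hp.le, if_neg hp.ne]
      exact hε
    · exact zero_mem _

theorem spinD_e_last_add_two {m : ℕ} (ε : Signs (m + 2)) :
    (spinD (m + 2)).e (m + 2) (spinVec ε) = if entry ε (m + 1) = -1 ∧ entry ε (m + 2) = -1 then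
      spinVec (setEntry (setEntry ε (m + 1) 1) (m + 2) 1) else 0 :=
  spinD_e_last ε

/-- The tail is the last position. If it is `+`, then `e_{n-1}` turns `(-, +)` into `(+, -)` with
coefficient `a`; if it is `-`, then `e_n` turns `(-, -)` into `(+, +)` with coefficient `b`. In both
cases the last sign changes and the other factor is idle. -/
theorem spinDataD (m : ℕ) (s : ℤˣ) (a b : ℂ) :
    SpinData (cartanD (m + 2)) (spinD (m + 2)) wtD (m + 1) s
      ((spinD (m + 2)).x (m + 2) b * (spinD (m + 2)).x (m + 1) a)
      (if s = 1 then node (m + 2) (m + 1) else node (m + 2) (m + 2)) (if s = 1 then a else b) := by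
  have hmem1 : m + 1 ∈ Finset.Icc 1 (m + 2) := by simp
  have hmem2 : m + 2 ∈ Finset.Icc 1 (m + 2) := by simp
  have hg := isGraded_spinD (n := m + 2) (by omega)
  have hw := spinVec_mem_weightSpaceD (n := m + 2) (by omega)
  have hx1 := x_apply_of_sq (spinD_e_sq hmem1) a
  have hx2 := x_apply_of_sq (spinD_e_sq hmem2) b
  have htail : ∀ ε : Signs (m + 2), TailEq (m + 1) s ε → entry ε (m + 2) = s := fun ε hε => by
    rw [← hε (Fin.last _) (by simp), ← entry_eq]; rfl
  refine ⟨hg, hw, by omega, fun p hp ε => spinD_e_of_lt (by omega) ε,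
    fun j hj => spinD_e_sq hj, ?_, fun ε hε h => ?_, fun ε hε h => ?_,
    fun p hp h1 y hy => ?_⟩
  · split_ifs
    exacts [node_pos hmem1, node_pos hmem2]
  · have hlast := htail ε hε
    rw [Module.End.mul_apply]
    rcases Int.units_eq_one_or s with rfl | rfl
    · have h1 := (LT.of_mem (A := cartanD (m + 2)) (hw ε)).x_apply hg hmem1 (spinD_e_sq hmem1) a
      -- Neither summand has two minus signs at the end: `ε` ends in `+`, the raised sequence in
      -- `(+, -)`.
      have h2 : (spinD (m + 2)).x (m + 2) b ((spinD (m + 2)).x (m + 1) a (spinVec ε)) =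
          (spinD (m + 2)).x (m + 1) a (spinVec ε) := by
        rw [hx2, hx1, map_add, map_smul, spinD_e_of_lt (by omega), if_pos ⟨h, hlast⟩,
          spinD_e_last_add_two, spinD_e_last_add_two, hlast,
          entry_raise ε (m + 1) (l := m + 1) (by omega) (by omega)]
        simp
      rw [h2]
      rw [zero_add, spinD_e_of_lt (by omega), if_pos ⟨h, hlast⟩] at h1
      rw [if_pos rfl, if_pos rfl]
      convert h1 using 3
      refine signs_ext fun l hl1 hl2 => ?_
      rw [entry_leadSign _ _ _ hl1 hl2, entry_raise _ _ hl1 hl2]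
      rcases (show l = m + 2 ∨ l ≤ m + 1 by omega) with rfl | h3
      · simp [hlast]
      · rw [if_neg (show ¬ m + 1 < l by omega), if_neg (show ¬ l = m + 1 + 1 by omega)]
    · have h1 := (LT.of_mem (A := cartanD (m + 2)) (hw ε)).x_apply hg hmem2 (spinD_e_sq hmem2) b
      have h2 : (spinD (m + 2)).x (m + 1) a (spinVec ε) = spinVec ε := by
        rw [hx1, spinD_e_of_lt (by omega), hlast]; simp
      rw [h2]
      rw [zero_add, spinD_e_last_add_two, if_pos ⟨h, hlast⟩] at h1
      rw [if_neg (by decide), if_neg (by decide)]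
      convert h1 using 3
      refine signs_ext fun l hl1 hl2 => ?_
      rw [entry_leadSign _ _ _ hl1 hl2, entry_setEntry _ _ _ hl1 hl2, entry_setEntry _ _ _ hl1 hl2]
      rcases (show l = m + 2 ∨ l ≤ m + 1 by omega) with rfl | h3
      · simp [hlast]
      · rw [if_neg (show ¬ m + 1 < l by omega), if_neg (show ¬ l = m + 2 by omega)]
        rfl
  · rw [Module.End.mul_apply, hx1, spinD_e_of_lt (by omega), h, if_neg (by simp), smul_zero,
      add_zero, hx2, spinD_e_last_add_two, h, if_neg (by simp), smul_zero, add_zero]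
    exact mem_Le_zero (hw ε)
  · have key : ∀ z ∈ Finsupp.supported ℂ ℂ {ε : Signs (m + 2) | entry ε p = 1},
        (spinD (m + 2)).x (m + 1) a z ∈
          Finsupp.supported ℂ ℂ {ε : Signs (m + 2) | entry ε p = 1} := fun z hz => by
      rw [hx1]
      refine add_mem hz (Submodule.smul_mem _ _ (supported_le_comap _ _ _ (fun ε hε => ?_) hz))
      rw [spinD_e_of_lt (by omega)]
      split_ifs
      · refine Finsupp.single_mem_supported ℂ _ ?_
        change entry _ p = 1
        rw [entry_raise _ _ h1 (by omega), if_neg (by omega), if_neg hp.ne]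
        exact hε
      · exact zero_mem _
    rw [Module.End.mul_apply, hx2]
    refine add_mem (key y hy) (Submodule.smul_mem _ _
      (supported_le_comap _ _ _ (fun ε hε => ?_) (key y hy)))
    rw [spinD_e_last_add_two]
    split_ifs
    · refine Finsupp.single_mem_supported ℂ _ ?_
      change entry _ p = 1
      rw [entry_setEntry _ _ _ h1 (by omega), if_neg (by omega),
        entry_setEntry _ _ _ h1 (by omega), if_neg hp.ne]
      exact hε
    · exact zero_mem _

end SpinInstances

/-! ### Tensor squares -/

section TensorSquare

variable {V : Type} [AddCommGroup V] [Module ℂ V] {n : ℕ} {A : Matrix (Fin n) (Fin n) ℤ}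
  {R : ChevalleyAction V} {μ ν : Fin n → ℤ} {κ η : Fin n → ℕ} {y z l l' : V}

theorem tensorSquareEnd_tmul (T : Module.End ℂ V) (y z : V) :
    tensorSquareEnd T (y ⊗ₜ[ℂ] z) = T y ⊗ₜ z + y ⊗ₜ T z := rfl

theorem tmul_mem_weightSpace (hy : y ∈ weightSpace R μ) (hz : z ∈ weightSpace R ν) :
    y ⊗ₜ[ℂ] z ∈ weightSpace R.tensorSquare (μ + ν) := by
  intro t
  change tensorSquareEnd (R.h (t + 1)) (y ⊗ₜ z) = _
  rw [tensorSquareEnd_tmul, hy t, hz t, ← TensorProduct.smul_tmul', TensorProduct.tmul_smul,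
    ← add_smul, Pi.add_apply, Int.cast_add]

theorem shiftWt_add_add :
    shiftWt A (μ + ν) (κ + η) = shiftWt A μ κ + shiftWt A ν η := by
  ext s
  simp [shiftWt, mul_add, Finset.sum_add_distrib]
  ring

theorem tmul_mem_Low_left (hy : y ∈ Low A R μ κ) (hz : z ∈ Le A R ν η) :
    y ⊗ₜ[ℂ] z ∈ Low A R.tensorSquare (μ + ν) (κ + η) := by
  have h1 : Low A R μ κ ≤
      (Low A R.tensorSquare (μ + ν) (κ + η)).comap ((TensorProduct.mk ℂ V V).flip z) := by
    refine iSup_le fun κ' y hy => ?_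
    have h2 : Le A R ν η ≤
        (Low A R.tensorSquare (μ + ν) (κ + η)).comap (TensorProduct.mk ℂ V V y) := by
      refine iSup_le fun η' z hz => weightSpace_le_Low (add_lt_add_of_lt_of_le κ'.2 η'.2) ?_
      rw [shiftWt_add_add]
      exact tmul_mem_weightSpace hy hz
    exact h2 hz
  exact h1 hy

theorem tmul_mem_Low_right (hy : y ∈ Le A R μ κ) (hz : z ∈ Low A R ν η) :
    y ⊗ₜ[ℂ] z ∈ Low A R.tensorSquare (μ + ν) (κ + η) := by
  have h1 : Le A R μ κ ≤
      (Low A R.tensorSquare (μ + ν) (κ + η)).comap ((TensorProduct.mk ℂ V V).flip z) := by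
    refine iSup_le fun κ' y hy => ?_
    have h2 : Low A R ν η ≤
        (Low A R.tensorSquare (μ + ν) (κ + η)).comap (TensorProduct.mk ℂ V V y) := by
      refine iSup_le fun η' z hz => weightSpace_le_Low (add_lt_add_of_le_of_lt κ'.2 η'.2) ?_
      rw [shiftWt_add_add]
      exact tmul_mem_weightSpace hy hz
    exact h2 hz
  exact h1 hy

/-- By `y ⊗ z - l ⊗ l' = (y - l) ⊗ z + l ⊗ (z - l')`, one strictly lower factor in each term
suffices. -/
theorem LT.tmul (hy : LT A R μ κ y l) (hz : LT A R ν η z l') :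
    LT A R.tensorSquare (μ + ν) (κ + η) (y ⊗ₜ z) (l ⊗ₜ l') := by
  refine ⟨by rw [shiftWt_add_add]; exact tmul_mem_weightSpace hy.1 hz.1, ?_⟩
  have : y ⊗ₜ[ℂ] z - l ⊗ₜ[ℂ] l' = (y - l) ⊗ₜ z + l ⊗ₜ (z - l') := by
    rw [TensorProduct.sub_tmul, TensorProduct.tmul_sub]; abel
  rw [this]
  exact add_mem (tmul_mem_Low_left hy.2 hz.mem_Le)
    (tmul_mem_Low_right (weightSpace_le_Le le_rfl hy.1) hz.2)

variable [Module ℚ V] [SMulCommClass ℂ ℚ V] [Module ℚ (V ⊗[ℂ] V)]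

/-- On the tensor square `e_j` need not have square zero, but it is a sum of two commuting operators
that do. The exponential of the sum is the product of the two exponentials. -/
theorem x_tensorSquare [SMulCommClass ℂ ℚ (V ⊗[ℂ] V)] {j : ℕ} (h : R.e j * R.e j = 0) (c : ℂ) :
    R.tensorSquare.x j c = TensorProduct.map (R.x j c) (R.x j c) := by
  rw [x_eq_of_sq h, ChevalleyAction.x]
  set T := c • R.e j with hT
  have hT2 : T * T = 0 := by rw [hT, smul_mul_smul_comm, h, smul_zero]
  set P : Module.End ℂ (V ⊗[ℂ] V) := TensorProduct.map T LinearMap.id with hP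
  set Q : Module.End ℂ (V ⊗[ℂ] V) := TensorProduct.map LinearMap.id T with hQ
  have hS : c • R.tensorSquare.e j = P + Q := by
    refine TensorProduct.ext' fun y z => ?_
    change c • tensorSquareEnd (R.e j) (y ⊗ₜ z) = _
    simp [hT, hP, hQ, tensorSquareEnd_tmul, TensorProduct.smul_tmul']
  have hT3 : ∀ y, T (T y) = 0 := fun y => LinearMap.congr_fun hT2 y
  have hP2 : P ^ 2 = 0 := by
    rw [pow_two]
    exact TensorProduct.ext' fun y z => by simp [hP, hT3]
  have hQ2 : Q ^ 2 = 0 := by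
    rw [pow_two]
    exact TensorProduct.ext' fun y z => by simp [hQ, hT3]
  have hcomm : Commute P Q := TensorProduct.ext' fun y z => by simp [hP, hQ]
  rw [hS, IsNilpotent.exp_add_of_commute hcomm ⟨2, hP2⟩ ⟨2, hQ2⟩, exp_of_sq hP2, exp_of_sq hQ2]
  refine TensorProduct.ext' fun y z => ?_
  simp [hP, hQ, TensorProduct.add_tmul, TensorProduct.tmul_add, add_assoc,
    add_left_comm]

theorem ascending_tensorSquare (r : ℕ) (h : ∀ j ∈ Finset.Icc 1 r, R.e j * R.e j = 0) (c : ℕ → ℂ) :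
    ascending R.tensorSquare r c = TensorProduct.map (ascending R r c) (ascending R r c) := by
  induction r with
  | zero => exact (TensorProduct.map_one).symm
  | succ r ih =>
    rw [ascending_succ, ascending_succ, ih fun j hj => h j (by simp at hj ⊢; omega),
      x_tensorSquare (h _ (by simp)), ← TensorProduct.map_mul]

theorem descending_tensorSquare (r : ℕ) (h : ∀ j ∈ Finset.Icc 1 r, R.e j * R.e j = 0)
    (c : ℕ → ℂ) :
    descending R.tensorSquare r c = TensorProduct.map (descending R r c) (descending R r c) := by
  induction r with
  | zero => exact (TensorProduct.map_one).symm
  | succ r ih =>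
    rw [descending_succ, descending_succ, ih fun j hj => h j (by simp at hj ⊢; omega),
      x_tensorSquare (h _ (by simp)), ← TensorProduct.map_mul]

theorem wordBC_tensorSquare (h : ∀ j ∈ Finset.Icc 1 n, R.e j * R.e j = 0) (a b : ℕ → ℂ) :
    wordBC R.tensorSquare n a b = TensorProduct.map (wordBC R n a b) (wordBC R n a b) := by
  rw [wordBC, wordBC, ascending_tensorSquare _ fun j hj => h j (by simp at hj ⊢; omega),
    descending_tensorSquare _ h, ← TensorProduct.map_mul]

theorem wordD_tensorSquare (hn : 1 ≤ n) (h : ∀ j ∈ Finset.Icc 1 n, R.e j * R.e j = 0)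
    (a b : ℕ → ℂ) :
    wordD R.tensorSquare n a b = TensorProduct.map (wordD R n a b) (wordD R n a b) := by
  rw [wordD, wordD, ascending_tensorSquare _ fun j hj => h j (by simp at hj ⊢; omega),
    descending_tensorSquare _ fun j hj => h j (by simp at hj ⊢; omega),
    x_tensorSquare (h n (by simp; omega)), ← TensorProduct.map_mul, ← TensorProduct.map_mul]

end TensorSquare

/-! ### The words preserve the generated module -/

section Words

variable {V : Type} [AddCommGroup V] [Module ℂ V] [Module ℚ V] [SMulCommClass ℂ ℚ V]

theorem wordBC_mem_generated (R : ChevalleyAction V) (n : ℕ) (a b : ℕ → ℂ) (v : V) :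
    wordBC R n a b v ∈ R.generated n v :=
  ascending_mem_generated (by omega) _ _ (descending_mem_generated le_rfl _ _ (mem_generated v))

theorem wordD_mem_generated (R : ChevalleyAction V) {n : ℕ} (hn : 1 ≤ n) (a b : ℕ → ℂ) (v : V) :
    wordD R n a b v ∈ R.generated n v :=
  ascending_mem_generated (by omega) _ _ (x_mem_generated _ (by simp; omega) _ _
    (descending_mem_generated (by omega) _ _ (mem_generated v)))

end Words

/-! ### Signs of sequences -/

section SignLemmas

variable {n : ℕ}

/-- As a product over positions the sign can be compared for two sequences one position at a time.
-/
theorem sg_eq_prod (ε : Signs n) :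
    sg ε = ∏ t : Fin n, if ε t = -1 then (-1 : ℂ) ^ (n - (t : ℕ)) else 1 := by
  rw [sg, ← Finset.prod_pow_eq_pow_sum, Finset.prod_filter]
  have h1 := Fin.prod_univ_eq_prod_range
    (fun l => if entry ε (l + 1) = -1 then (-1 : ℂ) ^ (n - (l + 1) + 1) else 1) n
  have h2 := Finset.prod_Ico_add' (fun l => if entry ε l = -1 then (-1 : ℂ) ^ (n - l + 1) else 1)
    0 n 1
  rw [Finset.range_eq_Ico] at h1
  rw [show Finset.Icc 1 n = Finset.Ico (0 + 1) (n + 1) by ext; simp, ← h2, ← h1]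
  refine Finset.prod_congr rfl fun t _ => ?_
  rw [entry_eq, show n - ((t : ℕ) + 1) + 1 = n - t by omega]
  refine if_congr ?_ rfl rfl
  rw [← Units.val_inj]; rfl

theorem sg_ne_zero (ε : Signs n) : sg ε ≠ 0 := by simp [sg]

theorem sg_eq_mul_of_ne_iff {ε ε' : Signs n} (D : Finset (Fin n)) (h : ∀ t, ε t ≠ ε' t ↔ t ∈ D) :
    sg ε' = sg ε * ∏ t ∈ D, (-1 : ℂ) ^ (n - (t : ℕ)) := by
  have hprod : ∏ t ∈ D, (-1 : ℂ) ^ (n - (t : ℕ)) =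
      ∏ t, if t ∈ D then (-1 : ℂ) ^ (n - (t : ℕ)) else 1 := by simp
  rw [sg_eq_prod, sg_eq_prod, hprod, ← Finset.prod_mul_distrib]
  refine Finset.prod_congr rfl fun t _ => ?_
  have ht := h t
  by_cases hD : t ∈ D
  · rw [if_pos hD]
    have := ht.2 hD
    rcases Int.units_eq_one_or (ε t) with h1 | h1 <;>
      rcases Int.units_eq_one_or (ε' t) with h2 | h2 <;> rw [h1, h2] at this ⊢ <;>
      simp at this ⊢
    rw [← mul_pow]; simp
  · rw [if_neg hD, mul_one, not_ne_iff.1 (mt ht.1 hD)]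

theorem prod_signs_eq_mul_of_ne_iff {ε ε' : Signs n} (D : Finset (Fin n))
    (h : ∀ t, ε t ≠ ε' t ↔ t ∈ D) : ∏ t, ε' t = (∏ t, ε t) * (-1) ^ D.card := by
  have hprod : (-1) ^ D.card = ∏ t, if t ∈ D then (-1 : ℤˣ) else 1 := by simp
  rw [hprod, ← Finset.prod_mul_distrib]
  refine Finset.prod_congr rfl fun t _ => ?_
  have ht := h t
  by_cases hD : t ∈ D
  · rw [if_pos hD]
    have := ht.2 hD
    rcases Int.units_eq_one_or (ε t) with h1 | h1 <;>
      rcases Int.units_eq_one_or (ε' t) with h2 | h2 <;> rw [h1, h2] at this ⊢ <;>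
      simp at this ⊢
  · rw [if_neg hD, mul_one, not_ne_iff.1 (mt ht.1 hD)]

theorem ne_iff_entry_ne (ε ε' : Signs n) (t : Fin n) :
    ε t ≠ ε' t ↔ entry ε (t + 1) ≠ entry ε' (t + 1) := by
  rw [entry_eq, entry_eq, Ne, Ne, Units.val_inj]

/-- The exponents at `j` and `j + 1` are `n - j + 1` and `n - j`, of opposite parity, so changing
both entries reverses `sg`; two changes preserve the product of the entries. -/
theorem sg_eq_neg_of_adjacent {ε ε' : Signs n} {j : ℕ} (h1 : 1 ≤ j) (hj : j < n)
    (h : ∀ l, 1 ≤ l → l ≤ n → (entry ε l ≠ entry ε' l ↔ l = j ∨ l = j + 1)) :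
    sg ε' = - sg ε ∧ ∏ t, ε' t = ∏ t, ε t := by
  have hD : ∀ t, ε t ≠ ε' t ↔ t ∈ ({⟨j - 1, by omega⟩, ⟨j, hj⟩} : Finset (Fin n)) := fun t => by
    rw [ne_iff_entry_ne, h _ (by omega) (by omega)]
    simp only [Finset.mem_insert, Finset.mem_singleton, Fin.ext_iff]
    omega
  have hne : (⟨j - 1, by omega⟩ : Fin n) ≠ ⟨j, hj⟩ := by simp [Fin.ext_iff]; omega
  constructor
  · rw [sg_eq_mul_of_ne_iff _ hD, Finset.prod_pair hne]
    simp only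
    rw [show n - (j - 1) = (n - j) + 1 by omega, pow_succ, mul_right_comm, ← mul_pow]
    simp
  · rw [prod_signs_eq_mul_of_ne_iff _ hD, Finset.card_pair hne]
    simp

theorem sg_eq_neg_of_last {ε ε' : Signs n} (hn : 1 ≤ n)
    (h : ∀ l, 1 ≤ l → l ≤ n → (entry ε l ≠ entry ε' l ↔ l = n)) :
    sg ε' = - sg ε ∧ ∏ t, ε' t = - ∏ t, ε t := by
  have hD : ∀ t, ε t ≠ ε' t ↔ t ∈ ({⟨n - 1, by omega⟩} : Finset (Fin n)) := fun t => by
    rw [ne_iff_entry_ne, h _ (by omega) (by omega)]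
    simp only [Finset.mem_singleton, Fin.ext_iff]
    omega
  constructor
  · rw [sg_eq_mul_of_ne_iff _ hD, Finset.prod_singleton]
    simp only
    rw [show n - (n - 1) = 1 by omega]
    simp
  · rw [prod_signs_eq_mul_of_ne_iff _ hD, Finset.card_singleton]
    simp

theorem entry_cons_one (s : ℤˣ) (ε : Signs n) : entry (Fin.cons s ε : Signs (n + 1)) 1 = s :=
  (entry_eq (Fin.cons s ε : Signs (n + 1)) 0).trans (by simp)

theorem entry_cons_succ (s : ℤˣ) (ε : Signs n) {l : ℕ} (h1 : 1 ≤ l) (h2 : l ≤ n) :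
    entry (Fin.cons s ε : Signs (n + 1)) (l + 1) = entry ε l := by
  obtain ⟨t, rfl⟩ : ∃ t : Fin n, l = t + 1 := ⟨⟨l - 1, by omega⟩, (Nat.sub_add_cancel h1).symm⟩
  rw [entry_eq]
  have := entry_eq (Fin.cons s ε : Signs (n + 1)) t.succ
  rw [Fin.cons_succ] at this
  exact this

theorem sg_cons (ε : Signs n) : sg (Fin.cons (-1) ε : Signs (n + 1)) = (-1) ^ (n + 1) * sg ε := by
  rw [sg_eq_prod, sg_eq_prod, Fin.prod_univ_succ]
  refine congrArg₂ (· * ·) (by simp) (Finset.prod_congr rfl fun t _ => ?_)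
  rw [Fin.cons_succ, Fin.val_succ, Nat.add_sub_add_right]

/-- The last entry changes its sign. -/
def flipLast (ε : Signs n) : Signs n := fun t => if (t : ℕ) + 1 = n then -ε t else ε t

theorem flipLast_flipLast (ε : Signs n) : flipLast (flipLast ε) = ε := by
  funext t; simp only [flipLast]; split_ifs <;> simp

theorem entry_flipLast (ε : Signs n) {l : ℕ} (h1 : 1 ≤ l) (h2 : l ≤ n) :
    entry (flipLast ε) l = if l = n then -entry ε l else entry ε l := by
  simp only [entry, h1, h2, and_self, dif_pos, flipLast, Nat.sub_add_cancel h1]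
  split_ifs <;> simp

theorem sg_flipLast (hn : 1 ≤ n) (ε : Signs n) :
    sg (flipLast ε) = - sg ε ∧ ∏ t, flipLast ε t = - ∏ t, ε t := by
  refine sg_eq_neg_of_last hn fun l h1 h2 => ?_
  rw [entry_flipLast _ h1 h2]
  have := entry_cases ε h1 h2
  split_ifs <;> omega

/-- Since all entries are `±1`, the product condition determines one entry from the other; this
linear form suits arithmetic. -/
theorem condL_iff {i : ℕ} {ε ε' : Signs n} : CondL i ε ε' ↔ ∀ j, 1 ≤ j → j ≤ n →
    (j ≤ i → entry ε j = -1 ∧ entry ε' j = -1) ∧ (i < j → entry ε' j = - entry ε j) := by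
  simp only [CondL, Finset.mem_Icc, and_imp]
  refine forall_congr' fun j => forall_congr' fun h1 => forall_congr' fun h2 => ?_
  by_cases h : j ≤ i
  · simp [h]
  · simp only [h, if_false, false_imp_iff, true_and, not_le.1 h, true_imp_iff]
    rcases entry_cases ε h1 h2 with h3 | h3 <;> rcases entry_cases ε' h1 h2 with h4 | h4 <;>
      simp [h3, h4]

theorem condL_cons {k : ℕ} {ε ε' : Signs n} :
    CondL (k + 1) (Fin.cons (-1) ε : Signs (n + 1)) (Fin.cons (-1) ε') ↔ CondL k ε ε' := by
  rw [condL_iff, condL_iff]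
  constructor
  · intro h j h1 h2
    have := h (j + 1) (by omega) (by omega)
    rw [entry_cons_succ _ _ h1 h2, entry_cons_succ _ _ h1 h2] at this
    exact ⟨fun hj => this.1 (by omega), fun hj => this.2 (by omega)⟩
  · intro h j h1 h2
    rcases (show j = 1 ∨ ∃ l, 1 ≤ l ∧ j = l + 1 by
      by_cases hj : j = 1
      · exact Or.inl hj
      · exact Or.inr ⟨j - 1, by omega, by omega⟩) with rfl | ⟨l, hl, rfl⟩
    · simp [entry_cons_one]
    · rw [entry_cons_succ _ _ hl (by omega), entry_cons_succ _ _ hl (by omega)]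
      have := h l hl (by omega)
      exact ⟨fun hj => this.1 (by omega), fun hj => this.2 (by omega)⟩

theorem condL_flipLast {k : ℕ} (hk : k < n) {ε ε' : Signs n} :
    CondL k (flipLast ε) (flipLast ε') ↔ CondL k ε ε' := by
  rw [condL_iff, condL_iff]
  refine forall_congr' fun j => forall_congr' fun h1 => forall_congr' fun h2 => ?_
  rw [entry_flipLast _ h1 h2, entry_flipLast _ h1 h2]
  by_cases hj : j = n
  · simpa [hj, hk, hk.not_ge] using neg_eq_iff_eq_neg
  · simp [hj]

/-- If all contributing pairs begin with minus signs, the sum runs over pairs of one rank less. -/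
theorem sum_signs_cons {M : Type*} [AddCommMonoid M]
    (F : Signs (n + 1) × Signs (n + 1) → M)
    (hF : ∀ p, ¬ (p.1 0 = -1 ∧ p.2 0 = -1) → F p = 0) :
    ∑ p, F p = ∑ p : Signs n × Signs n, F (Fin.cons (-1) p.1, Fin.cons (-1) p.2) := by
  symm
  refine Finset.sum_of_injOn (fun p : Signs n × Signs n =>
    ((Fin.cons (-1) p.1, Fin.cons (-1) p.2) : Signs (n + 1) × Signs (n + 1))) ?_ (by simp) ?_
    (fun _ _ => rfl)
  · rintro ⟨p1, p2⟩ _ ⟨q1, q2⟩ _ h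
    simp only [Prod.mk.injEq] at h
    rw [(Fin.cons_inj.1 h.1).2, (Fin.cons_inj.1 h.2).2]
  · intro p _ hp
    refine hF p fun h => hp ⟨(Fin.tail p.1, Fin.tail p.2), by simp, ?_⟩
    refine Prod.ext ?_ ?_
    · simp only [← h.1, Fin.cons_self_tail]
    · simp only [← h.2, Fin.cons_self_tail]

end SignLemmas

/-! ### The operators `f_j` annihilate the lowest weight vectors -/

section Exchange

variable {n : ℕ}

/-- The entries of two sequences at the positions in `J` are exchanged. -/
def exchange (J : ℕ → Prop) [DecidablePred J] :
    Signs n × Signs n ≃ Signs n × Signs n where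
  toFun p := (fun t => if J (t + 1) then p.2 t else p.1 t, fun t => if J (t + 1) then p.1 t else p.2 t)
  invFun p :=
    (fun t => if J (t + 1) then p.2 t else p.1 t, fun t => if J (t + 1) then p.1 t else p.2 t)
  left_inv p := by ext t <;> simp only <;> split_ifs <;> rfl
  right_inv p := by ext t <;> simp only <;> split_ifs <;> rfl

variable (J : ℕ → Prop) [DecidablePred J]

theorem entry_exchange_fst (p : Signs n × Signs n) {l : ℕ} (h1 : 1 ≤ l) (h2 : l ≤ n) :
    entry (exchange J p).1 l = if J l then entry p.2 l else entry p.1 l := by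
  simp only [entry, h1, h2, and_self, dif_pos, exchange, Equiv.coe_fn_mk, Nat.sub_add_cancel h1]
  split_ifs <;> rfl

theorem entry_exchange_snd (p : Signs n × Signs n) {l : ℕ} (h1 : 1 ≤ l) (h2 : l ≤ n) :
    entry (exchange J p).2 l = if J l then entry p.1 l else entry p.2 l := by
  simp only [entry, h1, h2, and_self, dif_pos, exchange, Equiv.coe_fn_mk, Nat.sub_add_cancel h1]
  split_ifs <;> rfl

theorem condL_exchange {i : ℕ} {p : Signs n × Signs n} :
    CondL i (exchange J p).1 (exchange J p).2 ↔ CondL i p.1 p.2 := by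
  rw [condL_iff, condL_iff]
  refine forall_congr' fun j => forall_congr' fun h1 => forall_congr' fun h2 => ?_
  rw [entry_exchange_fst J p h1 h2, entry_exchange_snd J p h1 h2]
  split_ifs <;> constructor <;> intro h <;>
    exact ⟨fun hj => by have := h.1 hj; omega, fun hj => by have := h.2 hj; omega⟩

/-- Reindexing by `σ` the terms in which `T` acts on the second factor matches each of them with a
term in which `T` acts on the first. -/
theorem tensorSquareEnd_eq_zero_of_equiv (T : Module.End ℂ (Spin n))
    (F : Signs n × Signs n → ℂ) (σ : Signs n × Signs n ≃ Signs n × Signs n)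
    (h : ∀ p, F p • (T (spinVec p.1) ⊗ₜ[ℂ] spinVec p.2) +
      F (σ p) • (spinVec (σ p).1 ⊗ₜ[ℂ] T (spinVec (σ p).2)) = 0) :
    tensorSquareEnd T (∑ p, F p • (spinVec p.1 ⊗ₜ[ℂ] spinVec p.2)) = 0 := by
  simp only [map_sum, map_smul, tensorSquareEnd_tmul, smul_add, Finset.sum_add_distrib]
  rw [← Equiv.sum_comp σ fun p => F p • (spinVec p.1 ⊗ₜ[ℂ] T (spinVec p.2))]
  rw [← Finset.sum_add_distrib]
  exact Finset.sum_eq_zero fun p _ => h p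

end Exchange

/-! ### Lowest weight vectors in the tensor squares of the spin modules -/

section LowestWeight

variable {n : ℕ}

/-- Let `T` change the entries `u l` at the positions `l ∈ J` into their negatives, and annihilate
all other sequences. Then it annihilates sums with antisymmetric coefficients. -/
theorem tensorSquareEnd_eq_zero_of_exchange (T : Module.End ℂ (Spin n)) (J : ℕ → Prop)
    [DecidablePred J] (u : ℕ → ℤ) (i : ℕ) (F : Signs n × Signs n → ℂ)
    (hJ : ∀ l, J l → 1 ≤ l ∧ l ≤ n ∧ ∃ l₀ ≤ l, J l₀ ∧ u l₀ = 1)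
    (hT : ∀ ε, (∀ l, J l → entry ε l = u l) → ∃ ε', T (spinVec ε) = spinVec ε' ∧
      ∀ l, 1 ≤ l → l ≤ n → entry ε' l = if J l then -u l else entry ε l)
    (hT0 : ∀ ε, ¬ (∀ l, J l → entry ε l = u l) → T (spinVec ε) = 0)
    (hF0 : ∀ p, ¬ CondL i p.1 p.2 → F p = 0)
    (hF : ∀ p, CondL i p.1 p.2 → (∀ l, J l → i < l) →
      (∀ l, 1 ≤ l → l ≤ n → (entry p.1 l ≠ entry (exchange J p).1 l ↔ J l)) →
      (∀ l, 1 ≤ l → l ≤ n → (entry p.2 l ≠ entry (exchange J p).2 l ↔ J l)) →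
      F (exchange J p) = - F p) :
    tensorSquareEnd T (∑ p, F p • (spinVec p.1 ⊗ₜ[ℂ] spinVec p.2)) = 0 := by
  refine tensorSquareEnd_eq_zero_of_equiv T F (exchange J) fun p => ?_
  by_cases hL : CondL i p.1 p.2
  swap
  · rw [hF0 p hL, hF0 _ (mt (condL_exchange J).1 hL)]
    simp
  have hiff : (∀ l, J l → entry (exchange J p).2 l = u l) ↔ ∀ l, J l → entry p.1 l = u l := by
    refine forall_congr' fun l => forall_congr' fun hl => ?_
    obtain ⟨h1, h2, -⟩ := hJ l hl
    rw [entry_exchange_snd J p h1 h2, if_pos hl]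
  by_cases hc : ∀ l, J l → entry p.1 l = u l
  swap
  · rw [hT0 _ hc, hT0 _ (mt hiff.1 hc)]
    simp
  have hL' := condL_iff.1 hL
  -- At some `l₀ ≤ l` in `J` the entry is `+`. Up to `i` all entries are minus signs, so `i < l₀`.
  have hi : ∀ l, J l → i < l := fun l hl => by
    obtain ⟨h1, h2, l₀, h3, h4, h5⟩ := hJ l hl
    obtain ⟨h6, h7, -⟩ := hJ l₀ h4
    have h8 := hc l₀ h4
    have h9 := (hL' l₀ h6 h7).1
    omega
  have hneg : ∀ l, J l → entry p.2 l = -u l := fun l hl => by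
    obtain ⟨h1, h2, -⟩ := hJ l hl
    rw [(hL' l h1 h2).2 (hi l hl), hc l hl]
  have hu : ∀ l, J l → u l ≠ - u l := fun l hl => by
    obtain ⟨h1, h2, -⟩ := hJ l hl
    have := entry_cases p.1 h1 h2
    rw [hc l hl] at this
    omega
  obtain ⟨ε₁, h1, h1'⟩ := hT _ hc
  obtain ⟨ε₂, h2, h2'⟩ := hT _ (hiff.2 hc)
  -- Both terms become multiples of the same tensor, the first sequence of the exchanged pair with
  -- the second sequence of the original pair. The coefficients then cancel.
  have e1 : ε₁ = (exchange J p).1 := signs_ext fun l hl1 hl2 => by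
    rw [h1' l hl1 hl2, entry_exchange_fst J p hl1 hl2]
    split_ifs with h
    · exact (hneg l h).symm
    · rfl
  have e2 : ε₂ = p.2 := signs_ext fun l hl1 hl2 => by
    rw [h2' l hl1 hl2]
    split_ifs with h
    · exact (hneg l h).symm
    · rw [entry_exchange_snd J p hl1 hl2, if_neg h]
  rw [h1, h2, e1, e2, hF p hL hi, ← add_smul, add_neg_cancel, zero_smul]
  · intro l hl1 hl2
    rw [entry_exchange_fst J p hl1 hl2]
    by_cases h : J l
    · simp only [h, if_true, iff_true, hc l h, hneg l h]
      exact hu l h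
    · simp [h]
  · intro l hl1 hl2
    rw [entry_exchange_snd J p hl1 hl2]
    by_cases h : J l
    · simp only [h, if_true, iff_true, hc l h, hneg l h]
      exact (hu l h).symm
    · simp [h]

open Classical in
/-- The coefficients of `lowB`. -/
def coeffB (n i : ℕ) (p : Signs n × Signs n) : ℂ :=
  if CondL i p.1 p.2 then (-1 : ℂ) ^ (n * (n + 1) / 2) * sg p.2 else 0

open Classical in
/-- The coefficients of `lowD`. -/
def coeffD (n i : ℕ) (p : Signs n × Signs n) : ℂ :=
  if CondL i p.1 p.2 ∧ ∏ t, p.1 t = 1 then (-1 : ℂ) ^ (n * (n + 1) / 2 + i) * sg p.2 else 0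

theorem lowB_eq_sum (n i : ℕ) :
    lowB n i = ∑ p, coeffB n i p • (spinVec p.1 ⊗ₜ[ℂ] spinVec p.2) := by
  simp only [lowB, coeffB, ite_smul, zero_smul]

theorem lowD_eq_sum (n i : ℕ) :
    lowD n i = ∑ p, coeffD n i p • (spinVec p.1 ⊗ₜ[ℂ] spinVec p.2) := by
  simp only [lowD, coeffD, ite_smul, zero_smul]

theorem coeffB_eq_zero {i : ℕ} {p : Signs n × Signs n} (h : ¬ CondL i p.1 p.2) :
    coeffB n i p = 0 := if_neg h

theorem coeffD_eq_zero {i : ℕ} {p : Signs n × Signs n} (h : ¬ CondL i p.1 p.2) :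
    coeffD n i p = 0 := if_neg fun h' => h h'.1

theorem coeffB_exchange (J : ℕ → Prop) [DecidablePred J] {i : ℕ} {p : Signs n × Signs n}
    (h : sg (exchange J p).2 = - sg p.2) : coeffB n i (exchange J p) = - coeffB n i p := by
  by_cases hp : CondL i p.1 p.2
  · rw [coeffB, coeffB, if_pos hp, if_pos ((condL_exchange J).2 hp), h, mul_neg]
  · rw [coeffB_eq_zero hp, coeffB_eq_zero (mt (condL_exchange J).1 hp), neg_zero]

theorem coeffD_exchange (J : ℕ → Prop) [DecidablePred J] {i : ℕ} {p : Signs n × Signs n}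
    (h : sg (exchange J p).2 = - sg p.2) (h' : ∏ t, (exchange J p).1 t = ∏ t, p.1 t) :
    coeffD n i (exchange J p) = - coeffD n i p := by
  rw [coeffD, coeffD]
  by_cases hp : CondL i p.1 p.2 ∧ ∏ t, p.1 t = 1
  · rw [if_pos hp, if_pos ⟨(condL_exchange J).2 hp.1, h'.trans hp.2⟩, h, mul_neg]
  · rw [if_neg hp, if_neg fun hq => hp ⟨(condL_exchange J).1 hq.1, h'.symm.trans hq.2⟩, neg_zero]

/-- `(+, -)` at the positions `j`, `j + 1` becomes `(-, +)`. -/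
def lower (ε : Signs n) (j : ℕ) : Signs n := setEntry (setEntry ε j (-1)) (j + 1) 1

theorem entry_lower (ε : Signs n) (j : ℕ) {l : ℕ} (h1 : 1 ≤ l) (h2 : l ≤ n) :
    entry (lower ε j) l = if l = j + 1 then 1 else if l = j then -1 else entry ε l := by
  rw [lower, entry_setEntry _ _ _ h1 h2, entry_setEntry _ _ _ h1 h2]
  simp

theorem spinB_f_of_lt {j : ℕ} (hj : j < n) (ε : Signs n) :
    (spinB n).f j (spinVec ε) =
      if entry ε j = 1 ∧ entry ε (j + 1) = -1 then spinVec (lower ε j) else 0 := by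
  simp [spinB, hj, hj.ne, lower]

theorem spinB_f_last (ε : Signs n) :
    (spinB n).f n (spinVec ε) = if entry ε n = 1 then spinVec (setEntry ε n (-1)) else 0 := by
  simp [spinB]

theorem spinD_f_of_lt {j : ℕ} (hj : j < n) (ε : Signs n) :
    (spinD n).f j (spinVec ε) =
      if entry ε j = 1 ∧ entry ε (j + 1) = -1 then spinVec (lower ε j) else 0 := by
  simp [spinD, hj, hj.ne, lower]

theorem spinD_f_last (ε : Signs n) :
    (spinD n).f n (spinVec ε) = if entry ε (n - 1) = 1 ∧ entry ε n = 1 then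
      spinVec (setEntry (setEntry ε (n - 1) (-1)) n (-1)) else 0 := by
  simp [spinD]

theorem tensorSquareEnd_f_adjacent (T : Module.End ℂ (Spin n)) {j : ℕ} (h1 : 1 ≤ j) (hj : j < n)
    (hT : ∀ ε, T (spinVec ε) =
      if entry ε j = 1 ∧ entry ε (j + 1) = -1 then spinVec (lower ε j) else 0)
    (i : ℕ) (F : Signs n × Signs n → ℂ) (hF0 : ∀ p, ¬ CondL i p.1 p.2 → F p = 0)
    (hF : ∀ (J : ℕ → Prop) [DecidablePred J] (p : Signs n × Signs n),
      sg (exchange J p).2 = - sg p.2 → ∏ t, (exchange J p).1 t = ∏ t, p.1 t →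
      F (exchange J p) = - F p) :
    tensorSquareEnd T (∑ p, F p • (spinVec p.1 ⊗ₜ[ℂ] spinVec p.2)) = 0 := by
  have hiff : ∀ ε : Signs n, (∀ l, l = j ∨ l = j + 1 → entry ε l = if l = j then 1 else -1) ↔
      entry ε j = 1 ∧ entry ε (j + 1) = -1 := fun ε => by simp [forall_eq_or_imp]
  refine tensorSquareEnd_eq_zero_of_exchange T (fun l => l = j ∨ l = j + 1)
    (fun l => if l = j then 1 else -1) i F ?_ ?_ ?_ hF0 ?_
  · rintro l hl
    exact ⟨by omega, by omega, j, by omega, Or.inl rfl, if_pos rfl⟩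
  · intro ε hε
    refine ⟨lower ε j, by rw [hT, if_pos ((hiff ε).1 hε)], fun l hl1 hl2 => ?_⟩
    rw [entry_lower _ _ hl1 hl2]
    split_ifs <;> omega
  · intro ε hε
    rw [hT, if_neg (mt (hiff ε).2 hε)]
  · intro p _ _ hd1 hd2
    exact hF _ p (sg_eq_neg_of_adjacent h1 hj hd2).1 (sg_eq_neg_of_adjacent h1 hj hd1).2

theorem spinB_f_lowB {i j : ℕ} (hj : j ∈ Finset.Icc 1 n) :
    (spinB n).tensorSquare.f j (lowB n i) = 0 := by
  obtain ⟨h1, h2⟩ := Finset.mem_Icc.1 hj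
  change tensorSquareEnd ((spinB n).f j) _ = 0
  rw [lowB_eq_sum]
  rcases h2.lt_or_eq with h | rfl
  · exact tensorSquareEnd_f_adjacent _ h1 h (fun ε => spinB_f_of_lt h ε) i _
      (fun p hp => coeffB_eq_zero hp) fun J _ p hp _ => coeffB_exchange J hp
  · refine tensorSquareEnd_eq_zero_of_exchange _ (fun l => l = j) (fun _ => 1) i _ ?_ ?_ ?_
      (fun p hp => coeffB_eq_zero hp) ?_
    · rintro l rfl
      exact ⟨h1, le_rfl, l, le_rfl, rfl, rfl⟩
    · intro ε hε
      refine ⟨setEntry ε j (-1), by rw [spinB_f_last, if_pos (hε j rfl)], fun l hl1 hl2 => ?_⟩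
      rw [entry_setEntry _ _ _ hl1 hl2]
      rfl
    · intro ε hε
      rw [spinB_f_last, if_neg fun h => hε fun l hl => by subst hl; exact h]
    · intro p _ _ _ hd2
      exact coeffB_exchange _ (sg_eq_neg_of_last h1 hd2).1

theorem spinD_f_lowD (hn : 2 ≤ n) {i j : ℕ} (hj : j ∈ Finset.Icc 1 n) :
    (spinD n).tensorSquare.f j (lowD n i) = 0 := by
  obtain ⟨h1, h2⟩ := Finset.mem_Icc.1 hj
  change tensorSquareEnd ((spinD n).f j) _ = 0
  rw [lowD_eq_sum]
  rcases h2.lt_or_eq with h | rfl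
  · exact tensorSquareEnd_f_adjacent _ h1 h (fun ε => spinD_f_of_lt h ε) i _
      (fun p hp => coeffD_eq_zero hp) fun J _ p hp hp' => coeffD_exchange J hp hp'
  -- Node `n` of type `D` turns `(+, +)` at the last two positions into `(-, -)`. Writing them as `j
  -- - 1` and `j - 1 + 1` makes the statement on adjacent changes applicable.
  · have hiff : ∀ ε : Signs j, (∀ l, l = j - 1 ∨ l = j - 1 + 1 → entry ε l = 1) ↔
        entry ε (j - 1) = 1 ∧ entry ε j = 1 := fun ε => by
      simp [Nat.sub_add_cancel h1]
    refine tensorSquareEnd_eq_zero_of_exchange _ (fun l => l = j - 1 ∨ l = j - 1 + 1)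
      (fun _ => 1) i _ ?_ ?_ ?_ (fun p hp => coeffD_eq_zero hp) ?_
    · rintro l hl
      exact ⟨by omega, by omega, l, le_rfl, hl, rfl⟩
    · intro ε hε
      refine ⟨setEntry (setEntry ε (j - 1) (-1)) j (-1),
        by rw [spinD_f_last, if_pos ((hiff ε).1 hε)], fun l hl1 hl2 => ?_⟩
      rw [entry_setEntry _ _ _ hl1 hl2, entry_setEntry _ _ _ hl1 hl2]
      simp only [Units.val_neg, Units.val_one]
      split_ifs <;> omega
    · intro ε hε
      rw [spinD_f_last, if_neg (mt (hiff ε).2 hε)]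
    · intro p _ _ hd1 hd2
      exact coeffD_exchange _ (sg_eq_neg_of_adjacent (by omega) (by omega) hd2).1
        (sg_eq_neg_of_adjacent (by omega) (by omega) hd1).2

/-- Up to position `i` the two entries add up to `-2` and behind it to `0`, so only the coroot `h_i`
sees a jump. -/
theorem wtB_add_wtB {i : ℕ} (h1 : 1 ≤ i) (hi : i < n) {p : Signs n × Signs n}
    (h : CondL i p.1 p.2) : wtB p.1 + wtB p.2 = negFundamental n i := by
  rw [condL_iff] at h
  ext s
  simp only [Pi.add_apply, wtB, negFundamental]
  have hn := h n (by omega) le_rfl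
  by_cases hs : (s : ℕ) + 1 < n
  · rw [if_pos hs, if_pos hs]
    have e1 := h (s + 1) (by omega) (by omega)
    have e2 := h (s + 2) (by omega) (by omega)
    have c1 := entry_cases p.1 (j := s + 1) (by omega) (by omega)
    have c2 := entry_cases p.1 (j := s + 2) (by omega) (by omega)
    split_ifs <;> omega
  · rw [if_neg hs, if_neg hs]
    split_ifs <;> omega

theorem wtD_add_wtD {i : ℕ} (h1 : 1 ≤ i) (hi : i + 2 ≤ n) {p : Signs n × Signs n}
    (h : CondL i p.1 p.2) : wtD p.1 + wtD p.2 = negFundamental n i := by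
  rw [condL_iff] at h
  ext s
  simp only [Pi.add_apply, wtD, negFundamental]
  by_cases hs : (s : ℕ) + 1 < n
  · rw [if_pos hs, if_pos hs]
    have e1 := h (s + 1) (by omega) (by omega)
    have e2 := h (s + 2) (by omega) (by omega)
    have c1 := entry_cases p.1 (j := s + 1) (by omega) (by omega)
    have c2 := entry_cases p.1 (j := s + 2) (by omega) (by omega)
    split_ifs <;> omega
  · rw [if_neg hs, if_neg hs]
    have e1 := h n (by omega) le_rfl
    have e2 := h (n - 1) (by omega) (by omega)
    have c1 := entry_cases p.1 (j := n) (by omega) (by omega)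
    have c2 := entry_cases p.1 (j := n - 1) (by omega) (by omega)
    split_ifs <;> omega

theorem sum_tmul_ne_zero (F : Signs n × Signs n → ℂ) (p : Signs n × Signs n) (hp : F p ≠ 0) :
    ∑ p, F p • (spinVec p.1 ⊗ₜ[ℂ] spinVec p.2) ≠ 0 := by
  intro h
  refine hp ?_
  have h1 := congrArg (fun z => finsuppTensorFinsupp' ℂ (Signs n) (Signs n) z p) h
  simp only [map_sum, map_smul, finsuppTensorFinsupp'_single_tmul_single, map_zero,
    Finsupp.coe_finsetSum, Finset.sum_apply, Finsupp.smul_apply, Finsupp.single_apply] at h1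
  simpa using h1

theorem lowB_ne_zero (n i : ℕ) : lowB n i ≠ 0 := by
  rw [lowB_eq_sum]
  refine sum_tmul_ne_zero _ (fun t => if (t : ℕ) + 1 ≤ i then -1 else 1, fun _ => -1) ?_
  rw [coeffB, if_pos]
  · exact mul_ne_zero (pow_ne_zero _ (by simp)) (sg_ne_zero _)
  · rw [condL_iff]
    intro j h1 h2
    simp only [entry, h1, h2, and_self, dif_pos, Nat.sub_add_cancel h1]
    constructor <;> intro h
    · simp [h]
    · simp [h.not_ge]

theorem lowD_ne_zero {n i : ℕ} (hi : i < n) : lowD n i ≠ 0 := by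
  rw [lowD_eq_sum]
  set ε : Signs n := fun t => if (t : ℕ) + 1 ≤ i then -1 else 1 with hε
  set ε' : Signs n := fun _ => -1 with hε'
  have hL : CondL i ε ε' := by
    rw [condL_iff]
    intro j h1 h2
    simp only [hε, hε', entry, h1, h2, and_self, dif_pos, Nat.sub_add_cancel h1]
    constructor <;> intro h
    · simp [h]
    · simp [h.not_ge]
  rcases Int.units_eq_one_or (∏ t, ε t) with h | h
  · refine sum_tmul_ne_zero _ (ε, ε') ?_
    rw [coeffD, if_pos ⟨hL, h⟩]
    exact mul_ne_zero (pow_ne_zero _ (by simp)) (sg_ne_zero _)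
  -- Flipping the last entries of both sequences corrects the parity and keeps the condition,
  -- because the last position lies behind `i`.
  · refine sum_tmul_ne_zero _ (flipLast ε, flipLast ε') ?_
    rw [coeffD, if_pos ⟨(condL_flipLast hi).2 hL, by
      rw [(sg_flipLast (by omega) ε).2, h, neg_neg]⟩]
    exact mul_ne_zero (pow_ne_zero _ (by simp)) (sg_ne_zero _)

theorem isLowestWeightVector_lowB {i : ℕ} (h1 : 1 ≤ i) (hi : i < n) :
    (spinB n).tensorSquare.IsLowestWeightVector (negFundamental n i) (lowB n i) := by
  refine ⟨⟨lowB_ne_zero n i, mem_weightSpace.1 ?_⟩, fun j hj => spinB_f_lowB hj⟩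
  rw [lowB_eq_sum]
  refine sum_mem fun p _ => ?_
  by_cases hp : CondL i p.1 p.2
  · rw [← wtB_add_wtB h1 hi hp]
    exact Submodule.smul_mem _ _
      (tmul_mem_weightSpace (spinVec_mem_weightSpaceB _) (spinVec_mem_weightSpaceB _))
  · rw [coeffB_eq_zero hp, zero_smul]
    exact zero_mem _

theorem isLowestWeightVector_lowD {i : ℕ} (h1 : 1 ≤ i) (hi : i + 2 ≤ n) :
    (spinD n).tensorSquare.IsLowestWeightVector (negFundamental n i) (lowD n i) := by
  refine ⟨⟨lowD_ne_zero (by omega), mem_weightSpace.1 ?_⟩,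
    fun j hj => spinD_f_lowD (by omega) hj⟩
  rw [lowD_eq_sum]
  refine sum_mem fun p _ => ?_
  by_cases hp : CondL i p.1 p.2
  · rw [← wtD_add_wtD h1 hi hp]
    exact Submodule.smul_mem _ _
      (tmul_mem_weightSpace (spinVec_mem_weightSpaceD (by omega) _)
        (spinVec_mem_weightSpaceD (by omega) _))
  · rw [coeffD_eq_zero hp, zero_smul]
    exact zero_mem _

end LowestWeight

/-! ### Leading terms in the tensor squares of the spin modules -/

section TensorLeading

variable {n : ℕ}

/-- For `t ≤ k` both signs at `t + 1` are minus, giving `b_t²`. For larger `t` they are opposite and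
give `a_t b_t` in either order, so the product is the same for every pair. -/
theorem leadCoeff_mul_leadCoeff (a b : ℕ → ℂ) (c c' : ℂ) {k q : ℕ} (hk : k + 1 ≤ q) (hq : q ≤ n)
    {ε ε' : Signs n} (h : CondL (k + 1) ε ε') :
    leadCoeff a b c 1 q ε * leadCoeff a b c' 1 q ε' =
      (∏ j ∈ Finset.Icc 1 k, b j) ^ 2 * (∏ j ∈ Finset.Ico (k + 1) q, b j) *
        (∏ j ∈ Finset.Ico (k + 1) q, a j) * (c * c') := by
  rw [condL_iff] at h
  rw [leadCoeff, leadCoeff, mul_mul_mul_comm, ← Finset.prod_mul_distrib,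
    ← Finset.prod_Ico_consecutive _ (by omega : 1 ≤ k + 1) hk,
    show Finset.Icc 1 k = Finset.Ico 1 (k + 1) from rfl, ← Finset.prod_pow,
    mul_assoc (∏ j ∈ Finset.Ico 1 (k + 1), b j ^ 2), ← Finset.prod_mul_distrib]
  congr 2
  · refine Finset.prod_congr rfl fun t ht => ?_
    rw [Finset.mem_Ico] at ht
    have := (h (t + 1) (by omega) (by omega)).1 (by omega)
    rw [this.1, this.2, if_neg (by simp), pow_two]
  · refine Finset.prod_congr rfl fun t ht => ?_
    rw [Finset.mem_Ico] at ht
    have := (h (t + 1) (by omega) (by omega)).2 (by omega)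
    rw [this]
    rcases entry_cases ε (j := t + 1) (by omega) (by omega) with h | h <;> rw [h]
    · simp [mul_comm]
    · simp

theorem head_eq_neg_one_of_condL {m k : ℕ} {p : Signs (m + 1) × Signs (m + 1)}
    (h : CondL (k + 1) p.1 p.2) : p.1 0 = -1 ∧ p.2 0 = -1 := by
  have := (condL_iff.1 h 1 le_rfl (by omega)).1 (by omega)
  have e1 := entry_eq p.1 0
  have e2 := entry_eq p.2 0
  simp only [Fin.val_zero, zero_add] at e1 e2
  rw [e1, e2] at this
  exact ⟨Units.ext (by simpa using this.1), Units.ext (by simpa using this.2)⟩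

theorem leadSign_cons_of_le (m : ℕ) (ε : Signs m) :
    leadSign 1 (m + 1) (Fin.cons (-1) ε : Signs (m + 1)) = Fin.cons 1 ε := by
  funext t
  refine Fin.cases ?_ (fun t => ?_) t
  · simp [leadSign]
  · simp only [leadSign, Fin.val_succ, Fin.cons_succ]
    rw [if_neg (by omega), if_neg (by omega)]

theorem leadSign_cons (m : ℕ) (ε : Signs (m + 1)) :
    leadSign 1 (m + 1) (Fin.cons (-1) ε : Signs (m + 2)) = Fin.cons 1 (flipLast ε) := by
  funext t
  refine Fin.cases ?_ (fun t => ?_) t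
  · simp [leadSign]
  · simp only [leadSign, Fin.val_succ, Fin.cons_succ, flipLast]
    rw [if_neg (by omega)]
    exact if_congr (by omega) rfl rfl

theorem plus_spinVec (ε : Signs n) : plus n (spinVec ε) = spinVec (Fin.cons 1 ε) := by
  simp [plus]

theorem plusTensor_sum (F : Signs n × Signs n → ℂ) :
    plusTensor n (∑ p, F p • (spinVec p.1 ⊗ₜ[ℂ] spinVec p.2)) =
      ∑ p, F p • (spinVec (Fin.cons 1 p.1) ⊗ₜ[ℂ] spinVec (Fin.cons 1 p.2)) := by
  simp only [map_sum, map_smul, plusTensor, TensorProduct.map_tmul, plus_spinVec]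

theorem plus_injective (n : ℕ) : Function.Injective (plus n) := by
  let g : Spin (n + 1) →ₗ[ℂ] Spin n := onBasis fun ε => spinVec (Fin.tail ε)
  have : g ∘ₗ plus n = LinearMap.id :=
    Finsupp.lhom_ext' fun ε => LinearMap.ext_ring (by simp [g, plus])
  exact Function.LeftInverse.injective (g := g) fun y => LinearMap.congr_fun this y

theorem plusTensor_ne_zero {z : Spin n ⊗[ℂ] Spin n} (hz : z ≠ 0) : plusTensor n z ≠ 0 := by
  have h : Function.Injective (plusTensor n) :=
    TensorProduct.map_injective_of_flat_flat _ _ (plus_injective n) (plus_injective n)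
  exact fun h0 => hz (h (by rw [h0, map_zero]))

/-- The new minus sign changes `sg` by `(-1)^(m+1)`, and `(m+1)(m+2)/2 = m(m+1)/2 + (m+1)`
compensates for it. -/
theorem coeffB_cons (m k : ℕ) (p : Signs m × Signs m) :
    coeffB (m + 1) (k + 1) (Fin.cons (-1) p.1, Fin.cons (-1) p.2) = coeffB m k p := by
  by_cases h : CondL k p.1 p.2
  · rw [coeffB, coeffB, if_pos (condL_cons.2 h), if_pos h, sg_cons, ← mul_assoc, ← pow_add]
    congr 1
    rw [show (m + 1) * (m + 1 + 1) = m * (m + 1) + (m + 1) * 2 by ring,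
      Nat.add_mul_div_right _ _ (by norm_num), add_assoc, ← two_mul, pow_add]
    simp
  · rw [coeffB_eq_zero (mt condL_cons.1 h), coeffB_eq_zero h]

/-- Compared with type `B`, flipping the last entry contributes one more sign, which the summand `i`
in the exponent absorbs. The flip also makes up for the new minus sign in the parity of the first
sequence. -/
theorem coeffD_cons (m k : ℕ) (hk : k < m) (p : Signs m × Signs m) :
    coeffD (m + 1) (k + 1) (Fin.cons (-1) (flipLast p.1), Fin.cons (-1) (flipLast p.2)) =
      coeffD m k p := by
  have h1 : CondL (k + 1) (Fin.cons (-1) (flipLast p.1) : Signs (m + 1))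
      (Fin.cons (-1) (flipLast p.2)) ↔ CondL k p.1 p.2 :=
    condL_cons.trans (condL_flipLast hk)
  have h2 : ∏ t, (Fin.cons (-1) (flipLast p.1) : Signs (m + 1)) t = ∏ t, p.1 t := by
    rw [Fin.prod_univ_succ, Fin.cons_zero]
    simp only [Fin.cons_succ]
    rw [(sg_flipLast (by omega) p.1).2, neg_one_mul, neg_neg]
  rw [coeffD, coeffD]
  by_cases h : CondL k p.1 p.2 ∧ ∏ t, p.1 t = 1
  · rw [if_pos ⟨h1.2 h.1, h2.trans h.2⟩, if_pos h, sg_cons, (sg_flipLast (by omega) p.2).1,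
      mul_neg, ← neg_mul, ← neg_one_mul ((-1 : ℂ) ^ (m + 1)), ← pow_succ', ← mul_assoc, ← pow_add]
    congr 1
    rw [show (m + 1) * (m + 1 + 1) = m * (m + 1) + (m + 1) * 2 by ring,
      Nat.add_mul_div_right _ _ (by norm_num),
      show m * (m + 1) / 2 + (m + 1) + (k + 1) + (m + 1 + 1) =
        m * (m + 1) / 2 + k + 2 * (m + 2) by ring, pow_add _ _ (2 * (m + 2))]
    simp
  · rw [if_neg h, if_neg fun h' => h ⟨h1.1 h'.1, h2.symm.trans h'.2⟩]

theorem sum_leadSign_B (m k : ℕ) :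
    ∑ p, coeffB (m + 1) (k + 1) p •
        (spinVec (leadSign 1 (m + 1) p.1) ⊗ₜ[ℂ] spinVec (leadSign 1 (m + 1) p.2)) =
      plusTensor m (lowB m k) := by
  rw [lowB_eq_sum, plusTensor_sum, sum_signs_cons]
  · refine Finset.sum_congr rfl fun p _ => ?_
    simp only [coeffB_cons, leadSign_cons_of_le]
  · intro p hp
    rw [coeffB_eq_zero (mt head_eq_neg_one_of_condL hp), zero_smul]

theorem sum_leadSign_D (m k : ℕ) (hk : k < m + 1) :
    ∑ p, coeffD (m + 2) (k + 1) p •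
        (spinVec (leadSign 1 (m + 1) p.1) ⊗ₜ[ℂ] spinVec (leadSign 1 (m + 1) p.2)) =
      plusTensor (m + 1) (lowD (m + 1) k) := by
  rw [lowD_eq_sum, plusTensor_sum, sum_signs_cons]
  -- The core of the word flips the last signs, so the pairs are reindexed by the same flip.
  · let φ : Signs (m + 1) ≃ Signs (m + 1) :=
      ⟨flipLast, flipLast, flipLast_flipLast, flipLast_flipLast⟩
    rw [← Equiv.sum_comp (φ.prodCongr φ)]
    refine Finset.sum_congr rfl fun p _ => ?_
    have : (φ.prodCongr φ) p = (flipLast p.1, flipLast p.2) := rfl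
    simp only [this, coeffD_cons _ _ hk, leadSign_cons, flipLast_flipLast]
  · intro p hp
    rw [coeffD_eq_zero (mt head_eq_neg_one_of_condL hp), zero_smul]

theorem LT_lowB {m k : ℕ} (hk : k < m) (a b : ℕ → ℂ) :
    LT (cartanB (m + 1)) (spinB (m + 1)).tensorSquare (negFundamental (m + 1) (k + 1))
      (leadMult (m + 1) (node (m + 1) (m + 1)) 1 (m + 1) +
        leadMult (m + 1) (node (m + 1) (m + 1)) 1 (m + 1))
      (wordBC (spinB (m + 1)).tensorSquare (m + 1) a b (lowB (m + 1) (k + 1)))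
      (((∏ j ∈ Finset.Icc 1 k, b j) ^ 2 * (∏ j ∈ Finset.Icc (k + 1) m, b j) *
          a (m + 1) ^ 2 * ∏ j ∈ Finset.Icc (k + 1) m, a j) • plusTensor m (lowB m k)) := by
  rw [wordBC_tensorSquare fun j hj => spinB_e_sq hj, wordBC_eq_sandwich, ← sum_leadSign_B,
    lowB_eq_sum, map_sum, Finset.smul_sum]
  refine LT.sum _ fun p _ => ?_
  by_cases hp : CondL (k + 1) p.1 p.2
  swap
  · simpa [coeffB_eq_zero hp] using LT.zero
  have hm := (condL_iff.1 hp 1 le_rfl (by omega)).1 (by omega)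
  have ht : ∀ ε : Signs (m + 1), TailEq (m + 1) 1 ε := fun ε t h => by omega
  have H := (spinDataB m 1 (a (m + 1))).sandwich_spec a b m 1 le_rfl (by omega)
  have h1 := ((H p.1 (ht _)).1 hm.1).tmul ((H p.2 (ht _)).1 hm.2)
  rw [wtB_add_wtB (by omega) (by omega) hp] at h1
  convert h1.smul (coeffB (m + 1) (k + 1) p) using 1
  · simp
  · rw [TensorProduct.smul_tmul_smul,
      leadCoeff_mul_leadCoeff a b _ _ (by omega) le_rfl hp, smul_comm]
    congr 2
    rw [show Finset.Icc (k + 1) m = Finset.Ico (k + 1) (m + 1) from rfl]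
    ring

/-- In each pair exactly one sequence ends in `+`. Its core contributes `a_{n-1}` and `α_{n-1}`,
that of the other `b_{n-1}` and `α_n`; the total coefficient and degree do not depend on which is
which. -/
theorem LT_lowD {m k : ℕ} (hk : k < m) (a b : ℕ → ℂ) :
    LT (cartanD (m + 2)) (spinD (m + 2)).tensorSquare (negFundamental (m + 2) (k + 1))
      (leadMult (m + 2) (node (m + 2) (m + 1)) 1 (m + 1) +
        leadMult (m + 2) (node (m + 2) (m + 2)) 1 (m + 1))
      (wordD (spinD (m + 2)).tensorSquare (m + 2) a b (lowD (m + 2) (k + 1)))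
      (((∏ j ∈ Finset.Icc 1 k, b j) ^ 2 * (∏ j ∈ Finset.Icc (k + 1) (m + 1), b j) *
          ∏ j ∈ Finset.Icc (k + 1) (m + 1), a j) • plusTensor (m + 1) (lowD (m + 1) k)) := by
  rw [wordD_tensorSquare (by omega) fun j hj => spinD_e_sq hj, wordD_eq_sandwich,
    ← sum_leadSign_D _ _ (by omega), lowD_eq_sum, map_sum, Finset.smul_sum]
  refine LT.sum _ fun p _ => ?_
  by_cases hp : CondL (k + 1) p.1 p.2
  swap
  · simpa [coeffD_eq_zero hp] using LT.zero
  have hm := (condL_iff.1 hp 1 le_rfl (by omega)).1 (by omega)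
  have hlast := (condL_iff.1 hp (m + 2) (by omega) le_rfl).2 (by omega)
  have ht : ∀ (ε : Signs (m + 2)) (s : ℤˣ), entry ε (m + 2) = s → TailEq (m + 1) s ε :=
    fun ε s h t ht => by
      rw [← Units.val_inj, ← h, ← entry_eq, show (t : ℕ) + 1 = m + 2 by omega]
  have H := fun s => (spinDataD m s (a (m + 1)) (b (m + 1))).sandwich_spec a b m 1 le_rfl (by omega)
  have key : ∀ c c' : ℂ, c * c' = a (m + 1) * b (m + 1) →
      ((∏ j ∈ Finset.Icc 1 k, b j) ^ 2 * (∏ j ∈ Finset.Icc (k + 1) (m + 1), b j) *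
        ∏ j ∈ Finset.Icc (k + 1) (m + 1), a j) =
      leadCoeff a b c 1 (m + 1) p.1 * leadCoeff a b c' 1 (m + 1) p.2 := fun c c' hc => by
    have htop : ∀ z : ℕ → ℂ, ∏ j ∈ Finset.Icc (k + 1) (m + 1), z j =
        (∏ j ∈ Finset.Ico (k + 1) (m + 1), z j) * z (m + 1) :=
      fun z => Finset.prod_Ico_succ_top (by omega) z
    rw [leadCoeff_mul_leadCoeff a b _ _ (by omega) (by omega) hp, hc, htop, htop]
    ring
  rcases entry_cases p.1 (j := m + 2) (by omega) le_rfl with h | h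
  · have h1 := ((H 1 p.1 (ht _ _ (by simpa using h))).1 hm.1).tmul
      ((H (-1) p.2 (ht _ _ (by rw [hlast, h]; rfl))).1 hm.2)
    rw [wtD_add_wtD (by omega) (by omega) hp, if_pos rfl, if_pos rfl, if_neg (by decide),
      if_neg (by decide)] at h1
    convert h1.smul (coeffD (m + 2) (k + 1) p) using 1
    · simp
    · rw [TensorProduct.smul_tmul_smul, smul_comm, key _ _ rfl]
  · have h1 := ((H (-1) p.1 (ht _ _ (by simpa using h))).1 hm.1).tmul
      ((H 1 p.2 (ht _ _ (by rw [hlast, h]; rfl))).1 hm.2)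
    rw [wtD_add_wtD (by omega) (by omega) hp, if_pos rfl, if_pos rfl, if_neg (by decide),
      if_neg (by decide), add_comm (leadMult _ (node (m + 2) (m + 2)) _ _)] at h1
    convert h1.smul (coeffD (m + 2) (k + 1) p) using 1
    · simp
    · rw [TensorProduct.smul_tmul_smul, smul_comm, key _ _ (mul_comm _ _)]

theorem hasLeadingTerm_lowB {m k : ℕ} (hk : k < m) (a b : ℕ → ℂ) :
    HasLeadingTerm (cartanB (m + 1)) (spinB (m + 1)).tensorSquare (lowB (m + 1) (k + 1))
        (wordBC (spinB (m + 1)).tensorSquare (m + 1) a b)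
        ((∏ j ∈ Finset.Icc 1 k, b j) ^ 2 * (∏ j ∈ Finset.Icc (k + 1) m, b j) *
          a (m + 1) ^ 2 * ∏ j ∈ Finset.Icc (k + 1) m, a j)
        (plusTensor m (lowB m k)) :=
  hasLeadingTerm_of_LT (irrefl_cartanB _) (wordBC_mem_generated _ _ _ _ _) (LT_lowB hk a b)
    -- With all parameters equal to one the coefficient is one, which shows the weight of the
    -- leading vector itself.
    (by simpa using (LT_lowB hk 1 1).1) (plusTensor_ne_zero (lowB_ne_zero m k))

theorem hasLeadingTerm_lowD {m k : ℕ} (hk : k < m) (a b : ℕ → ℂ) :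
    HasLeadingTerm (cartanD (m + 2)) (spinD (m + 2)).tensorSquare (lowD (m + 2) (k + 1))
        (wordD (spinD (m + 2)).tensorSquare (m + 2) a b)
        ((∏ j ∈ Finset.Icc 1 k, b j) ^ 2 * (∏ j ∈ Finset.Icc (k + 1) (m + 1), b j) *
          ∏ j ∈ Finset.Icc (k + 1) (m + 1), a j)
        (plusTensor (m + 1) (lowD (m + 1) k)) :=
  hasLeadingTerm_of_LT (irrefl_cartanD _ (by omega)) (wordD_mem_generated _ (by omega) _ _ _)
    (LT_lowD hk a b) (by simpa using (LT_lowD hk 1 1).1)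
    (plusTensor_ne_zero (lowD_ne_zero (by omega)))

end TensorLeading

/-! ### The spin representations -/

section Spin

variable {n : ℕ}

/-- `(-, …, -, s)`. -/
def minusSigns (n : ℕ) (s : ℤˣ) : Signs n := fun t => if (t : ℕ) + 1 = n then s else -1

theorem entry_minusSigns (s : ℤˣ) {l : ℕ} (h1 : 1 ≤ l) (h2 : l ≤ n) :
    entry (minusSigns n s) l = if l = n then (s : ℤ) else -1 := by
  simp only [entry, h1, h2, and_self, dif_pos, minusSigns, Nat.sub_add_cancel h1]
  split_ifs <;> simp

theorem allMinus_eq (n : ℕ) : allMinus n = spinVec (minusSigns n (-1)) := by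
  unfold allMinus
  congr 1
  funext t
  simp [minusSigns]

theorem lastPlus_eq (n : ℕ) : lastPlus n = spinVec (minusSigns n 1) := rfl

theorem plus_ne_zero (ε : Signs n) : plus n (spinVec ε) ≠ 0 := by
  simp [plus_spinVec]

theorem leadCoeff_minusSigns (a b : ℕ → ℂ) (c : ℂ) (s : ℤˣ) {q : ℕ} (hq : q ≤ n)
    (hs : q < n ∨ s = -1) :
    leadCoeff a b c 1 q (minusSigns n s) = (∏ j ∈ Finset.Ico 1 q, b j) * c := by
  rw [leadCoeff]
  congr 1
  refine Finset.prod_congr rfl fun t ht => ?_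
  rw [Finset.mem_Ico] at ht
  have : entry (minusSigns n s) (t + 1) = -1 := by
    rw [entry_minusSigns _ (by omega) (by omega)]
    rcases hs with hs | rfl
    · rw [if_neg (by omega)]
    · simp
  rw [this, if_neg (by decide)]

theorem minusSigns_eq_cons (m : ℕ) (hm : 1 ≤ m) (s : ℤˣ) :
    minusSigns (m + 1) s = Fin.cons (-1) (minusSigns m s) := by
  funext t
  refine Fin.cases ?_ (fun t => ?_) t
  · simp [minusSigns]; omega
  · simp [minusSigns]

theorem flipLast_minusSigns (m : ℕ) (s : ℤˣ) :
    flipLast (minusSigns m s) = minusSigns m (-s) := by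
  funext t
  simp only [flipLast, minusSigns]
  split_ifs <;> rfl

theorem wtB_minusSigns (m : ℕ) :
    wtB (minusSigns (m + 1) (-1)) = negFundamental (m + 1) (m + 1) := by
  have E : ∀ l, 1 ≤ l → l ≤ m + 1 → entry (minusSigns (m + 1) (-1)) l = -1 := fun l h1 h2 => by
    rw [entry_minusSigns _ h1 h2]; simp
  ext s
  simp only [wtB, negFundamental]
  by_cases hs : (s : ℕ) + 1 < m + 1
  · rw [if_pos hs, E _ (by omega) (by omega), E _ (by omega) (by omega), if_neg (by omega)]
    rfl
  · rw [if_neg hs, E _ (by omega) le_rfl, if_pos (by omega)]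

theorem wtD_minusSigns (m : ℕ) (s : ℤˣ) :
    wtD (minusSigns (m + 2) s) = negFundamental (m + 2) (if s = 1 then m + 1 else m + 2) := by
  have E : ∀ l, 1 ≤ l → l ≤ m + 2 →
      entry (minusSigns (m + 2) s) l = if l = m + 2 then (s : ℤ) else -1 :=
    fun l h1 h2 => entry_minusSigns s h1 h2
  have hs : (s = 1 ∧ (s : ℤ) = 1) ∨ (s ≠ 1 ∧ (s : ℤ) = -1) := by
    rcases Int.units_eq_one_or s with rfl | rfl
    · exact Or.inl ⟨rfl, rfl⟩
    · exact Or.inr ⟨by decide, rfl⟩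
  ext t
  simp only [wtD, negFundamental]
  by_cases ht : (t : ℕ) + 1 < m + 2
  · rw [if_pos ht, E _ (by omega) (by omega), E _ (by omega) (by omega)]
    rcases hs with ⟨h, h'⟩ | ⟨h, h'⟩ <;> simp only [h'] <;> simp only [h, if_true, if_false] <;>
      split_ifs <;> omega
  · rw [if_neg ht, E _ (by omega) (by omega), E _ (by omega) (by omega)]
    rcases hs with ⟨h, h'⟩ | ⟨h, h'⟩ <;> simp only [h'] <;> simp only [h, if_true, if_false] <;>
      split_ifs <;> omega

theorem isLowestWeightVector_lowSpinB (m : ℕ) :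
    (spinB (m + 1)).IsLowestWeightVector (negFundamental (m + 1) (m + 1)) (lowSpinB (m + 1)) := by
  rw [lowSpinB, allMinus_eq]
  refine ⟨⟨by simp, mem_weightSpace.1 ?_⟩, fun j hj => ?_⟩
  · rw [← wtB_minusSigns]
    exact spinVec_mem_weightSpaceB _
  · obtain ⟨h1, h2⟩ := Finset.mem_Icc.1 hj
    rcases h2.lt_or_eq with h | rfl
    · rw [spinB_f_of_lt h, entry_minusSigns _ h1 h2]
      simp
    · rw [spinB_f_last, entry_minusSigns _ h1 h2]
      simp

theorem hasLeadingTerm_lowSpinB {m : ℕ} (hm : 1 ≤ m) (a b : ℕ → ℂ) :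
    HasLeadingTerm (cartanB (m + 1)) (spinB (m + 1)) (lowSpinB (m + 1))
      (wordBC (spinB (m + 1)) (m + 1) a b) ((∏ j ∈ Finset.Icc 1 m, b j) * a (m + 1))
      (plus m (lowSpinB m)) := by
  have key : ∀ a b : ℕ → ℂ, LT (cartanB (m + 1)) (spinB (m + 1)) (negFundamental (m + 1) (m + 1))
      (leadMult (m + 1) (node (m + 1) (m + 1)) 1 (m + 1))
      (wordBC (spinB (m + 1)) (m + 1) a b (lowSpinB (m + 1)))
      (((∏ j ∈ Finset.Icc 1 m, b j) * a (m + 1)) • plus m (lowSpinB m)) := fun a b => by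
    have h := ((spinDataB m 1 (a (m + 1))).sandwich_spec a b m 1 le_rfl (by omega)
      (minusSigns (m + 1) (-1)) (fun t ht => by omega)).1
      (by rw [entry_minusSigns _ (by omega) (by omega)]; simp)
    rwa [← wordBC_eq_sandwich, wtB_minusSigns, leadCoeff_minusSigns _ _ _ _ le_rfl (Or.inr rfl),
      minusSigns_eq_cons m hm, leadSign_cons_of_le, ← plus_spinVec, ← minusSigns_eq_cons m hm,
      ← allMinus_eq, ← allMinus_eq] at h
  refine hasLeadingTerm_of_LT (irrefl_cartanB _) (wordBC_mem_generated _ _ _ _ _) (key a b)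
    (by simpa using (key 1 1).1) ?_
  rw [lowSpinB, allMinus_eq]
  exact plus_ne_zero _

theorem isLowestWeightVector_minusSigns (m : ℕ) (s : ℤˣ) :
    (spinD (m + 2)).IsLowestWeightVector
      (negFundamental (m + 2) (if s = 1 then m + 1 else m + 2)) (spinVec (minusSigns (m + 2) s)) := by
  refine ⟨⟨by simp, mem_weightSpace.1 ?_⟩, fun j hj => ?_⟩
  · rw [← wtD_minusSigns]
    exact spinVec_mem_weightSpaceD (by omega) _
  · obtain ⟨h1, h2⟩ := Finset.mem_Icc.1 hj
    rcases h2.lt_or_eq with h | rfl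
    · rw [spinD_f_of_lt h, entry_minusSigns _ h1 h2, if_neg h.ne]
      simp
    · rw [spinD_f_last, entry_minusSigns _ (l := m + 2 - 1) (by omega) (by omega),
        if_neg (by omega)]

/-- Organized by the last sign `s` rather than by the parity of the rank: the four cases of types
`Λ_{n-1}` and `Λ_n` reduce to two. The last sign is reversed by the core. -/
theorem hasLeadingTerm_minusSigns (m : ℕ) (s : ℤˣ) (a b : ℕ → ℂ) :
    HasLeadingTerm (cartanD (m + 2)) (spinD (m + 2)) (spinVec (minusSigns (m + 2) s))
      (wordD (spinD (m + 2)) (m + 2) a b)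
      ((∏ j ∈ Finset.Icc 1 m, b j) * if s = 1 then a (m + 1) else b (m + 1))
      (plus (m + 1) (spinVec (minusSigns (m + 1) (-s)))) := by
  have key : ∀ a b : ℕ → ℂ, LT (cartanD (m + 2)) (spinD (m + 2))
      (negFundamental (m + 2) (if s = 1 then m + 1 else m + 2))
      (leadMult (m + 2) (if s = 1 then node (m + 2) (m + 1) else node (m + 2) (m + 2)) 1 (m + 1))
      (wordD (spinD (m + 2)) (m + 2) a b (spinVec (minusSigns (m + 2) s)))
      (((∏ j ∈ Finset.Icc 1 m, b j) * if s = 1 then a (m + 1) else b (m + 1)) •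
        plus (m + 1) (spinVec (minusSigns (m + 1) (-s)))) := fun a b => by
    have h := ((spinDataD m s (a (m + 1)) (b (m + 1))).sandwich_spec a b m 1 le_rfl (by omega)
      (minusSigns (m + 2) s) (fun t ht => by
        rw [minusSigns, if_pos (by omega)])).1
      (by rw [entry_minusSigns _ (by omega) (by omega), if_neg (by omega)])
    rw [← wordD_eq_sandwich, wtD_minusSigns,
      leadCoeff_minusSigns _ _ _ _ (by omega) (Or.inl (by omega)),
      minusSigns_eq_cons (m + 1) (by omega), leadSign_cons, ← plus_spinVec,
      flipLast_minusSigns, ← minusSigns_eq_cons (m + 1) (by omega)] at h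
    exact h
  refine hasLeadingTerm_of_LT (irrefl_cartanD _ (by omega))
    (wordD_mem_generated _ (by omega) _ _ _) (key a b)
    (by simpa using (key 1 1).1) (plus_ne_zero _)

end Spin

/-! ### Leading terms of multilinear expressions -/

section Multilinear

variable {V : Type} [AddCommGroup V] [Module ℂ V] {n : ℕ} {A : Matrix (Fin n) (Fin n) ℤ}
  {R : ChevalleyAction V}

/-- A finite expansion into homogeneous components with the top one singled out, ready to be put
into a multilinear map. -/
theorem LT.exists_sum {μ : Fin n → ℤ} {κ : Fin n → ℕ} {y l : V} (h : LT A R μ κ y l) :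
    ∃ (S : Finset (Fin n → ℕ)) (g : (Fin n → ℕ) → V), κ ∈ S ∧ (∀ η ∈ S, η ≤ κ) ∧
      (∀ η ∈ S, g η ∈ weightSpace R (shiftWt A μ η)) ∧ g κ = l ∧ ∑ η ∈ S, g η = y := by
  classical
  obtain ⟨f, hf, hsum⟩ := (Submodule.mem_iSup_iff_exists_finsupp _ _).1 h.2
  set S : Finset (Fin n → ℕ) := f.support.map (Function.Embedding.subtype _) with hS
  have hSlt : ∀ η ∈ S, η < κ := fun η hη => by
    obtain ⟨η, -, rfl⟩ := Finset.mem_map.1 hη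
    exact η.2
  have hκ : κ ∉ S := fun hκ => (hSlt κ hκ).ne rfl
  refine ⟨insert κ S, fun η => if hη : η < κ then f ⟨η, hη⟩ else l, Finset.mem_insert_self _ _,
    fun η hη => ?_, fun η hη => ?_, by simp, ?_⟩
  · rcases Finset.mem_insert.1 hη with rfl | hη
    exacts [le_rfl, (hSlt η hη).le]
  · rcases Finset.mem_insert.1 hη with rfl | hη
    · simpa using h.1
    · simpa [hSlt η hη] using hf ⟨η, hSlt η hη⟩
  · rw [Finset.sum_insert hκ, hS, Finset.sum_map, dif_neg (lt_irrefl κ)]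
    have : ∑ η ∈ f.support, (if hη : (η : Fin n → ℕ) < κ then f ⟨η, hη⟩ else l) = y - l := by
      rw [← hsum, Finsupp.sum]
      exact Finset.sum_congr rfl fun η _ => by rw [dif_pos η.2]
    rw [← add_sub_cancel l y, ← this]
    rfl

theorem shiftWt_sum {r : ℕ} (μ : Fin r → Fin n → ℤ) (κ : Fin r → Fin n → ℕ) :
    shiftWt A (∑ s, μ s) (∑ s, κ s) = ∑ s, shiftWt A (μ s) (κ s) := by
  ext t
  simp only [shiftWt, Finset.sum_apply, Nat.cast_sum, Finset.mul_sum, Finset.sum_add_distrib]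
  rw [Finset.sum_comm]

/-- Expanding all arguments, every choice of components other than the top ones is strictly smaller
in some argument, so the sum of its degrees is strictly below the top. -/
theorem LT.multilinear {V' : Type} [AddCommGroup V'] [Module ℂ V'] {R' : ChevalleyAction V'}
    {r : ℕ} (F : MultilinearMap ℂ (fun _ : Fin r => V) V')
    (hF : ∀ (μ : Fin r → Fin n → ℤ) (w : Fin r → V), (∀ s, w s ∈ weightSpace R (μ s)) →
      F w ∈ weightSpace R' (∑ s, μ s))
    {μ : Fin r → Fin n → ℤ} {κ : Fin r → Fin n → ℕ} {y l : Fin r → V}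
    (h : ∀ s, LT A R (μ s) (κ s) (y s) (l s)) :
    LT A R' (∑ s, μ s) (∑ s, κ s) (F y) (F l) := by
  classical
  choose S g hκ hle hg hl hy using fun s => (h s).exists_sum
  obtain rfl : y = fun s => ∑ η ∈ S s, g s η := funext fun s => (hy s).symm
  obtain rfl : l = fun s => g s (κ s) := funext fun s => (hl s).symm
  constructor
  · rw [shiftWt_sum]
    exact hF _ _ fun s => hg s _ (hκ s)
  · rw [MultilinearMap.map_sum_finset,
      ← Finset.add_sum_erase _ _ (Fintype.mem_piFinset.2 hκ), add_sub_cancel_left]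
    refine sum_mem fun ρ hρ => ?_
    obtain ⟨hne, hρ⟩ := Finset.mem_erase.1 hρ
    rw [Fintype.mem_piFinset] at hρ
    refine weightSpace_le_Low (κ' := ∑ s, ρ s) ?_ ?_
    · have hle' : ∀ s, ρ s ≤ κ s := fun s => hle s _ (hρ s)
      obtain ⟨s, hs⟩ : ∃ s, ρ s ≠ κ s := by
        by_contra! hcon
        exact hne (funext hcon)
      exact Finset.sum_lt_sum (fun s _ => hle' s) ⟨s, Finset.mem_univ _, lt_of_le_of_ne (hle' s) hs⟩
    · rw [shiftWt_sum]
      exact hF _ _ fun s => hg s _ (hρ s)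

end Multilinear

/-! ### Tensor powers and antisymmetrization -/

section TensorPower

variable {V : Type} [AddCommGroup V] [Module ℂ V] {n r : ℕ} {R : ChevalleyAction V}

theorem map_update_tprod (T : Module.End ℂ V) (s : Fin r) (w : Fin r → V) :
    PiTensorProduct.map (Function.update (fun _ => LinearMap.id) s T)
      (PiTensorProduct.tprod ℂ w) = PiTensorProduct.tprod ℂ (Function.update w s (T (w s))) := by
  rw [PiTensorProduct.map_tprod]
  congr 1
  funext i
  by_cases h : i = s
  · subst h; simp
  · simp [h]

theorem tensorPowerEnd_tprod (T : Module.End ℂ V) (w : Fin r → V) :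
    tensorPowerEnd r T (PiTensorProduct.tprod ℂ w) =
      ∑ s, PiTensorProduct.tprod ℂ (Function.update w s (T (w s))) := by
  simp only [tensorPowerEnd, LinearMap.sum_apply, map_update_tprod]

/-- `∑_σ sgn(σ) w_{σ(1)} ⊗ ⋯ ⊗ w_{σ(r)}`. -/
def alt (V : Type) [AddCommGroup V] [Module ℂ V] (r : ℕ) :
    V [⋀^Fin r]→ₗ[ℂ] (⨂[ℂ] _ : Fin r, V) :=
  MultilinearMap.alternatization (PiTensorProduct.tprod ℂ (s := fun _ : Fin r => V))

theorem alt_apply (w : Fin r → V) : alt V r w = ∑ σ : Equiv.Perm (Fin r),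
    ((Equiv.Perm.sign σ : ℤ) : ℂ) • PiTensorProduct.tprod ℂ fun s => w (σ s) := by
  rw [alt, MultilinearMap.alternatization_apply]
  refine Finset.sum_congr rfl fun σ _ => ?_
  rw [Int.cast_smul_eq_zsmul]
  rfl

/-- A derivation treats all factors alike, so it commutes with permuting them. -/
theorem tensorPowerEnd_alt (T : Module.End ℂ V) (w : Fin r → V) :
    tensorPowerEnd r T (alt V r w) = ∑ s, alt V r (Function.update w s (T (w s))) := by
  simp only [alt_apply, map_sum, map_smul, tensorPowerEnd_tprod]
  rw [Finset.sum_comm]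
  refine Finset.sum_congr rfl fun σ _ => ?_
  rw [← Finset.smul_sum, ← Equiv.sum_comp σ fun s =>
    PiTensorProduct.tprod ℂ fun i => Function.update w s (T (w s)) (σ i)]
  congr 1
  refine Finset.sum_congr rfl fun s _ => ?_
  congr 1
  funext i
  by_cases h : i = s
  · subst h; simp
  · rw [Function.update_of_ne h, Function.update_of_ne fun h' => h (σ.injective h')]

theorem map_alt (T : Module.End ℂ V) (w : Fin r → V) :
    PiTensorProduct.map (fun _ => T) (alt V r w) = alt V r fun s => T (w s) := by
  simp only [alt_apply, map_sum, map_smul, PiTensorProduct.map_tprod]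

theorem tprod_mem_weightSpace (μ : Fin r → Fin n → ℤ) (w : Fin r → V)
    (h : ∀ s, w s ∈ weightSpace R (μ s)) :
    PiTensorProduct.tprod ℂ w ∈ weightSpace (R.tensorPower r) (∑ s, μ s) := by
  intro t
  change tensorPowerEnd r (R.h (t + 1)) _ = _
  rw [tensorPowerEnd_tprod, Finset.sum_apply, Int.cast_sum, Finset.sum_smul]
  refine Finset.sum_congr rfl fun s _ => ?_
  rw [h s t, MultilinearMap.map_update_smul, Function.update_eq_self]

theorem alt_mem_weightSpace (μ : Fin r → Fin n → ℤ) (w : Fin r → V)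
    (h : ∀ s, w s ∈ weightSpace R (μ s)) :
    alt V r w ∈ weightSpace (R.tensorPower r) (∑ s, μ s) := by
  rw [alt_apply]
  refine sum_mem fun σ _ => Submodule.smul_mem _ _ ?_
  rw [← Equiv.sum_comp σ]
  exact tprod_mem_weightSpace (fun s => μ (σ s)) _ fun s => h (σ s)

theorem alt_ne_zero {X : Type} (x : Fin r → X) (hx : Function.Injective x) :
    alt (X →₀ ℂ) r (fun s => Finsupp.single (x s) 1) ≠ 0 := by
  intro h
  -- The product of the coordinates `x s` of the factors; as `x` is injective, only the identity
  -- permutation has a nonzero value.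
  let G : (⨂[ℂ] _ : Fin r, (X →₀ ℂ)) →ₗ[ℂ] ℂ := PiTensorProduct.lift
    ((MultilinearMap.mkPiAlgebra ℂ (Fin r) ℂ).compLinearMap fun s => Finsupp.lapply (x s))
  have h1 := congrArg G h
  rw [alt_apply, map_sum, map_zero, Finset.sum_eq_single 1] at h1
  · simp [G] at h1
  · intro σ _ hσ
    obtain ⟨s, hs⟩ : ∃ s, σ s ≠ s := by
      by_contra! hcon
      exact hσ (Equiv.ext hcon)
    rw [map_smul, PiTensorProduct.lift.tprod, MultilinearMap.compLinearMap_apply,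
      MultilinearMap.mkPiAlgebra_apply, Finset.prod_eq_zero (Finset.mem_univ s), smul_zero]
    rw [Finsupp.lapply_apply, Finsupp.single_eq_of_ne]
    exact fun h => hs (hx h).symm
  · simp

theorem insertFactor_tprod (s : Fin (r + 1)) (v : V) (w : Fin r → V) :
    insertFactor s v (PiTensorProduct.tprod ℂ w) =
      PiTensorProduct.tprod ℂ (s.insertNth v w : Fin (r + 1) → V) := by
  rw [insertFactor, PiTensorProduct.lift.tprod]
  rfl

/-- Expansion of an antisymmetrization by the position of the first vector. -/
theorem sum_insertFactor_alt (v : V) (w : Fin r → V) :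
    ∑ s : Fin (r + 1), ((-1 : ℂ) ^ (s : ℕ)) • insertFactor s v (alt V r w) =
      alt V (r + 1) (Fin.cons v w : Fin (r + 1) → V) := by
  simp only [alt_apply, map_sum, map_smul, insertFactor_tprod, Finset.smul_sum, smul_smul]
  rw [← Fintype.sum_prod_type']
  -- The cycle takes position `s` to `0`, keeps the order of the others and has sign `(-1)^s`; then
  -- `σ` permutes the nonzero indices. Every permutation arises exactly once.
  let Φ : Fin (r + 1) × Equiv.Perm (Fin r) → Equiv.Perm (Fin (r + 1)) := fun p =>
    Equiv.Perm.decomposeFin.symm (0, p.2) * p.1.cycleRange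
  have h0 : ∀ p, Φ p p.1 = 0 := fun p => by simp [Φ]
  have hs : ∀ p i, Φ p (p.1.succAbove i) = (p.2 i).succ := fun p i => by
    simp [Φ, Fin.cycleRange_succAbove]
  have hinj : Function.Injective Φ := by
    rintro ⟨s, σ⟩ ⟨s', σ'⟩ h
    have h1 : s = s' := by
      have e1 := h0 (s, σ)
      have e2 := h0 (s', σ')
      rw [h] at e1
      exact (Φ (s', σ')).injective (e1.trans e2.symm)
    subst h1
    have h2 : σ = σ' := Equiv.ext fun i => by
      have e1 := hs (s, σ) i
      rw [h, hs (s, σ') i] at e1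
      exact (Fin.succ_injective _ e1).symm
    rw [h2]
  have hbij : Function.Bijective Φ := by
    rw [Fintype.bijective_iff_injective_and_card]
    exact ⟨hinj, by simp [Fintype.card_perm, Nat.factorial_succ]⟩
  refine Fintype.sum_bijective Φ hbij _ _ fun p => ?_
  congr 1
  · simp [Φ, Equiv.Perm.decomposeFin.symm_sign, mul_comm]
  · congr 1
    funext i
    refine Fin.succAboveCases p.1 ?_ (fun i => ?_) i
    · rw [Fin.insertNth_apply_same, h0, Fin.cons_zero]
    · rw [Fin.insertNth_apply_succAbove, hs, Fin.cons_succ]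

/-- The copies of `T` in different factors commute and have square zero, so the factors can be
adjoined one at a time. Nilpotency is carried along because the exponential law for commuting
summands needs it. -/
theorem exp_sum_factors [Module ℚ (⨂[ℂ] _ : Fin r, V)] {T : Module.End ℂ V} (hT : T * T = 0) (S : Finset (Fin r)) :
    IsNilpotent (∑ s ∈ S, PiTensorProduct.map (R := ℂ) (s := fun _ : Fin r => V)
        (t := fun _ : Fin r => V) (Function.update (fun _ => LinearMap.id) s T) :
          Module.End ℂ (⨂[ℂ] _ : Fin r, V)) ∧
      IsNilpotent.exp (∑ s ∈ S, PiTensorProduct.map (R := ℂ) (s := fun _ : Fin r => V)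
        (t := fun _ : Fin r => V) (Function.update (fun _ => LinearMap.id) s T) :
          Module.End ℂ (⨂[ℂ] _ : Fin r, V)) =
        PiTensorProduct.map fun s => if s ∈ S then 1 + T else 1 := by
  set ι : Fin r → Module.End ℂ (⨂[ℂ] _ : Fin r, V) := fun s =>
    PiTensorProduct.map (Function.update (fun _ => LinearMap.id) s T) with hι
  have happly : ∀ s w, ι s (PiTensorProduct.tprod ℂ w) =
      PiTensorProduct.tprod ℂ (Function.update w s (T (w s))) := fun s w => map_update_tprod T s w
  have hTT : ∀ y, T (T y) = 0 := fun y => LinearMap.congr_fun hT y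
  have hsq : ∀ s, ι s ^ 2 = 0 := fun s => by
    rw [pow_two]
    refine PiTensorProduct.ext (MultilinearMap.ext fun w => ?_)
    simp only [LinearMap.compMultilinearMap_apply, Module.End.mul_apply, happly,
      Function.update_self, hTT, Function.update_idem, LinearMap.zero_apply]
    exact MultilinearMap.map_update_zero _ _ _
  have hcomm : ∀ s s', s ≠ s' → Commute (ι s) (ι s') := fun s s' h => by
    refine PiTensorProduct.ext (MultilinearMap.ext fun w => ?_)
    simp only [LinearMap.compMultilinearMap_apply, Module.End.mul_apply, happly,
      Function.update_of_ne h, Function.update_of_ne h.symm]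
    rw [Function.update_comm h]
  induction S using Finset.induction_on with
  | empty =>
    refine ⟨by simp, ?_⟩
    rw [Finset.sum_empty, IsNilpotent.exp_zero]
    simp
  | insert s S hs ih =>
    have hc : Commute (ι s) (∑ s' ∈ S, ι s') :=
      Commute.sum_right _ _ _ fun s' hs' => hcomm s s' fun h => hs (h ▸ hs')
    rw [Finset.sum_insert hs]
    refine ⟨hc.isNilpotent_add ⟨2, hsq s⟩ ih.1, ?_⟩
    rw [IsNilpotent.exp_add_of_commute hc ⟨2, hsq s⟩ ih.1, ih.2, exp_of_sq (hsq s)]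
    refine PiTensorProduct.ext (MultilinearMap.ext fun w => ?_)
    simp only [LinearMap.compMultilinearMap_apply, Module.End.mul_apply, LinearMap.add_apply,
      PiTensorProduct.map_tprod, happly, Module.End.one_apply]
    set z : Fin r → V := fun i => (if i ∈ S then 1 + T else 1) (w i) with hz
    have hzs : z s = w s := by simp [hz, hs]
    have h1 : (fun i => (if i ∈ insert s S then 1 + T else 1) (w i)) =
        Function.update z s (z s + T (z s)) := by
      funext i
      by_cases h : i = s
      · subst h; simp [hzs]
      · simp [h, hz]
    rw [h1, MultilinearMap.map_update_add, Function.update_eq_self]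

variable [Module ℚ V] [SMulCommClass ℂ ℚ V] [Module ℚ (⨂[ℂ] _ : Fin r, V)]

theorem x_tensorPower [SMulCommClass ℂ ℚ (⨂[ℂ] _ : Fin r, V)] {j : ℕ} (h : R.e j * R.e j = 0) (c : ℂ) :
    (R.tensorPower r).x j c = PiTensorProduct.map fun _ => R.x j c := by
  have hT : (c • R.e j) * (c • R.e j) = 0 := by rw [smul_mul_smul_comm, h, smul_zero]
  have h1 : c • (R.tensorPower r).e j = tensorPowerEnd r (c • R.e j) := by
    refine PiTensorProduct.ext (MultilinearMap.ext fun w => ?_)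
    change c • tensorPowerEnd r (R.e j) _ = tensorPowerEnd r (c • R.e j) _
    simp only [tensorPowerEnd_tprod, LinearMap.smul_apply, MultilinearMap.map_update_smul,
      Finset.smul_sum]
  rw [ChevalleyAction.x, h1, tensorPowerEnd, (exp_sum_factors hT Finset.univ).2, x_eq_of_sq h]
  simp

variable [SMulCommClass ℂ ℚ (⨂[ℂ] _ : Fin r, V)]

theorem x_alt {j : ℕ} (h : R.e j * R.e j = 0) (c : ℂ) (w : Fin r → V) :
    (R.tensorPower r).x j c (alt V r w) = alt V r fun s => R.x j c (w s) := by
  rw [x_tensorPower h, map_alt]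

theorem ascending_alt (q : ℕ) (h : ∀ j ∈ Finset.Icc 1 q, R.e j * R.e j = 0) (c : ℕ → ℂ)
    (w : Fin r → V) : ascending (R.tensorPower r) q c (alt V r w) =
      alt V r fun s => ascending R q c (w s) := by
  induction q generalizing w with
  | zero => rfl
  | succ q ih =>
    simp only [ascending_succ, Module.End.mul_apply]
    rw [x_alt (h _ (by simp)), ih fun j hj => h j (by simp at hj ⊢; omega)]

end TensorPower

/-! ### The vector representation of type C -/

section VectorRepresentation

variable {n : ℕ}

theorem vec_eq_single {t : Fin n} : vec n (t + 1) = Finsupp.single (Sum.inl t) 1 := by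
  simp [vec]

theorem vecBar_eq_single {t : Fin n} : vecBar n (t + 1) = Finsupp.single (Sum.inr t) 1 := by
  simp [vecBar]

theorem vecBar_eq {j : ℕ} (h1 : 1 ≤ j) (h2 : j ≤ n) :
    vecBar n j = Finsupp.single (Sum.inr ⟨j - 1, by omega⟩) 1 := dif_pos ⟨h1, h2⟩

theorem vec_eq {j : ℕ} (h1 : 1 ≤ j) (h2 : j ≤ n) :
    vec n j = Finsupp.single (Sum.inl ⟨j - 1, by omega⟩) 1 := dif_pos ⟨h1, h2⟩

theorem vectorC_e_vecBar {j l : ℕ} (h1 : 1 ≤ l) (h2 : l ≤ n) :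
    (vectorC n).e j (vecBar n l) =
      if l = j then (if j = n then vec n n else vecBar n (j + 1)) else 0 := by
  rw [vecBar_eq h1 h2]
  simp [vectorC, Nat.sub_add_cancel h1]

theorem vectorC_e_vec {j l : ℕ} (h1 : 1 ≤ l) (h2 : l ≤ n) :
    (vectorC n).e j (vec n l) = if j < n ∧ l = j + 1 then vec n j else 0 := by
  rw [vec_eq h1 h2]
  simp only [vectorC, Finsupp.linearCombination_single, one_smul, Nat.sub_add_cancel h1]

theorem vectorC_f_vecBar {j l : ℕ} (h1 : 1 ≤ l) (h2 : l ≤ n) :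
    (vectorC n).f j (vecBar n l) = if j < n ∧ l = j + 1 then vecBar n j else 0 := by
  rw [vecBar_eq h1 h2]
  simp only [vectorC, Finsupp.linearCombination_single, one_smul, Nat.sub_add_cancel h1]

/-- The weight `Λ_j - Λ_{j-1}` of `v_j`. -/
def wtVec (n j : ℕ) : Fin n → ℤ :=
  fun s => (if (s : ℕ) + 1 = j then 1 else 0) - (if (s : ℕ) + 2 = j then 1 else 0)

/-- The weights of the basis vectors of the vector representation. -/
def wtC : Fin n ⊕ Fin n → Fin n → ℤ
  | Sum.inl t => wtVec n (t + 1)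
  | Sum.inr t => -wtVec n (t + 1)

theorem single_mem_weightSpaceC (x : Fin n ⊕ Fin n) :
    Finsupp.single x (1 : ℂ) ∈ weightSpace (vectorC n) (wtC x) := by
  intro s
  rcases x with t | t
  · have e1 : ((t : ℕ) + 1 = s + 1) ↔ ((s : ℕ) + 1 = t + 1) := eq_comm
    have e2 : ((t : ℕ) = s + 1) ↔ ((s : ℕ) + 2 = t + 1) := by omega
    simp only [vectorC, Finsupp.linearCombination_single, one_smul, vec_eq_single, wtC, wtVec,
      e1, e2]
    push_cast
    rfl
  · have e1 : ((t : ℕ) + 1 = s + 1) ↔ ((s : ℕ) + 1 = t + 1) := eq_comm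
    have e2 : ((t : ℕ) = s + 1) ↔ ((s : ℕ) + 2 = t + 1) := by omega
    simp only [vectorC, Finsupp.linearCombination_single, one_smul, vecBar_eq_single, wtC, wtVec,
      e1, e2, Pi.neg_apply, neg_sub]
    push_cast
    rfl

theorem vecBar_mem_weightSpace {j : ℕ} (h1 : 1 ≤ j) (h2 : j ≤ n) :
    vecBar n j ∈ weightSpace (vectorC n) (-wtVec n j) := by
  have := single_mem_weightSpaceC (Sum.inr (⟨j - 1, by omega⟩ : Fin n))
  simp only [wtC, Nat.sub_add_cancel h1] at this
  rwa [vecBar_eq h1 h2]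

theorem isGraded_vectorC (n : ℕ) : IsGraded (cartanC n) (vectorC n) := by
  refine isGraded_of_basis wtC single_mem_weightSpaceC fun x t => ?_
  rcases x with u | u
  · rw [← vec_eq_single, vectorC_e_vec (by omega) (by omega)]
    split_ifs with h
    · refine Or.inr ⟨Sum.inl t, vec_eq_single, fun s => ?_⟩
      simp only [wtC, wtVec, cartanC, Matrix.of_apply, Fin.ext_iff]
      split_ifs <;> omega
    · exact Or.inl rfl
  · rw [← vecBar_eq_single, vectorC_e_vecBar (by omega) (by omega)]
    split_ifs with h h'
    · refine Or.inr ⟨Sum.inl t, ?_, fun s => ?_⟩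
      · rw [← vec_eq_single, h']
      simp only [wtC, wtVec, cartanC, Matrix.of_apply, Fin.ext_iff, Pi.neg_apply]
      split_ifs <;> omega
    · refine Or.inr ⟨Sum.inr ⟨t + 1, by omega⟩, ?_, fun s => ?_⟩
      · rw [← vecBar_eq_single]
      simp only [wtC, wtVec, cartanC, Matrix.of_apply, Fin.ext_iff, Pi.neg_apply]
      split_ifs <;> omega
    · exact Or.inl rfl

theorem vectorC_e_sq {j : ℕ} (hj : j ∈ Finset.Icc 1 n) :
    (vectorC n).e j * (vectorC n).e j = 0 := by
  obtain ⟨h1, h2⟩ := Finset.mem_Icc.1 hj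
  refine sq_eq_zero_of_basis _ fun x => ?_
  rcases x with u | u
  · rw [← vec_eq_single, vectorC_e_vec (by omega) (by omega)]
    split_ifs with h
    · rw [vectorC_e_vec h1 h2, if_neg (by omega)]
    · simp
  · rw [← vecBar_eq_single, vectorC_e_vecBar (by omega) (by omega)]
    split_ifs with h h'
    · rw [vectorC_e_vec (by omega) le_rfl, if_neg (by omega)]
    · rw [vectorC_e_vecBar (by omega) (by omega), if_neg (by omega)]
    · simp

theorem x_vecBar_of_ne {j l : ℕ} (hj : j ∈ Finset.Icc 1 n) (h1 : 1 ≤ l) (h2 : l ≤ n)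
    (h : l ≠ j) (c : ℂ) : (vectorC n).x j c (vecBar n l) = vecBar n l := by
  rw [x_apply_of_sq (vectorC_e_sq hj), vectorC_e_vecBar h1 h2, if_neg h, smul_zero, add_zero]

theorem x_vecBar_self {j : ℕ} (h1 : 1 ≤ j) (h2 : j < n) (c : ℂ) :
    (vectorC n).x j c (vecBar n j) = vecBar n j + c • vecBar n (j + 1) := by
  rw [x_apply_of_sq (vectorC_e_sq (by simp; omega)), vectorC_e_vecBar h1 h2.le, if_pos rfl,
    if_neg h2.ne]

theorem ascending_vecBar_of_lt (c : ℕ → ℂ) {r j : ℕ} (hj : r < j) (hjn : j ≤ n) :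
    ascending (vectorC n) r c (vecBar n j) = vecBar n j := by
  induction r with
  | zero => rfl
  | succ r ih =>
    rw [ascending_succ, Module.End.mul_apply,
      x_vecBar_of_ne (by simp; omega) (by omega) hjn (by omega), ih (by omega)]

/-- The factors with numbers above `j` act first and fix `v_{\bar j}`. After `x_j` both `v_{\bar j}`
and `v_{\overline{j+1}}` are fixed by the factors with smaller numbers. -/
theorem ascending_vecBar (c : ℕ → ℂ) {r j : ℕ} (h1 : 1 ≤ j) (hj : j ≤ r) (hr : r < n) :
    ascending (vectorC n) r c (vecBar n j) = (vectorC n).x j (c j) (vecBar n j) := by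
  induction r with
  | zero => omega
  | succ r ih =>
    rw [ascending_succ, Module.End.mul_apply]
    rcases hj.lt_or_eq with h | rfl
    · rw [x_vecBar_of_ne (by simp; omega) h1 (by omega) (by omega), ih (by omega) (by omega)]
    · rw [x_vecBar_self (by omega) hr, map_add, map_smul,
        ascending_vecBar_of_lt c (by omega) hr.le, ascending_vecBar_of_lt c (by omega) hr]

/-- The rightmost factor acts first and takes `v_{r+1}` to `v_r`, so in the leading term every
factor raises by one step. The input is general because it changes at each step of the induction. -/
theorem LT_ascending_vec {m : ℕ} (b : ℕ → ℂ) (r : ℕ) (hr : r ≤ m) :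
    ∀ (μ : Fin (m + 1) → ℤ) (κ : Fin (m + 1) → ℕ) (y : VecC (m + 1)) (c : ℂ),
      LT (cartanC (m + 1)) (vectorC (m + 1)) μ κ y (c • vec (m + 1) (r + 1)) →
      LT (cartanC (m + 1)) (vectorC (m + 1)) μ (κ + ∑ t ∈ Finset.Icc 1 r, node (m + 1) t)
        (ascending (vectorC (m + 1)) r b y)
        (((∏ j ∈ Finset.Icc 1 r, b j) * c) • vec (m + 1) 1) := by
  induction r with
  | zero =>
    intro μ κ y c h
    simpa [ascending] using h
  | succ r ih =>
    intro μ κ y c h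
    have hmem : r + 1 ∈ Finset.Icc 1 (m + 1) := by simp; omega
    have h1 := h.x_apply (isGraded_vectorC _) hmem (vectorC_e_sq hmem) (b (r + 1))
    rw [map_smul, vectorC_e_vec (by omega) (by omega), if_pos ⟨by omega, rfl⟩, smul_smul] at h1
    have h2 := ih (by omega) _ _ _ _ h1
    rw [ascending_succ, Module.End.mul_apply, Finset.sum_Icc_succ_top (by omega),
      Finset.prod_Icc_succ_top (by omega), mul_assoc, add_comm (∑ _ ∈ _, _), ← add_assoc]
    exact h2

end VectorRepresentation

/-! ### Type `C_n` -/

section TypeC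

variable {n : ℕ}

/-- The sequence `v_{\bar i}, …, v_{\bar 1}`. -/
def barSeq (n i : ℕ) : Fin i → VecC n := fun s => vecBar n ((Fin.rev s : ℕ) + 1)

theorem lowC_eq_alt (n i : ℕ) : lowC n i = alt (VecC n) i (barSeq n i) := by
  rw [alt_apply, lowC]
  -- Both descriptions differ by conjugation with the reversal, which preserves signs.
  refine Fintype.sum_equiv Fin.revPerm.permCongr _ _ fun σ => ?_
  rw [Equiv.Perm.sign_permCongr]
  congr 2
  funext s
  simp [barSeq]

theorem shiftC_vecBar {m j : ℕ} (h1 : 1 ≤ j) (h2 : j ≤ m) :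
    shiftC m (vecBar m j) = vecBar (m + 1) (j + 1) := by
  rw [vecBar_eq h1 h2]
  simp only [shiftC, Finsupp.linearCombination_single, one_smul]
  congr 1
  omega

/-- The sequence `v_1, v_{\overline{k+1}}, …, v_{\bar 2}`. -/
def leadSeq (m k : ℕ) : Fin (k + 1) → VecC (m + 1) :=
  Fin.cons (vec (m + 1) 1) fun s : Fin k => vecBar (m + 1) ((Fin.rev s : ℕ) + 2)

theorem leadC_eq_alt {m k : ℕ} (hk : k ≤ m) :
    leadC m k = alt (VecC (m + 1)) (k + 1) (leadSeq m k) := by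
  rw [leadC, lowC_eq_alt]
  have : PiTensorProduct.map (fun _ => shiftC m) (alt (VecC m) k (barSeq m k)) =
      alt (VecC (m + 1)) k fun s => vecBar (m + 1) ((Fin.rev s : ℕ) + 2) := by
    simp only [alt_apply, map_sum, map_smul, PiTensorProduct.map_tprod]
    refine Finset.sum_congr rfl fun σ _ => ?_
    congr 2
    funext s
    exact shiftC_vecBar (by omega) (by omega)
  rw [this]
  exact sum_insertFactor_alt _ _

theorem lowC_ne_zero {i : ℕ} (hi : i ≤ n) : lowC n i ≠ 0 := by
  rw [lowC_eq_alt]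
  have : barSeq n i = fun s =>
      Finsupp.single (Sum.inr (⟨(Fin.rev s : ℕ), by omega⟩ : Fin n) : Fin n ⊕ Fin n) 1 := by
    funext s
    exact vecBar_eq_single (t := ⟨(Fin.rev s : ℕ), by omega⟩)
  rw [this]
  refine alt_ne_zero _ fun s s' h => Fin.rev_injective (Fin.ext ?_)
  simpa using h

theorem leadC_ne_zero {m k : ℕ} (hk : k ≤ m) : leadC m k ≠ 0 := by
  rw [leadC_eq_alt hk]
  set x : Fin (k + 1) → Fin (m + 1) ⊕ Fin (m + 1) :=
    Fin.cons (Sum.inl 0) fun s : Fin k => Sum.inr ⟨(Fin.rev s : ℕ) + 1, by omega⟩ with hx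
  have : leadSeq m k = fun s => Finsupp.single (x s) 1 := by
    funext s
    refine Fin.cases ?_ (fun s => ?_) s
    · exact vec_eq_single (t := 0)
    · exact vecBar_eq_single (t := ⟨(Fin.rev s : ℕ) + 1, by omega⟩)
  rw [this]
  refine alt_ne_zero _ fun s s' => ?_
  refine Fin.cases ?_ (fun s => ?_) s <;> refine Fin.cases ?_ (fun s' => ?_) s'
  · simp
  · simp [hx]
  · simp [hx]
  · intro h
    have h1 : (Fin.rev s : ℕ) = Fin.rev s' := by
      simpa only [hx, Fin.cons_succ, Sum.inr.injEq, Fin.mk.injEq, add_left_inj] using h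
    rw [Fin.rev_injective (Fin.ext h1)]

theorem sum_wtVec (n i : ℕ) :
    ∑ s : Fin i, -wtVec n ((Fin.rev s : ℕ) + 1) = negFundamental n i := by
  rw [← Equiv.sum_comp Fin.revPerm]
  simp only [Fin.revPerm_apply, Fin.rev_rev]
  rw [Fin.sum_univ_eq_sum_range (fun s => -wtVec n (s + 1)) i]
  induction i with
  | zero => ext s; simp [negFundamental]
  | succ i ih =>
    rw [Finset.sum_range_succ, ih]
    ext s
    simp only [negFundamental, wtVec, Pi.add_apply, Pi.neg_apply]
    split_ifs <;> omega

theorem isLowestWeightVector_lowC {i : ℕ} (hi : i ≤ n) :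
    ((vectorC n).tensorPower i).IsLowestWeightVector (negFundamental n i) (lowC n i) := by
  refine ⟨⟨lowC_ne_zero hi, mem_weightSpace.1 ?_⟩, fun j hj => ?_⟩
  · rw [lowC_eq_alt, ← sum_wtVec]
    exact alt_mem_weightSpace _ _ fun s => vecBar_mem_weightSpace (by omega) (by omega)
  · obtain ⟨h1, h2⟩ := Finset.mem_Icc.1 hj
    rw [lowC_eq_alt]
    change tensorPowerEnd i ((vectorC n).f j) _ = 0
    rw [tensorPowerEnd_alt]
    refine Finset.sum_eq_zero fun s _ => ?_
    rw [barSeq, vectorC_f_vecBar (by omega) (by omega)]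
    split_ifs with h
    -- If `f_j` acts nontrivially, it produces `v_{\bar j}`, which already stands one place further
    -- on.
    · have hs := Fin.val_rev s
      obtain ⟨s', hs', hne⟩ : ∃ s' : Fin i, (Fin.rev s' : ℕ) + 1 = j ∧ s ≠ s' := by
        refine ⟨⟨s + 1, by omega⟩, ?_, ?_⟩
        · rw [Fin.val_rev]; simp only; omega
        · simp [Fin.ext_iff]
      have : vecBar n j = barSeq n i s' := by rw [barSeq, hs']
      rw [this]
      exact AlternatingMap.map_update_self _ _ hne
    · exact AlternatingMap.map_update_zero _ _ _

/-- The added vector `v_{\overline{j+1}}` already occurs in the sequence because `j < i`, so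
antisymmetrization removes it. -/
theorem alt_x_barSeq {i j : ℕ} (h1 : 1 ≤ j) (hj : j < i) (hi : i ≤ n) (c : ℂ) :
    (alt (VecC n) i fun s => (vectorC n).x j c (barSeq n i s)) = alt (VecC n) i (barSeq n i) := by
  set s₀ : Fin i := ⟨i - j, by omega⟩ with hs₀
  set s₁ : Fin i := ⟨i - j - 1, by omega⟩ with hs₁
  have e0 : barSeq n i s₀ = vecBar n j := by
    rw [barSeq, Fin.val_rev]; congr 1; simp only [hs₀]; omega
  have e1 : barSeq n i s₁ = vecBar n (j + 1) := by
    rw [barSeq, Fin.val_rev]; congr 1; simp only [hs₁]; omega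
  have hne : s₀ ≠ s₁ := by simp [hs₀, hs₁, Fin.ext_iff]; omega
  have : (fun s => (vectorC n).x j c (barSeq n i s)) =
      Function.update (barSeq n i) s₀ (barSeq n i s₀ + c • barSeq n i s₁) := by
    funext s
    by_cases hs : s = s₀
    · rw [hs, Function.update_self, e0, e1, x_vecBar_self h1 (by omega)]
    · rw [Function.update_of_ne hs]
      refine x_vecBar_of_ne (by simp; omega) (by omega) (by omega) (fun h => hs ?_) c
      rw [Fin.val_rev] at h
      ext
      simp only [hs₀]
      omega
  rw [this, AlternatingMap.map_update_add, AlternatingMap.map_update_smul,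
    AlternatingMap.map_update_self _ _ hne, Function.update_eq_self, smul_zero, add_zero]

theorem descending_lowC {i r : ℕ} (hr : r < i) (hi : i ≤ n) (a : ℕ → ℂ) :
    descending ((vectorC n).tensorPower i) r a (lowC n i) = lowC n i := by
  induction r with
  | zero => rfl
  | succ r ih =>
    rw [descending_succ, Module.End.mul_apply, ih (by omega), lowC_eq_alt,
      x_alt (vectorC_e_sq (by simp; omega)), alt_x_barSeq (by omega) hr hi]

/-- Behind the first `k` steps the descending word only moves the first factor. -/
theorem LT_descending_lowC {m k : ℕ} (a : ℕ → ℂ) (d : ℕ) (hd : k + d ≤ m + 1) (hk : k ≤ m) :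
    ∃ y, descending ((vectorC (m + 1)).tensorPower (k + 1)) (k + d) a (lowC (m + 1) (k + 1)) =
        alt (VecC (m + 1)) (k + 1) (Function.update (barSeq (m + 1) (k + 1)) 0 y) ∧
      LT (cartanC (m + 1)) (vectorC (m + 1)) (-wtVec (m + 1) (k + 1))
        (∑ t ∈ Finset.Ico (k + 1) (k + d + 1), node (m + 1) t) y
        ((∏ t ∈ Finset.Ico (k + 1) (k + d + 1), a t) •
          if k + d ≤ m then vecBar (m + 1) (k + d + 1) else vec (m + 1) (m + 1)) := by
  induction d with
  | zero =>
    -- The first `k` steps fix the lowest weight vector, whose first factor is `v_{\overline{k+1}}`.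
    refine ⟨vecBar (m + 1) (k + 1), ?_, ?_⟩
    · have h0 : vecBar (m + 1) (k + 1) = barSeq (m + 1) (k + 1) 0 := by
        rw [barSeq, Fin.val_rev]; congr 1
      rw [h0, Function.update_eq_self, ← lowC_eq_alt]
      exact descending_lowC (by omega) (by omega) a
    · simpa [hk] using LT.of_mem (A := cartanC (m + 1))
        (vecBar_mem_weightSpace (n := m + 1) (j := k + 1) (by omega) (by omega))
  | succ d ih =>
    obtain ⟨y, h1, h2⟩ := ih (by omega)
    have hmem : k + d + 1 ∈ Finset.Icc 1 (m + 1) := by simp; omega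
    refine ⟨(vectorC (m + 1)).x (k + d + 1) (a (k + d + 1)) y, ?_, ?_⟩
    · rw [← add_assoc, descending_succ, Module.End.mul_apply, h1, x_alt (vectorC_e_sq hmem)]
      congr 1
      funext s
      refine Fin.cases ?_ (fun s => ?_) s
      · simp
      · rw [Function.update_of_ne (Fin.succ_ne_zero s), Function.update_of_ne (Fin.succ_ne_zero s)]
        -- The remaining factors have labels at most `k`, below the number `k + d + 1` of the step.
        refine x_vecBar_of_ne hmem (by omega) (by omega) ?_ _
        rw [Fin.val_rev, Fin.val_succ]
        omega
    · have h3 := h2.x_apply (isGraded_vectorC _) hmem (vectorC_e_sq hmem) (a (k + d + 1))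
      rw [if_pos (by omega), map_smul, vectorC_e_vecBar (by omega) (by omega), if_pos rfl,
        smul_smul, mul_comm] at h3
      rw [← add_assoc, Finset.sum_Ico_succ_top (by omega), Finset.prod_Ico_succ_top (by omega)]
      convert h3 using 2
      by_cases h : k + d + 1 ≤ m
      · rw [if_pos h, if_neg (by omega)]
      · rw [if_neg h, if_pos (by omega)]

/-- The first factor collects all `b_j` and the `a_j` with `j > k`, and the factors `v_{\bar j}`
with `j ≤ k` collect `b_j` a second time. The degree is chosen before the parameters so that these
can be set to one to find the weight of the leading vector. -/
theorem LT_lowC {m k : ℕ} (hk : k ≤ m) : ∃ κ : Fin (m + 1) → ℕ, ∀ a b : ℕ → ℂ,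
    LT (cartanC (m + 1)) ((vectorC (m + 1)).tensorPower (k + 1))
      (negFundamental (m + 1) (k + 1)) κ
      (wordBC ((vectorC (m + 1)).tensorPower (k + 1)) (m + 1) a b (lowC (m + 1) (k + 1)))
      (((∏ j ∈ Finset.Icc 1 k, b j) ^ 2 * (∏ j ∈ Finset.Icc (k + 1) m, b j) *
          ∏ j ∈ Finset.Icc (k + 1) (m + 1), a j) • leadC m k) := by
  refine ⟨∑ s : Fin (k + 1), (Fin.cons
    (∑ t ∈ Finset.Ico (k + 1) (m + 2), node (m + 1) t + ∑ t ∈ Finset.Icc 1 m, node (m + 1) t)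
    (fun s : Fin k => node (m + 1) ((Fin.rev s : ℕ) + 1)) : Fin (k + 1) → Fin (m + 1) → ℕ) s,
    fun a b => ?_⟩
  obtain ⟨y, h1, h2⟩ := LT_descending_lowC (k := k) a (m + 1 - k) (by omega) hk
  rw [show k + (m + 1 - k) = m + 1 by omega] at h1 h2
  rw [if_neg (by omega)] at h2
  have h3 := LT_ascending_vec b m le_rfl _ _ _ _ h2
  rw [wordBC, Module.End.mul_apply, h1, Nat.add_sub_cancel,
    ascending_alt _ fun j hj => vectorC_e_sq (by simp at hj ⊢; omega), leadC_eq_alt hk,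
    ← sum_wtVec]
  set C : ℂ := (∏ j ∈ Finset.Icc 1 m, b j) * ∏ t ∈ Finset.Ico (k + 1) (m + 2), a t with hC
  have hcoef : (∏ j ∈ Finset.Icc 1 k, b j) ^ 2 * (∏ j ∈ Finset.Icc (k + 1) m, b j) *
      ∏ j ∈ Finset.Icc (k + 1) (m + 1), a j =
      ∏ s : Fin (k + 1), (Fin.cons C (fun s : Fin k => b ((Fin.rev s : ℕ) + 1)) :
        Fin (k + 1) → ℂ) s := by
    rw [Fin.prod_univ_succ]
    simp only [Fin.cons_zero, Fin.cons_succ]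
    rw [← Equiv.prod_comp Fin.revPerm]
    simp only [Fin.revPerm_apply, Fin.rev_rev]
    rw [Fin.prod_univ_eq_prod_range (fun s => b (s + 1)) k, Finset.range_eq_Ico,
      Finset.prod_Ico_add' b 0 k 1, hC,
      show Finset.Icc 1 m = Finset.Ico 1 (m + 1) from rfl,
      ← Finset.prod_Ico_consecutive b (show 1 ≤ k + 1 by omega) (show k + 1 ≤ m + 1 by omega),
      show Finset.Icc 1 k = Finset.Ico 1 (k + 1) from rfl,
      show Finset.Icc (k + 1) m = Finset.Ico (k + 1) (m + 1) from rfl,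
      show Finset.Icc (k + 1) (m + 1) = Finset.Ico (k + 1) (m + 2) from rfl, zero_add]
    ring
  -- The coefficient is distributed over the factors, so that leading terms can be compared factor
  -- by factor.
  have hlead : (∏ s : Fin (k + 1), (Fin.cons C (fun s : Fin k => b ((Fin.rev s : ℕ) + 1)) :
        Fin (k + 1) → ℂ) s) • alt (VecC (m + 1)) (k + 1) (leadSeq m k) =
      alt (VecC (m + 1)) (k + 1) fun s => (Fin.cons C (fun s : Fin k => b ((Fin.rev s : ℕ) + 1)) :
        Fin (k + 1) → ℂ) s • leadSeq m k s :=
    ((alt (VecC (m + 1)) (k + 1)).toMultilinearMap.map_smul_univ _ _).symm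
  rw [hcoef, hlead]
  have hF (μ : Fin (k + 1) → Fin (m + 1) → ℤ) (w : Fin (k + 1) → VecC (m + 1))
      (h : ∀ s, w s ∈ weightSpace (vectorC (m + 1)) (μ s)) :
      (alt (VecC (m + 1)) (k + 1)).toMultilinearMap w ∈
        weightSpace ((vectorC (m + 1)).tensorPower (k + 1)) (∑ s, μ s) :=
    alt_mem_weightSpace μ w h
  refine LT.multilinear _ hF fun s => ?_
  refine Fin.cases ?_ (fun s => ?_) s
  · simp only [Function.update_self, Fin.cons_zero, leadSeq]
    convert h3 using 2
    simp
  · have hmem : (Fin.rev s : ℕ) + 1 ∈ Finset.Icc 1 (m + 1) := by simp; omega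
    have hrev : (Fin.rev s.succ : ℕ) = Fin.rev s := by
      rw [Fin.val_rev, Fin.val_rev, Fin.val_succ]; omega
    rw [Function.update_of_ne (Fin.succ_ne_zero s)]
    simp only [Fin.cons_succ, leadSeq, barSeq, hrev]
    rw [ascending_vecBar b (by omega) (by omega) (by omega)]
    have h4 := (LT.of_mem (A := cartanC (m + 1))
      (vecBar_mem_weightSpace (n := m + 1) (j := (Fin.rev s : ℕ) + 1) (by omega)
      (by omega))).x_apply (isGraded_vectorC _) hmem (vectorC_e_sq hmem) (b ((Fin.rev s : ℕ) + 1))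
    rwa [zero_add, vectorC_e_vecBar (by omega) (by omega), if_pos rfl, if_neg (by omega)] at h4

theorem hasLeadingTerm_lowC {m k : ℕ} (hk : k ≤ m) (a b : ℕ → ℂ) :
    HasLeadingTerm (cartanC (m + 1)) ((vectorC (m + 1)).tensorPower (k + 1))
        (lowC (m + 1) (k + 1))
        (wordBC ((vectorC (m + 1)).tensorPower (k + 1)) (m + 1) a b)
        ((∏ j ∈ Finset.Icc 1 k, b j) ^ 2 * (∏ j ∈ Finset.Icc (k + 1) m, b j) *
          ∏ j ∈ Finset.Icc (k + 1) (m + 1), a j)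
        (leadC m k) := by
  obtain ⟨κ, h⟩ := LT_lowC hk
  exact hasLeadingTerm_of_LT (irrefl_cartanC _) (wordBC_mem_generated _ _ _ _ _) (h a b)
    (by simpa using (h 1 1).1) (leadC_ne_zero hk)

end TypeC

end FundamentalRep

end

open FundamentalRep in
/-- The rank is `n = m + 1` and the index of the fundamental weight is `i = k + 1`. -/
theorem lemma6p2 (m k : ℕ) (hk : 1 ≤ k) (a b : ℕ → ℂ) :
    -- type `B_n`, `i < n`
    (k < m →
      (spinB (m + 1)).tensorSquare.IsLowestWeightVector
        (negFundamental (m + 1) (k + 1)) (lowB (m + 1) (k + 1)) ∧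
      HasLeadingTerm (cartanB (m + 1)) (spinB (m + 1)).tensorSquare (lowB (m + 1) (k + 1))
        (wordBC (spinB (m + 1)).tensorSquare (m + 1) a b)
        ((∏ j ∈ Finset.Icc 1 k, b j) ^ 2 * (∏ j ∈ Finset.Icc (k + 1) m, b j) *
          a (m + 1) ^ 2 * ∏ j ∈ Finset.Icc (k + 1) m, a j)
        (plusTensor m (lowB m k))) ∧
    -- type `B_n`, `i = n`
    (k = m →
      (spinB (m + 1)).IsLowestWeightVector
        (negFundamental (m + 1) (m + 1)) (lowSpinB (m + 1)) ∧
      HasLeadingTerm (cartanB (m + 1)) (spinB (m + 1)) (lowSpinB (m + 1))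
        (wordBC (spinB (m + 1)) (m + 1) a b)
        ((∏ j ∈ Finset.Icc 1 m, b j) * a (m + 1))
        (plus m (lowSpinB m))) ∧
    -- type `C_n`, `i ≤ n`
    (k ≤ m →
      ((vectorC (m + 1)).tensorPower (k + 1)).IsLowestWeightVector
        (negFundamental (m + 1) (k + 1)) (lowC (m + 1) (k + 1)) ∧
      HasLeadingTerm (cartanC (m + 1)) ((vectorC (m + 1)).tensorPower (k + 1))
        (lowC (m + 1) (k + 1))
        (wordBC ((vectorC (m + 1)).tensorPower (k + 1)) (m + 1) a b)
        ((∏ j ∈ Finset.Icc 1 k, b j) ^ 2 * (∏ j ∈ Finset.Icc (k + 1) m, b j) *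
          ∏ j ∈ Finset.Icc (k + 1) (m + 1), a j)
        (leadC m k)) ∧
    -- type `D_n`, `i ≤ n - 2`
    (k + 2 ≤ m →
      (spinD (m + 1)).tensorSquare.IsLowestWeightVector
        (negFundamental (m + 1) (k + 1)) (lowD (m + 1) (k + 1)) ∧
      HasLeadingTerm (cartanD (m + 1)) (spinD (m + 1)).tensorSquare (lowD (m + 1) (k + 1))
        (wordD (spinD (m + 1)).tensorSquare (m + 1) a b)
        ((∏ j ∈ Finset.Icc 1 k, b j) ^ 2 * (∏ j ∈ Finset.Icc (k + 1) m, b j) *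
          ∏ j ∈ Finset.Icc (k + 1) m, a j)
        (plusTensor m (lowD m k))) ∧
    -- type `D_n`, `i = n - 1`
    (k + 1 = m →
      (spinD (m + 1)).IsLowestWeightVector
        (negFundamental (m + 1) (if Even (m + 1) then m else m + 1)) (lowSpinD' (m + 1)) ∧
      HasLeadingTerm (cartanD (m + 1)) (spinD (m + 1)) (lowSpinD' (m + 1))
        (wordD (spinD (m + 1)) (m + 1) a b)
        ((∏ j ∈ Finset.Icc 1 (m - 1), b j) * if Even (m + 1) then a m else b m)
        (plus m (lowSpinD' m))) ∧
    -- type `D_n`, `i = n`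
    (k = m →
      (spinD (m + 1)).IsLowestWeightVector
        (negFundamental (m + 1) (if Even (m + 1) then m + 1 else m)) (lowSpinD (m + 1)) ∧
      HasLeadingTerm (cartanD (m + 1)) (spinD (m + 1)) (lowSpinD (m + 1))
        (wordD (spinD (m + 1)) (m + 1) a b)
        ((∏ j ∈ Finset.Icc 1 (m - 1), b j) * if Even (m + 1) then b m else a m)
        (plus m (lowSpinD m))) := by
  refine ⟨fun h => ?_, fun h => ?_, fun h => ?_, fun h => ?_, fun h => ?_, fun h => ?_⟩
  · exact ⟨isLowestWeightVector_lowB (by omega) (by omega), hasLeadingTerm_lowB h a b⟩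
  · exact ⟨isLowestWeightVector_lowSpinB m, hasLeadingTerm_lowSpinB (by omega) a b⟩
  · exact ⟨isLowestWeightVector_lowC (by omega), hasLeadingTerm_lowC h a b⟩
  -- The statements for type `D` are proved in rank `m + 2`, which contains the two nodes of the
  -- fork.
  · obtain ⟨m, rfl⟩ : ∃ m', m = m' + 1 := ⟨m - 1, by omega⟩
    exact ⟨isLowestWeightVector_lowD (by omega) (by omega), hasLeadingTerm_lowD (by omega) a b⟩
  · obtain ⟨m, rfl⟩ : ∃ m', m = m' + 1 := ⟨m - 1, by omega⟩
    -- The parity of the rank decides which of the two sequences `(-, …, -, ±)` is meant, and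
    -- passing to one rank less reverses both the parity and the last sign.
    by_cases hm : Even (m + 1)
    · have hm' : ¬ Even (m + 1 + 1) := by simpa [Nat.even_add_one] using hm
      simpa [lowSpinD', hm, hm', allMinus_eq, lastPlus_eq] using
        And.intro (isLowestWeightVector_minusSigns m (-1)) (hasLeadingTerm_minusSigns m (-1) a b)
    · have hm' : Even (m + 1 + 1) := by simpa [Nat.even_add_one] using hm
      simpa [lowSpinD', hm, hm', allMinus_eq, lastPlus_eq] using
        And.intro (isLowestWeightVector_minusSigns m 1) (hasLeadingTerm_minusSigns m 1 a b)
  · obtain ⟨m, rfl⟩ : ∃ m', m = m' + 1 := ⟨m - 1, by omega⟩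
    by_cases hm : Even (m + 1)
    · have hm' : ¬ Even (m + 1 + 1) := by simpa [Nat.even_add_one] using hm
      simpa [lowSpinD, hm, hm', allMinus_eq, lastPlus_eq] using
        And.intro (isLowestWeightVector_minusSigns m 1) (hasLeadingTerm_minusSigns m 1 a b)
    · have hm' : Even (m + 1 + 1) := by simpa [Nat.even_add_one] using hm
      simpa [lowSpinD, hm, hm', allMinus_eq, lastPlus_eq] using
        And.intro (isLowestWeightVector_minusSigns m (-1)) (hasLeadingTerm_minusSigns m (-1) a b)
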